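/- Let $\mathbf C$ be an infinitary pretopos (an exact category with small coproducts that are disjoint and universal) and let $K$ be a commutative ring object of $\mathbf C$, not necessarily with a unit, which is weakly unital. The latter means that there is a subobject $\mathcal E \subseteq K$ (a weak unit) closed under multiplication such that the multiplication morphisms $\mathcal E \times \mathcal E \to \mathcal E$ and $K \times \mathcal E \to K$ are epimorphisms and, in the internal language of $\mathbf C$, any two elements of $\mathcal E$ have a common divisor (for $a, b \in \mathcal E$ there are $a', b', d \in \mathcal E$ with $a = a' d$ and $b = b' d$), and if $m e = 0$ for $m \in K$ and $e \in \mathcal E$, then $e = e' e''$ and $m e' = 0$ for some $e', e'' \in \mathcal E$. Let $\mathsf D_4 = \{\pm \mathrm e_i \pm \mathrm e_j \mid 1 \le i < j \le 4\}$, and let $\mathrm{St}(\mathsf D_4, K)$ be the group object with generators $x_\alpha(p)$ for $\alpha \in \mathsf D_4$ and $p \in K$, and with the relations $x_\alpha(p)\, x_\alpha(q) = x_\alpha(p + q)$, $[x_\alpha(p), x_\beta(q)] = x_{\alpha + \beta}(N_{\alpha\beta}\, p q)$ if $\alpha + \beta \in \mathsf D_4$, and $[x_\alpha(p), x_\beta(q)]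 = 1$ if $\alpha + \beta \notin \mathsf D_4 \cup \{0\}$. Here $[g, h] = g h g^{-1} h^{-1}$ and $N_{\alpha\beta} \in \{\pm 1\}$ are the structure constants of the split Lie algebra of type $\mathsf D_4$ over $\mathbb Z$ with respect to any choice of generators of the root spaces. Let $\kappa \colon \widetilde{\mathrm{St}} \to \mathrm{St}(\mathsf D_4, K)$ be the universal central extension, let $\mathrm M = \operatorname{Ker} \kappa$ be the Schur multiplier, and let $\langle g, h \rangle \in \widetilde{\mathrm{St}}$ be the commutator of arbitrary preimages of $g$ and $h$ under $\kappa$. Put $$K_{2\varepsilon} = K / \langle 2p,\ (p^2 - p)(q^2 - q) \rangle, \qquad I = \langle p^2 - p \rangle \trianglelefteq K_{2\varepsilon}, \qquad K_2 = K_{2\varepsilon} / I,$$ where $\langle X \rangle$ is the ideal generated by $X$, so $K_2$ is the universal Boolean quotient of $K$. The following three sets are the orbits of $\mathrm W(\mathsf D_4)$ on the short roots of $\mathsf F_4$: $$O_0 = \{\pm \mathrm e_i\}, \qquad O_\pm = \bigl\{ \tfrac12 \textstyle\sum_i s_i \mathrm e_i \bigm| s_i \in \{-1, 1\},\ \prod_i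 s_i = \pm 1 \bigr\}.$$ Then for every $o \in \{0, +, -\}$ there is a unique homomorphism $c_o \colon K_{2\varepsilon} \to \mathrm M$ from the additive group such that $\langle x_\alpha(p), x_\beta(q) \rangle = c_o(p q)$ for all $p, q \in K$ and all orthogonal roots $\alpha, \beta \in \mathsf D_4$ with $\frac12(\alpha + \beta) \in O_o$. The Schur multiplier $\mathrm M$ is the product of the images of $c_0$, $c_+$, $c_-$. Moreover, the projection $K_{2\varepsilon} \to K_2$ has a section which is a ring homomorphism and which sends the class of $p$ to $p^2$, so $K_{2\varepsilon} = I \rtimes K_2$, and $$c_0(p) = c_+(p) = c_-(p) \quad \text{for } p \in I, \qquad c_0(q)\, c_+(q)\, c_-(q) = 1 \quad \text{for } q \in K_2.$$ -/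

import Mathlib

open CategoryTheory Limits MonoidalCategory CartesianMonoidalCategory
open scoped MonObj AddMonObj commutatorElement

universe v u

namespace SteinbergD4

/-! ## Infinitary pretopoi -/

/-- An infinitary pretopos: a regular category (finite limits, coequalizers of kernel pairs,
pullback-stable regular epimorphisms) in which all internal equivalence relations are effective
and which has all small coproducts, these being disjoint and universal (van Kampen).

In such a category every epimorphism is regular, so below epimorphisms, which also interpret the
existential quantifier of the internal language, are spelled as regular epimorphisms. -/
class InfinitaryPretopos (C : Type u) [Category.{v} C] : Prop extends Regular C where
  hasCoproducts : HasCoproducts.{v} C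
  isVanKampen_coproduct : ∀ {J : Type v} (X : J → C) (c : Cofan X),
    Nonempty (IsColimit c) → IsVanKampenColimit c
  isEffective : ∀ {R X : C} (p₁ p₂ : R ⟶ X), IsEquivalenceRelation p₁ p₂ →
    IsEffectiveEquivalenceRelation p₁ p₂

variable {C : Type u} [Category.{v} C] [CartesianMonoidalCategory C]

/-! ## Non-unital commutative ring objects

Identities between terms are stated for generalized elements `T ⟶ R`. -/

/-- A commutative ring object, not necessarily with a unit. -/
class NonUnitalCommRingObj (R : C) extends AddGrpObj R where
  /-- the multiplication morphism -/
  mulHom : R ⊗ R ⟶ R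
  add_comm' : ∀ {T : C} (a b : T ⟶ R), a + b = b + a
  mul_assoc' : ∀ {T : C} (a b c : T ⟶ R),
    lift (lift a b ≫ mulHom) c ≫ mulHom = lift a (lift b c ≫ mulHom) ≫ mulHom
  mul_comm' : ∀ {T : C} (a b : T ⟶ R), lift a b ≫ mulHom = lift b a ≫ mulHom
  mul_add' : ∀ {T : C} (a b c : T ⟶ R),
    lift a (b + c) ≫ mulHom = lift a b ≫ mulHom + lift a c ≫ mulHom

/-- The generalized elements of a non-unital commutative ring object form such a ring. -/
instance homNonUnitalCommRing {T R : C} [NonUnitalCommRingObj R] :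
    NonUnitalCommRing (T ⟶ R) :=
  have hr : ∀ a b c : T ⟶ R,
      lift (a + b) c ≫ NonUnitalCommRingObj.mulHom =
        lift a c ≫ NonUnitalCommRingObj.mulHom + lift b c ≫ NonUnitalCommRingObj.mulHom := by
    intro a b c
    rw [NonUnitalCommRingObj.mul_comm', NonUnitalCommRingObj.mul_add',
      NonUnitalCommRingObj.mul_comm' c a, NonUnitalCommRingObj.mul_comm' c b]
  { (inferInstance : AddGroup (T ⟶ R)) with
    add_comm := NonUnitalCommRingObj.add_comm'
    mul := fun a b => lift a b ≫ NonUnitalCommRingObj.mulHom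
    left_distrib := NonUnitalCommRingObj.mul_add'
    right_distrib := hr
    zero_mul := fun a => by
      have h := hr 0 0 a
      rw [add_zero] at h
      exact left_eq_add.mp h
    mul_zero := fun a => by
      have h := NonUnitalCommRingObj.mul_add' a 0 0
      rw [add_zero] at h
      exact left_eq_add.mp h
    mul_assoc := NonUnitalCommRingObj.mul_assoc'
    mul_comm := NonUnitalCommRingObj.mul_comm' }

theorem hom_mul_def {T R : C} [NonUnitalCommRingObj R] (a b : T ⟶ R) :
    a * b = lift a b ≫ NonUnitalCommRingObj.mulHom := rfl

theorem comp_mul_hom {S T R : C} [NonUnitalCommRingObj R] (f : S ⟶ T) (a b : T ⟶ R) :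
    f ≫ (a * b) = (f ≫ a) * (f ≫ b) := by
  simp only [hom_mul_def, ← Category.assoc, comp_lift]

/-- Homomorphisms of non-unital commutative ring objects. -/
structure IsRingObjHom {R S : C} [NonUnitalCommRingObj R] [NonUnitalCommRingObj S]
    (f : R ⟶ S) : Prop where
  map_add : ∀ {T : C} (a b : T ⟶ R), (a + b) ≫ f = a ≫ f + b ≫ f
  map_mul : ∀ {T : C} (a b : T ⟶ R), (a * b) ≫ f = (a ≫ f) * (b ≫ f)

/-- The monomorphism `j : E ⟶ K` is a weak unit of the commutative ring object `K`: a
multiplicative subsemigroup in which any two elements locally have a common divisor, with epic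
multiplication morphisms `E × E ⟶ E` and `K × E ⟶ K`, and such that `m e = 0` for `e` in `E`
implies that locally `e = e' e''` with `e', e''` in `E` and `m e' = 0`. -/
structure IsWeakUnit {E K : C} [NonUnitalCommRingObj K] (j : E ⟶ K) : Prop where
  mono : Mono j
  mul_epi : ∃ m : E ⊗ E ⟶ E, m ≫ j = (fst E E ≫ j) * (snd E E ≫ j) ∧ IsRegularEpi m
  smul_epi : IsRegularEpi (fst K E * (snd K E ≫ j))
  common_divisor : ∀ {T : C} (a b : T ⟶ E),
    ∃ (T' : C) (f : T' ⟶ T) (a' b' d : T' ⟶ E), IsRegularEpi f ∧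
      f ≫ a ≫ j = (a' ≫ j) * (d ≫ j) ∧ f ≫ b ≫ j = (b' ≫ j) * (d ≫ j)
  annihilator : ∀ {T : C} (m : T ⟶ K) (e : T ⟶ E), m * (e ≫ j) = 0 →
    ∃ (T' : C) (f : T' ⟶ T) (e' e'' : T' ⟶ E), IsRegularEpi f ∧
      f ≫ e ≫ j = (e' ≫ j) * (e'' ≫ j) ∧ (f ≫ m) * (e' ≫ j) = 0

/-- A commutative ring object is weakly unital if it has a weak unit. -/
def IsWeaklyUnital (K : C) [NonUnitalCommRingObj K] : Prop :=
  ∃ (E : C) (j : E ⟶ K), IsWeakUnit j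

/-- `J` is an ideal of `R`. -/
structure IsIdeal {R : C} [NonUnitalCommRingObj R] (J : Subobject R) : Prop where
  zero_mem : ∀ {T : C}, J.Factors (0 : T ⟶ R)
  add_mem : ∀ {T : C} (a b : T ⟶ R), J.Factors a → J.Factors b → J.Factors (a + b)
  neg_mem : ∀ {T : C} (a : T ⟶ R), J.Factors a → J.Factors (-a)
  mul_mem : ∀ {T : C} (r a : T ⟶ R), J.Factors a → J.Factors (r * a)

/-- `π : R ⟶ S` is the quotient of `R` by the ideal generated by the elements satisfying `P`. -/
structure IsQuotientBySpan {R S : C} [NonUnitalCommRingObj R] [NonUnitalCommRingObj S]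
    (P : ∀ T : C, (T ⟶ R) → Prop) (π : R ⟶ S) : Prop where
  isHom : IsRingObjHom π
  isRegularEpi : IsRegularEpi π
  relation : ∀ {T : C} (a : T ⟶ R), P T a → a ≫ π = 0
  ker_le : ∀ J : Subobject R, IsIdeal J → (∀ (T : C) (a : T ⟶ R), P T a → J.Factors a) →
    ∀ {T : C} (a : T ⟶ R), a ≫ π = 0 → J.Factors a

/-- The relators `2 p` and `(p ^ 2 - p) (q ^ 2 - q)`. -/
def TwoEpsRelator {R : C} [NonUnitalCommRingObj R] (T : C) (a : T ⟶ R) : Prop :=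
  (∃ p : T ⟶ R, a = p + p) ∨ ∃ p q : T ⟶ R, a = (p * p - p) * (q * q - q)

/-- The relators `2 p` and `p ^ 2 - p`. -/
def BooleanRelator {R : C} [NonUnitalCommRingObj R] (T : C) (a : T ⟶ R) : Prop :=
  (∃ p : T ⟶ R, a = p + p) ∨ ∃ p : T ⟶ R, a = p * p - p

/-! ## The root system of type D4 and the short roots of F4 -/

/-- The root system `D4`, consisting of the vectors `±e_i ± e_j` with `i < j`. -/
def rootsD4 : Set (Fin 4 → ℤ) :=
  {w | ∃ i j : Fin 4, i < j ∧ ∃ s t : ℤˣ, w = Pi.single i (s : ℤ) + Pi.single j (t : ℤ)}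

/-- Labels for the three orbits of the Weyl group of `D4` on the short roots of `F4`. -/
inductive Orbit
  | zero
  | plus
  | minus

/-- The orbits: `±e_i`, and the vectors with all coordinates `±1/2` with an even, respectively
odd, number of negative coordinates. -/
def Orbit.roots : Orbit → Set (Fin 4 → ℚ)
  | .zero => {g | ∃ (i : Fin 4) (s : ℤˣ), g = Pi.single i ((s : ℤ) : ℚ)}
  | .plus => {g | ∃ s : Fin 4 → ℤˣ, ∏ i, s i = 1 ∧ g = fun i => ((s i : ℤ) : ℚ) / 2}
  | .minus => {g | ∃ s : Fin 4 → ℤˣ, ∏ i, s i = -1 ∧ g = fun i => ((s i : ℤ) : ℚ) / 2}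

/-- The vector `(a + b) / 2`. -/
def halfSum (a b : Fin 4 → ℤ) : Fin 4 → ℚ := fun i => ((a i + b i : ℤ) : ℚ) / 2

/-- The weights `±e_i` of the natural representation of the orthogonal Lie algebra of rank 4. -/
def weight (k : Fin 4 × ℤˣ) : Fin 4 → ℤ := Pi.single k.1 (k.2 : ℤ)

/-- `X` is a generator of the root space with root `a` in the split orthogonal Lie algebra
over `ℤ`. With `i` and `j` the basis vectors of the natural representation such that
`weight i - weight j = a`, this says that `X` is one of the matrices `±(E_{i, j} - E_{-j, -i})`. -/
structure IsRootVector (a : Fin 4 → ℤ) (X : Matrix (Fin 4 × ℤˣ) (Fin 4 × ℤˣ) ℤ) : Prop where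
  eq_zero : ∀ i j, weight i - weight j ≠ a → X i j = 0
  eq_unit : ∀ i j, weight i - weight j = a → X i j = 1 ∨ X i j = -1
  skew : ∀ i j, X (j.1, -j.2) (i.1, -i.2) = -X i j

/-- `N` is the family of structure constants of type `D4` for some choice of
the generators of the root spaces. Only the values `N a b` for which `a + b` is a root matter. -/
def IsStructureConstants (N : rootsD4 → rootsD4 → ℤ) : Prop :=
  ∃ X : rootsD4 → Matrix (Fin 4 × ℤˣ) (Fin 4 × ℤˣ) ℤ,
    (∀ a, IsRootVector a.1 (X a)) ∧
      ∀ a b c : rootsD4, c.1 = a.1 + b.1 → X a * X b - X b * X a = N a b • X c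

/-! ## The Steinberg group object -/

/-- A morphism from an additive group object to a multiplicative one is a homomorphism. -/
def IsAddMulHom {A G : C} [AddGrpObj A] [GrpObj G] (f : A ⟶ G) : Prop :=
  ∀ {T : C} (p q : T ⟶ A), (p + q) ≫ f = (p ≫ f) * (q ≫ f)

/-- The Steinberg relations of type `D4` for a family of morphisms to a group object. -/
structure SteinbergRelations {K G : C} [NonUnitalCommRingObj K] [GrpObj G]
    (N : rootsD4 → rootsD4 → ℤ) (x : rootsD4 → (K ⟶ G)) : Prop where
  map_add : ∀ a, IsAddMulHom (x a)
  commutator_root : ∀ a b c : rootsD4, c.1 = a.1 + b.1 → ∀ {T : C} (p q : T ⟶ K),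
    ⁅p ≫ x a, q ≫ x b⁆ = (N a b • (p * q)) ≫ x c
  commutator_one : ∀ a b : rootsD4, a.1 + b.1 ∉ rootsD4 → a.1 + b.1 ≠ 0 →
    ∀ {T : C} (p q : T ⟶ K), ⁅p ≫ x a, q ≫ x b⁆ = 1

/-- The group object `St` with root morphisms `x` is the Steinberg group `St(D4, K)`: the group
object with generators `x a` and only the Steinberg relations. -/
structure IsSteinbergGroup {K St : C} [NonUnitalCommRingObj K] [GrpObj St]
    (N : rootsD4 → rootsD4 → ℤ) (x : rootsD4 → (K ⟶ St)) : Prop where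
  relations : SteinbergRelations N x
  existsUnique_hom : ∀ {G : C} [GrpObj G] (y : rootsD4 → (K ⟶ G)), SteinbergRelations N y →
    ∃! f : St ⟶ G, IsMonHom f ∧ ∀ a, x a ≫ f = y a

/-! ## Central extensions and the Schur multiplier -/

/-- A central extension: an epimorphism of group objects with central kernel. -/
structure IsCentralExtension {H G : C} [GrpObj H] [GrpObj G] (f : H ⟶ G) : Prop where
  isMonHom : IsMonHom f
  isRegularEpi : IsRegularEpi f
  central : ∀ {T : C} (z h : T ⟶ H), z ≫ f = 1 → z * h = h * z

/-- A universal central extension: it maps uniquely to every central extension. -/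
structure IsUniversalCentralExtension {H G : C} [GrpObj H] [GrpObj G] (k : H ⟶ G) : Prop where
  isCentralExtension : IsCentralExtension k
  existsUnique_hom : ∀ {X : C} [GrpObj X] (d : X ⟶ G), IsCentralExtension d →
    ∃! f : H ⟶ X, IsMonHom f ∧ f ≫ d = k

/-- `M`, embedded by `i`, is the Schur multiplier of `G`: the kernel of the universal central
extension `k` of `G`. -/
structure IsSchurMultiplier {M H G : C} [GrpObj M] [GrpObj H] [GrpObj G]
    (i : M ⟶ H) (k : H ⟶ G) : Prop where
  isUniversalCentralExtension : IsUniversalCentralExtension k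
  isMonHom : IsMonHom i
  isPullback : IsPullback i (toUnit M) k η[G]

/-- `c` is the homomorphism from `K2e` to the Schur multiplier attached to an orbit `o`:
`⟨x_a(p), x_b(q)⟩ = c(p q)` for all orthogonal roots `a, b` with `(a + b) / 2` in `o`.
Here `⟨g, h⟩` is the commutator of arbitrary preimages of `g` and `h`. -/
structure IsOrbitHom {K St H M K2e : C} [NonUnitalCommRingObj K] [GrpObj St] [GrpObj H]
    [GrpObj M] [NonUnitalCommRingObj K2e] (x : rootsD4 → (K ⟶ St)) (k : H ⟶ St) (i : M ⟶ H)
    (π : K ⟶ K2e) (o : Orbit) (c : K2e ⟶ M) : Prop where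
  map_add : IsAddMulHom c
  commutator_eq : ∀ a b : rootsD4, a.1 ⬝ᵥ b.1 = 0 → halfSum a.1 b.1 ∈ o.roots →
    ∀ {T : C} (p q : T ⟶ K) (g h : T ⟶ H), g ≫ k = p ≫ x a → h ≫ k = q ≫ x b →
      ⁅g, h⁆ = (p * q) ≫ π ≫ c ≫ i

end SteinbergD4

open SteinbergD4

/-! Write ⟨g, h⟩ for the commutator of arbitrary preimages (`liftedComm`). Everything comes from
subsystems of type A3: roots r, s, d with r ⟂ d such that g = r + s and t = s + d are roots. Then g
⟂ t and r + t = g + d. As x_r and x_d commute, the Hall–Witt identity gives, up to signs, ⟨x_r(a),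
x_t(bc)⟩ = ⟨x_g(ab), x_t(bc)⟩ ⟨x_g(ab), x_d(c)⟩ (`br_triple`). So two lifts of the same element with
root r + s + d differ by a central symbol of the orthogonal pair (g, t).

In this identity two terms are additive in b and the third one is quadratic, hence its polarization
is trivial (`br_polarize`). Together with weak unitality this makes ⟨x_g(p), x_t(q)⟩ an additive
function of pq with values of order at most 2 (`exists_isSymbol`). Comparing different A3 subsystems
shows that this function depends only on the orbit of (g + t)/2 (`exists_orbit_symbols`).

Passing through an A3 subsystem and back returns to the same pair of roots and gives f(a, xyc) =
f(axy, c) c_o(ac(xy² + x²y)) for the lifts f (`rootLift_double`). Here f does not know how the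
product xy was split, which forces c_o to vanish on multiples of (p² - p)(q² - q); nor does it know
the orbit o, so the three symbols agree on multiples of p² - p. A triangle of A3 subsystems joining
the three decompositions of e₁ + e₂ into sums of two roots yields the product relation on squares
(`map_square`), and K₂ sits in K₂ε through squares because squaring is additive and kills I.

The images of the symbols exhaust M for the following reason. Divide the universal central extension
by their product. In the resulting central extension all symbols are trivial, so the lifts of root
elements no longer depend on decompositions and satisfy the Steinberg relations (`exists_section`).
The extension therefore splits, and by universality the quotient morphism factors through κ, so it
kills M.

The weak unit replaces 1: locally every element has the form a d⁸, any two elements have a common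
divisor, and balanced morphisms on K × K factor through the multiplication (`exists_factor`).
Arguments with elements become arguments with generalized elements after passing to regular
epimorphic covers. -/

namespace SteinbergD4

/-! ### Local arguments in regular categories. -/

section RegularEpi

variable {C : Type u} [Category.{v} C]

theorem eq_of_cover {T' T Y : C} {e : T' ⟶ T} (he : IsRegularEpi e) {f g : T ⟶ Y}
    (h : e ≫ f = e ≫ g) : f = g :=
  (cancel_epi e).mp h

theorem exists_desc {X Y Z : C} {f : X ⟶ Y} (hf : IsRegularEpi f) (g : X ⟶ Z)
    (h : ∀ (T : C) (u v : T ⟶ X), u ≫ f = v ≫ f → u ≫ g = v ≫ g) : ∃ d : Y ⟶ Z, f ≫ d = g :=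
  ⟨IsRegularEpi.desc f g (h _ _ _ (IsRegularEpi.w f)), IsRegularEpi.fac f g _⟩

/-- Regular epimorphisms are orthogonal to monomorphisms, so membership in a subobject is a local
property. -/
theorem exists_factor_of_cover {T' T A B : C} {e : T' ⟶ T} (he : IsRegularEpi e) (m : A ⟶ B)
    [Mono m] (t : T ⟶ B) (s : T' ⟶ A) (h : s ≫ m = e ≫ t) : ∃ t' : T ⟶ A, t' ≫ m = t := by
  have sq : CommSq s e m t := ⟨h⟩
  exact ⟨sq.lift, sq.fac_right⟩

end RegularEpi

section RegularCategory

variable {C : Type u} [Category.{v} C] [Regular C]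

theorem isRegularEpi_comp {X Y Z : C} {f : X ⟶ Y} {g : Y ⟶ Z} (hf : IsRegularEpi f)
    (hg : IsRegularEpi g) : IsRegularEpi (f ≫ g) := by
  have : StrongEpi (f ≫ g) := strongEpi_comp f g
  infer_instance

theorem isRegularEpi_of_comp {X Y Z : C} (f : X ⟶ Y) (g : Y ⟶ Z)
    (h : IsRegularEpi (f ≫ g)) : IsRegularEpi g := by
  have : StrongEpi g := strongEpi_of_strongEpi f g
  infer_instance

theorem exists_local_lift {X Y T : C} {f : X ⟶ Y} (hf : IsRegularEpi f) (y : T ⟶ Y) :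
    ∃ (T' : C) (e : T' ⟶ T) (x : T' ⟶ X), IsRegularEpi e ∧ x ≫ f = e ≫ y :=
  ⟨pullback f y, pullback.snd f y, pullback.fst f y, inferInstance, pullback.condition⟩

variable [CartesianMonoidalCategory C]

theorem isRegularEpi_tensor {X Y X' Y' : C} {f : X ⟶ Y} {g : X' ⟶ Y'} (hf : IsRegularEpi f)
    (hg : IsRegularEpi g) : IsRegularEpi (f ⊗ₘ g) := by
  obtain ⟨T, e, x, he, hx⟩ := exists_local_lift hf (fst Y Y')
  obtain ⟨T', e', x', he', hx'⟩ := exists_local_lift hg (e ≫ snd Y Y')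
  refine isRegularEpi_of_comp (lift (e' ≫ x) x') _ ?_
  have : lift (e' ≫ x) x' ≫ (f ⊗ₘ g) = e' ≫ e := by
    apply CartesianMonoidalCategory.hom_ext <;> simp [hx, hx']
  rw [this]
  exact isRegularEpi_comp he' he

end RegularCategory

/-! ### Division in weakly unital rings. -/

section WeakUnit

variable {C : Type u} [Category.{v} C] [CartesianMonoidalCategory C] [Regular C]
variable {K : C} [NonUnitalCommRingObj K]

/-- Locally every element is a multiple of an element of the weak unit. -/
theorem IsWeakUnit.exists_mul {E : C} {j : E ⟶ K} (hj : IsWeakUnit j) {T : C} (p : T ⟶ K) :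
    ∃ (T' : C) (f : T' ⟶ T) (a : T' ⟶ K) (e : T' ⟶ E), IsRegularEpi f ∧
      f ≫ p = a * (e ≫ j) := by
  obtain ⟨T', f, y, hf, hy⟩ := exists_local_lift hj.smul_epi p
  refine ⟨T', f, y ≫ fst _ _, y ≫ snd _ _, hf, ?_⟩
  rw [← hy, comp_mul_hom]
  simp

/-- Split e into two factors in the weak unit and extract a common divisor d of both. -/
theorem IsWeakUnit.exists_mul_mul {E : C} {j : E ⟶ K} (hj : IsWeakUnit j) {T : C} (e : T ⟶ E) :
    ∃ (T' : C) (f : T' ⟶ T) (e' d : T' ⟶ E), IsRegularEpi f ∧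
      f ≫ e ≫ j = (e' ≫ j) * ((d ≫ j) * (d ≫ j)) := by
  obtain ⟨m, hm, hm'⟩ := hj.mul_epi
  obtain ⟨T', f, y, hf, hy⟩ := exists_local_lift hm' e
  obtain ⟨T'', f', a, b, d, hf', ha, hb⟩ :=
    hj.common_divisor (y ≫ fst _ _) (y ≫ snd _ _)
  refine ⟨T'', f' ≫ f, lift a b ≫ m, d, isRegularEpi_comp hf' hf, ?_⟩
  simp only [Category.assoc] at ha hb
  have h1 : (f' ≫ f) ≫ e ≫ j = f' ≫ y ≫ m ≫ j := by
    simp only [Category.assoc, ← reassoc_of% hy]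
  have h2 : (lift a b ≫ m) ≫ j = (a ≫ j) * (b ≫ j) := by
    rw [Category.assoc, hm, comp_mul_hom, lift_fst_assoc, lift_snd_assoc]
  rw [h1, h2, hm, comp_mul_hom, comp_mul_hom, ha, hb, mul_mul_mul_comm]

/-- Locally every element is divisible by the eighth power of an element. -/
theorem IsWeaklyUnital.exists_pow_eight (hK : IsWeaklyUnital K) {T : C} (p : T ⟶ K) :
    ∃ (T' : C) (f : T' ⟶ T) (a d : T' ⟶ K), IsRegularEpi f ∧
      f ≫ p = a * (((d * d) * (d * d)) * ((d * d) * (d * d))) := by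
  obtain ⟨E, j, hj⟩ := hK
  obtain ⟨T₁, f₁, a, e, hf₁, h₁⟩ := hj.exists_mul p
  obtain ⟨T₂, f₂, e₂, d₂, hf₂, h₂⟩ := hj.exists_mul_mul e
  obtain ⟨T₃, f₃, e₃, d₃, hf₃, h₃⟩ := hj.exists_mul_mul d₂
  obtain ⟨T₄, f₄, e₄, d₄, hf₄, h₄⟩ := hj.exists_mul_mul d₃
  refine ⟨T₄, ((f₄ ≫ f₃) ≫ f₂) ≫ f₁,
    (f₄ ≫ f₃ ≫ f₂ ≫ a) * (f₄ ≫ f₃ ≫ e₂ ≫ j) * ((f₄ ≫ e₃ ≫ j) * (f₄ ≫ e₃ ≫ j)) *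
      (((e₄ ≫ j) * (e₄ ≫ j)) * ((e₄ ≫ j) * (e₄ ≫ j))), d₄ ≫ j,
    isRegularEpi_comp (isRegularEpi_comp (isRegularEpi_comp hf₄ hf₃) hf₂) hf₁, ?_⟩
  simp only [Category.assoc, h₁, comp_mul_hom, h₂, h₃, h₄]
  ac_rfl

theorem IsWeaklyUnital.exists_mul (hK : IsWeaklyUnital K) {T : C} (p : T ⟶ K) :
    ∃ (T' : C) (f : T' ⟶ T) (a b : T' ⟶ K), IsRegularEpi f ∧ f ≫ p = a * b := by
  obtain ⟨T', f, a, d, hf, h⟩ := hK.exists_pow_eight p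
  exact ⟨T', f, a, _, hf, h⟩

theorem IsWeaklyUnital.isRegularEpi_mul (hK : IsWeaklyUnital K) :
    IsRegularEpi (fst K K * snd K K) := by
  obtain ⟨E, j, hj⟩ := hK
  refine isRegularEpi_of_comp (lift (fst K E) (snd K E ≫ j)) _ ?_
  simpa [comp_mul_hom] using hj.smul_epi

/-- A balanced morphism factors through the multiplication. -/
theorem IsWeaklyUnital.exists_factor (hK : IsWeaklyUnital K) {H : C} (y : K ⊗ K ⟶ H)
    (hy : ∀ {T : C} (a b c : T ⟶ K), lift (a * b) c ≫ y = lift a (b * c) ≫ y) :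
    ∃ z : K ⟶ H, ∀ {T : C} (a b : T ⟶ K), (a * b) ≫ z = lift a b ≫ y := by
  -- Write b and b' as multiples of one d in the weak unit, so that ab = a'b' says that a difference
  -- u - u' is annihilated by d. Splitting d = d' d'' with (u - u') d' = 0, balancedness moves every
  -- factor except d'' to the left, where both sides coincide.
  have key : ∀ {T : C} (a b a' b' : T ⟶ K), a * b = a' * b' →
      lift a b ≫ y = lift a' b' ≫ y := by
    obtain ⟨E, j, hj⟩ := hK
    intro T a b a' b' h
    obtain ⟨T₁, f₁, c, e, hf₁, h₁⟩ := hj.exists_mul b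
    obtain ⟨T₂, f₂, c', e', hf₂, h₂⟩ := hj.exists_mul (f₁ ≫ b')
    obtain ⟨T₃, f₃, e₁, e₂, d, hf₃, h₃, h₃'⟩ := hj.common_divisor (f₂ ≫ e) e'
    simp only [Category.assoc] at h₃
    have hm : ((f₃ ≫ f₂ ≫ f₁ ≫ a) * (f₃ ≫ f₂ ≫ c) * (e₁ ≫ j) -
        (f₃ ≫ f₂ ≫ f₁ ≫ a') * (f₃ ≫ c') * (e₂ ≫ j)) * (d ≫ j) = 0 := by
      have hb : f₃ ≫ f₂ ≫ f₁ ≫ b = (f₃ ≫ f₂ ≫ c) * (f₃ ≫ f₂ ≫ e ≫ j) := by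
        rw [h₁, comp_mul_hom, comp_mul_hom]
      have hb' : f₃ ≫ f₂ ≫ f₁ ≫ b' = (f₃ ≫ c') * (f₃ ≫ e' ≫ j) := by
        rw [h₂, comp_mul_hom]
      rw [sub_mul, mul_assoc, mul_assoc, mul_assoc, mul_assoc, ← h₃, ← h₃', ← hb, ← hb',
        sub_eq_zero]
      simp only [← comp_mul_hom, h]
    obtain ⟨T₄, f₄, d', d'', hf₄, h₄, h₄'⟩ := hj.annihilator _ d hm
    refine eq_of_cover (isRegularEpi_comp (isRegularEpi_comp (isRegularEpi_comp hf₄ hf₃) hf₂) hf₁)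
      ?_
    have e1 : (((f₄ ≫ f₃) ≫ f₂) ≫ f₁) ≫ lift a b ≫ y =
        lift ((f₄ ≫ f₃ ≫ f₂ ≫ f₁ ≫ a) * (f₄ ≫ f₃ ≫ f₂ ≫ c) * (f₄ ≫ e₁ ≫ j) * (d' ≫ j))
          (d'' ≫ j) ≫ y := by
      rw [comp_lift_assoc, hy, hy, hy]
      simp only [Category.assoc]
      rw [h₁, ← h₄, ← comp_mul_hom, ← h₃]
      simp only [comp_mul_hom]
    have e2 : (((f₄ ≫ f₃) ≫ f₂) ≫ f₁) ≫ lift a' b' ≫ y =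
        lift ((f₄ ≫ f₃ ≫ f₂ ≫ f₁ ≫ a') * (f₄ ≫ f₃ ≫ c') * (f₄ ≫ e₂ ≫ j) * (d' ≫ j))
          (d'' ≫ j) ≫ y := by
      rw [comp_lift_assoc, hy, hy, hy]
      simp only [Category.assoc]
      rw [h₂, ← h₄, ← comp_mul_hom, ← h₃']
      simp only [comp_mul_hom]
    rw [e1, e2]
    congr 2
    rw [← sub_eq_zero, ← sub_mul, ← h₄']
    congr 1
    simp only [sub_eq_add_neg, AddMonObj.comp_add, AddGrpObj.comp_neg, comp_mul_hom]
  obtain ⟨z, hz⟩ := exists_desc hK.isRegularEpi_mul y fun T u v huv => by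
    have := key (u ≫ fst K K) (u ≫ snd K K) (v ≫ fst K K) (v ≫ snd K K)
      (by simpa only [comp_mul_hom] using huv)
    simpa [← comp_lift_assoc] using this
  refine ⟨z, fun a b => ?_⟩
  rw [← hz, ← Category.assoc, comp_mul_hom, lift_fst, lift_snd]

/-- Locally two elements have a common divisor. -/
theorem IsWeaklyUnital.exists_common_divisor (hK : IsWeaklyUnital K) {T : C} (p q : T ⟶ K) :
    ∃ (T' : C) (f : T' ⟶ T) (a b d : T' ⟶ K), IsRegularEpi f ∧
      f ≫ p = a * d ∧ f ≫ q = b * d := by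
  obtain ⟨E, j, hj⟩ := hK
  obtain ⟨T₁, f₁, a, e, hf₁, h₁⟩ := hj.exists_mul p
  obtain ⟨T₂, f₂, b, e', hf₂, h₂⟩ := hj.exists_mul (f₁ ≫ q)
  obtain ⟨T₃, f₃, e₁, e₂, d, hf₃, h₃, h₃'⟩ := hj.common_divisor (f₂ ≫ e) e'
  refine ⟨T₃, (f₃ ≫ f₂) ≫ f₁, (f₃ ≫ f₂ ≫ a) * (e₁ ≫ j), (f₃ ≫ b) * (e₂ ≫ j), d ≫ j,
    isRegularEpi_comp (isRegularEpi_comp hf₃ hf₂) hf₁, ?_, ?_⟩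
  · rw [mul_assoc, ← h₃]
    simp only [Category.assoc, h₁, comp_mul_hom]
  · rw [mul_assoc, ← h₃']
    simp only [Category.assoc, h₂, comp_mul_hom]

/-- Locally two elements have a common divisor d, and ad + bd = (a + b)d, so additivity in the first
argument suffices. -/
theorem IsWeaklyUnital.isAddMulHom_of_factor (hK : IsWeaklyUnital K) {H : C} [GrpObj H]
    {y : K ⊗ K ⟶ H} {z : K ⟶ H} (hz : ∀ {T : C} (a b : T ⟶ K), (a * b) ≫ z = lift a b ≫ y)
    (hy : ∀ {T : C} (a a' b : T ⟶ K), lift (a + a') b ≫ y = (lift a b ≫ y) * (lift a' b ≫ y)) :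
    IsAddMulHom z := by
  intro T p q
  obtain ⟨T', f, a, b, d, hf, hp, hq⟩ := hK.exists_common_divisor p q
  refine eq_of_cover hf ?_
  rw [MonObj.comp_mul, ← Category.assoc, ← Category.assoc, ← Category.assoc, AddMonObj.comp_add,
    hp, hq]
  have : a * d + b * d = (a + b) * d := (add_mul a b d).symm
  rw [this, hz, hz, hz, hy]

end WeakUnit

/-! ### Combinatorics of the root system D4. -/

section Roots

/-- The list of the roots of type D4. -/
def rootList : List (Fin 4 → ℤ) :=
  [![1, 1, 0, 0], ![1, -1, 0, 0], ![-1, 1, 0, 0], ![-1, -1, 0, 0],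
   ![1, 0, 1, 0], ![1, 0, -1, 0], ![-1, 0, 1, 0], ![-1, 0, -1, 0],
   ![1, 0, 0, 1], ![1, 0, 0, -1], ![-1, 0, 0, 1], ![-1, 0, 0, -1],
   ![0, 1, 1, 0], ![0, 1, -1, 0], ![0, -1, 1, 0], ![0, -1, -1, 0],
   ![0, 1, 0, 1], ![0, 1, 0, -1], ![0, -1, 0, 1], ![0, -1, 0, -1],
   ![0, 0, 1, 1], ![0, 0, 1, -1], ![0, 0, -1, 1], ![0, 0, -1, -1]]

theorem mem_rootList_iff {w : Fin 4 → ℤ} : w ∈ rootList ↔ w ∈ rootsD4 := by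
  constructor
  · revert w
    change ∀ w ∈ rootList,
      ∃ i j : Fin 4, i < j ∧ ∃ s t : ℤˣ, w = Pi.single i (s : ℤ) + Pi.single j (t : ℤ)
    decide
  · rintro ⟨i, j, hij, s, t, rfl⟩
    revert i j s t
    decide

-- The coordinates -1, 0, 1 are encoded by `Fin 3` shifted by one, which leaves a finite check.
set_option maxRecDepth 10000 in
theorem mem_rootList_of_norm : ∀ a b c d : Fin 3, ((a : ℤ) - 1) * ((a : ℤ) - 1) +
    ((b : ℤ) - 1) * ((b : ℤ) - 1) + ((c : ℤ) - 1) * ((c : ℤ) - 1) +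
    ((d : ℤ) - 1) * ((d : ℤ) - 1) = 2 →
      ![(a : ℤ) - 1, (b : ℤ) - 1, (c : ℤ) - 1, (d : ℤ) - 1] ∈ rootList := by
  decide

/-- This characterization reduces questions about sums and differences of roots to scalar products.
-/
theorem mem_rootsD4_iff {w : Fin 4 → ℤ} : w ∈ rootsD4 ↔ w ⬝ᵥ w = 2 := by
  constructor
  · rintro ⟨i, j, hij, s, t, rfl⟩
    revert i j s t
    decide
  · intro h
    rw [← mem_rootList_iff]
    simp only [dotProduct, Fin.sum_univ_four] at h
    have bound : ∀ i, ∃ a : Fin 3, w i = (a : ℤ) - 1 := by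
      intro i
      have h1 : w i * w i ≤ 2 := by
        fin_cases i <;> simp only [Fin.zero_eta, Fin.mk_one, Fin.reduceFinMk] <;>
          nlinarith [mul_self_nonneg (w 0), mul_self_nonneg (w 1), mul_self_nonneg (w 2),
            mul_self_nonneg (w 3)]
      have h2 : w i < 2 := by nlinarith
      have h3 : -2 < w i := by nlinarith
      refine ⟨⟨(w i + 1).toNat, by omega⟩, ?_⟩
      simp only
      omega
    obtain ⟨a, ha⟩ := bound 0
    obtain ⟨b, hb⟩ := bound 1
    obtain ⟨c, hc⟩ := bound 2
    obtain ⟨d, hd⟩ := bound 3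
    have hw : w = ![(a : ℤ) - 1, (b : ℤ) - 1, (c : ℤ) - 1, (d : ℤ) - 1] := by
      ext i
      fin_cases i <;> simp [ha, hb, hc, hd]
    rw [hw]
    rw [ha, hb, hc, hd] at h
    exact mem_rootList_of_norm a b c d h

theorem root_norm (a : rootsD4) : a.1 ⬝ᵥ a.1 = 2 := mem_rootsD4_iff.mp a.2

theorem root_add_mem {a b : rootsD4} (h : a.1 ⬝ᵥ b.1 = -1) : a.1 + b.1 ∈ rootsD4 := by
  rw [mem_rootsD4_iff]
  simp only [dotProduct_add, add_dotProduct, root_norm, dotProduct_comm b.1 a.1, h]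
  norm_num

theorem root_sub_mem {a b : rootsD4} (h : a.1 ⬝ᵥ b.1 = 1) : a.1 - b.1 ∈ rootsD4 := by
  rw [mem_rootsD4_iff]
  simp only [dotProduct_sub, sub_dotProduct, root_norm, dotProduct_comm b.1 a.1, h]
  norm_num

theorem root_dot_of_add {a b c : rootsD4} (h : c.1 = a.1 + b.1) : a.1 ⬝ᵥ b.1 = -1 := by
  have := root_norm c
  rw [h] at this
  simp only [dotProduct_add, add_dotProduct, root_norm, dotProduct_comm b.1 a.1] at this
  omega

theorem root_neg_mem (a : rootsD4) : -a.1 ∈ rootsD4 := by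
  rw [mem_rootsD4_iff]
  simp [root_norm]

/-- The opposite root. -/
def rootNeg (a : rootsD4) : rootsD4 := ⟨-a.1, root_neg_mem a⟩

theorem root_eq_of_dot {a b : rootsD4} (h : a.1 ⬝ᵥ b.1 = 2) : a = b := by
  have : (a.1 - b.1) ⬝ᵥ (a.1 - b.1) = 0 := by
    simp only [dotProduct_sub, sub_dotProduct, root_norm, dotProduct_comm b.1 a.1, h]
    norm_num
  exact Subtype.ext (sub_eq_zero.mp (dotProduct_self_eq_zero.mp this))

theorem root_dot_le (a b : rootsD4) : a.1 ⬝ᵥ b.1 ≤ 2 := by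
  have : 0 ≤ (a.1 - b.1) ⬝ᵥ (a.1 - b.1) := by
    simp only [dotProduct]
    exact Finset.sum_nonneg fun i _ => mul_self_nonneg _
  simp only [dotProduct_sub, sub_dotProduct, root_norm, dotProduct_comm b.1 a.1] at this
  omega

theorem neg_two_le_root_dot (a b : rootsD4) : -2 ≤ a.1 ⬝ᵥ b.1 := by
  have := root_dot_le a (rootNeg b)
  simp only [rootNeg, dotProduct_neg] at this
  omega

theorem root_add_eq_zero {a b : rootsD4} (h : a.1 ⬝ᵥ b.1 = -2) : a.1 + b.1 = 0 := by
  have : a = rootNeg b := root_eq_of_dot (by simp [rootNeg, h])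
  rw [this]
  simp [rootNeg]

theorem root_add_not_mem {a b : rootsD4} (h : 0 ≤ a.1 ⬝ᵥ b.1) :
    a.1 + b.1 ∉ rootsD4 ∧ a.1 + b.1 ≠ 0 := by
  have h1 : (a.1 + b.1) ⬝ᵥ (a.1 + b.1) = 4 + 2 * (a.1 ⬝ᵥ b.1) := by
    simp only [dotProduct_add, add_dotProduct, root_norm, dotProduct_comm b.1 a.1]
    ring
  refine ⟨fun h2 => ?_, fun h2 => ?_⟩
  · rw [mem_rootsD4_iff] at h2
    omega
  · rw [h2, dotProduct_zero] at h1
    omega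

-- Such a c is the middle root s of an A3 subsystem in which a and b play the roles of g = r + s and
-- t = s + d.
set_option maxRecDepth 10000 in
theorem exists_root_dot_one_one {a b : rootsD4} (h : a.1 ⬝ᵥ b.1 = 0) :
    ∃ c : rootsD4, c.1 ⬝ᵥ a.1 = 1 ∧ c.1 ⬝ᵥ b.1 = 1 := by
  have key : ∀ a ∈ rootList, ∀ b ∈ rootList, a ⬝ᵥ b = 0 →
      ∃ c ∈ rootList, c ⬝ᵥ a = 1 ∧ c ⬝ᵥ b = 1 := by
    decide
  obtain ⟨c, hc, h1⟩ := key _ (mem_rootList_iff.mpr a.2) _ (mem_rootList_iff.mpr b.2) h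
  exact ⟨⟨c, mem_rootList_iff.mp hc⟩, h1⟩

-- This presents x_a as a commutator of root elements commuting with x_b, whence ⟨x_a, x_b⟩ = 1. The
-- case a = b is included.
set_option maxRecDepth 10000 in
theorem exists_root_decomposition {a b : rootsD4} (h : 0 < a.1 ⬝ᵥ b.1) :
    ∃ c d : rootsD4, a.1 = c.1 + d.1 ∧ 0 ≤ c.1 ⬝ᵥ b.1 ∧ 0 ≤ d.1 ⬝ᵥ b.1 := by
  have key : ∀ a ∈ rootList, ∀ b ∈ rootList, 0 < a ⬝ᵥ b →
      ∃ c ∈ rootList, a ⬝ᵥ c = 1 ∧ 0 ≤ c ⬝ᵥ b ∧ 0 ≤ (a - c) ⬝ᵥ b := by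
    decide
  obtain ⟨c, hc, h0, h1, h2⟩ := key _ (mem_rootList_iff.mpr a.2) _ (mem_rootList_iff.mpr b.2) h
  exact ⟨⟨c, mem_rootList_iff.mp hc⟩, ⟨_, root_sub_mem (b := ⟨c, mem_rootList_iff.mp hc⟩) h0⟩,
    by simp, h1, h2⟩

end Roots

/-! ### Orthogonal pairs of roots and the three orbits. -/

section Orbits

theorem exists_orbit {a b : rootsD4} (h : a.1 ⬝ᵥ b.1 = 0) :
    ∃ o : Orbit, halfSum a.1 b.1 ∈ o.roots := by
  have key : ∀ a ∈ rootList, ∀ b ∈ rootList, a ⬝ᵥ b = 0 →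
      (∃ (i : Fin 4) (s : ℤˣ), ∀ k, a k + b k = 2 * (Pi.single i (s : ℤ) : Fin 4 → ℤ) k) ∨
        ∀ k, a k + b k = 1 ∨ a k + b k = -1 := by
    set_option maxRecDepth 10000 in decide
  rcases key _ (mem_rootList_iff.mpr a.2) _ (mem_rootList_iff.mpr b.2) h with ⟨i, s, hs⟩ | h
  · refine ⟨.zero, i, s, funext fun k => ?_⟩
    simp only [halfSum, hs]
    rcases eq_or_ne k i with rfl | hk
    · simp
    · simp [hk]
  · have : ∀ k, ∃ s : ℤˣ, a.1 k + b.1 k = s := fun k => (h k).elim (fun h => ⟨1, h⟩)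
      (fun h => ⟨-1, h⟩)
    choose s hs using this
    rcases Int.units_eq_one_or (∏ i, s i) with h1 | h1
    · exact ⟨.plus, s, h1, funext fun k => by simp only [halfSum, hs]⟩
    · exact ⟨.minus, s, h1, funext fun k => by simp only [halfSum, hs]⟩

/-- Vectors twice as long as the vectors in one of the orbits. -/
theorem orbit_double {o : Orbit} {v w : Fin 4 → ℤ} (hv : (fun i => (v i : ℚ) / 2) ∈ o.roots)
    (hw : (fun i => (w i : ℚ) / 2) ∈ o.roots) :
    v = w ∨ v = -w ∨ v ⬝ᵥ w = 0 ∧ v ⬝ᵥ v = 4 ∧ w ⬝ᵥ w = 4 ∧ ∀ i, 2 ∣ v i + w i := by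
  have single : ∀ (i : Fin 4) (s : ℤˣ) (v : Fin 4 → ℤ),
      (fun i => (v i : ℚ) / 2) = Pi.single i ((s : ℤ) : ℚ) → v = Pi.single i (2 * (s : ℤ)) := by
    intro i s v h
    funext k
    have hk := congrFun h k
    rcases eq_or_ne k i with rfl | hki
    · simp only [Pi.single_eq_same] at hk ⊢
      rw [div_eq_iff two_ne_zero] at hk
      rw [mul_comm]
      exact_mod_cast hk
    · simp only [ne_eq, hki, not_false_eq_true, Pi.single_eq_of_ne] at hk ⊢
      simpa using hk
  have half : ∀ (s : Fin 4 → ℤˣ) (v : Fin 4 → ℤ),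
      ((fun i => (v i : ℚ) / 2) = fun i => ((s i : ℤ) : ℚ) / 2) → v = fun i => (s i : ℤ) := by
    intro s v h
    funext k
    have hk := congrFun h k
    simp only [div_left_inj' (two_ne_zero' ℚ)] at hk
    exact_mod_cast hk
  cases o with
  | zero =>
    obtain ⟨i, s, hv⟩ := hv
    obtain ⟨j, t, hw⟩ := hw
    rw [single _ _ _ hv, single _ _ _ hw]
    clear hv hw
    revert i j s t
    decide
  | plus =>
    obtain ⟨s, hs, hv⟩ := hv
    obtain ⟨t, ht, hw⟩ := hw
    rw [half _ _ hv, half _ _ hw]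
    clear hv hw
    revert s t
    decide
  | minus =>
    obtain ⟨s, hs, hv⟩ := hv
    obtain ⟨t, ht, hw⟩ := hw
    rw [half _ _ hv, half _ _ hw]
    clear hv hw
    revert s t
    decide

/-- For v = a + b and w = a' + b' the vectors g = (v + w)/2 and k = (v - w)/2 are orthogonal roots
with g + k = v and g - k = w. Hence changing the sign of k leads from one pair to the other. -/
theorem orbit_eq_of_dot_eq_zero {X : Type*} {F : rootsD4 → rootsD4 → X}
    (h₁ : ∀ a b a' b' : rootsD4, a.1 ⬝ᵥ b.1 = 0 → a'.1 ⬝ᵥ b'.1 = 0 → a.1 + b.1 = a'.1 + b'.1 →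
      F a b = F a' b')
    (h₂ : ∀ a b : rootsD4, a.1 ⬝ᵥ b.1 = 0 → F a b = F a (rootNeg b))
    {a b a' b' : rootsD4} (h : a.1 ⬝ᵥ b.1 = 0) (h' : a'.1 ⬝ᵥ b'.1 = 0)
    (h0 : (a.1 + b.1) ⬝ᵥ (a'.1 + b'.1) = 0)
    (hd : ∀ i, 2 ∣ (a.1 + b.1) i + (a'.1 + b'.1) i) : F a b = F a' b' := by
  choose g hg using hd
  have e1 : (a.1 + b.1) + (a'.1 + b'.1) = (2 : ℤ) • g := funext fun i => by
    simpa using hg i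
  have hv : ∀ {a b : rootsD4}, a.1 ⬝ᵥ b.1 = 0 → (a.1 + b.1) ⬝ᵥ (a.1 + b.1) = 4 := by
    intro a b h
    simp only [dotProduct_add, add_dotProduct, root_norm, dotProduct_comm b.1 a.1, h]
    norm_num
  have hg1 : g ⬝ᵥ g = 2 := by
    have : ((2 : ℤ) • g) ⬝ᵥ ((2 : ℤ) • g) = 8 := by
      have expand : ∀ v w : Fin 4 → ℤ, (v + w) ⬝ᵥ (v + w) = v ⬝ᵥ v + 2 * (v ⬝ᵥ w) + w ⬝ᵥ w := by
        intro v w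
        rw [dotProduct_add, add_dotProduct, add_dotProduct, dotProduct_comm w v]
        ring
      rw [← e1, expand, hv h, hv h', h0]
      norm_num
    simp only [smul_dotProduct, dotProduct_smul, smul_eq_mul] at this
    omega
  have hg2 : g ⬝ᵥ (a.1 + b.1) = 2 := by
    have : ((2 : ℤ) • g) ⬝ᵥ (a.1 + b.1) = 4 := by
      rw [← e1, add_dotProduct, hv h, dotProduct_comm (a'.1 + b'.1), h0, add_zero]
    simp only [smul_dotProduct, smul_eq_mul] at this
    omega
  have hk : ((a.1 + b.1) - g) ⬝ᵥ ((a.1 + b.1) - g) = 2 := by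
    rw [sub_dotProduct, dotProduct_sub, dotProduct_sub, dotProduct_comm (a.1 + b.1) g, hg1, hg2,
      hv h]
    norm_num
  have hgk : g ⬝ᵥ ((a.1 + b.1) - g) = 0 := by
    rw [dotProduct_sub, hg1, hg2, sub_self]
  let g' : rootsD4 := ⟨g, mem_rootsD4_iff.mpr hg1⟩
  let k' : rootsD4 := ⟨_, mem_rootsD4_iff.mpr hk⟩
  have hgk' : g'.1 ⬝ᵥ (rootNeg k').1 = 0 := by
    simp only [rootNeg, dotProduct_neg, neg_eq_zero]
    exact hgk
  rw [h₁ a b g' k' h hgk (by simp [g', k']), h₂ g' k' hgk]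
  refine h₁ _ _ _ _ hgk' h' ?_
  simp only [g', k', rootNeg, neg_sub]
  rw [← add_sub_assoc, ← two_smul ℤ, ← e1]
  abel

/-- Doubled vectors of one orbit are equal, opposite, or orthogonal and congruent modulo 2. Opposite
vectors ±(a + b) are joined through a - b, which is orthogonal to both. -/
theorem orbit_eq {X : Type*} {F : rootsD4 → rootsD4 → X}
    (h₁ : ∀ a b a' b' : rootsD4, a.1 ⬝ᵥ b.1 = 0 → a'.1 ⬝ᵥ b'.1 = 0 → a.1 + b.1 = a'.1 + b'.1 →
      F a b = F a' b')
    (h₂ : ∀ a b : rootsD4, a.1 ⬝ᵥ b.1 = 0 → F a b = F a (rootNeg b))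
    {o : Orbit} {a b a' b' : rootsD4} (h : a.1 ⬝ᵥ b.1 = 0) (h' : a'.1 ⬝ᵥ b'.1 = 0)
    (ho : halfSum a.1 b.1 ∈ o.roots) (ho' : halfSum a'.1 b'.1 ∈ o.roots) : F a b = F a' b' := by
  rcases orbit_double (v := a.1 + b.1) (w := a'.1 + b'.1) ho ho' with h3 | h3 | ⟨h3, -, -, hd⟩
  · exact h₁ _ _ _ _ h h' h3
  · have hab : a.1 ⬝ᵥ (rootNeg b).1 = 0 := by
      simp [rootNeg, h]
    rw [h₂ _ _ h]
    refine orbit_eq_of_dot_eq_zero h₁ h₂ hab h' ?_ fun i => ?_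
    · have : a'.1 + b'.1 = -(a.1 + b.1) := by rw [h3, neg_neg]
      rw [this]
      simp only [rootNeg, dotProduct_neg, dotProduct_add, add_dotProduct, neg_dotProduct,
        root_norm, dotProduct_comm b.1 a.1, h]
      norm_num
    · have := congrFun h3 i
      simp only [rootNeg, Pi.add_apply, Pi.neg_apply] at this ⊢
      omega
  · exact orbit_eq_of_dot_eq_zero h₁ h₂ h h' h3 hd

/-- A function of orthogonal roots with two invariance properties depends only on their sum. -/
theorem eq_of_sum_eq {X : Type*} {F : rootsD4 → rootsD4 → X}
    (h₁ : ∀ a b : rootsD4, a.1 ⬝ᵥ b.1 = 0 → F a b = F b a)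
    (h₂ : ∀ a b a' b' c : rootsD4, a.1 ⬝ᵥ b.1 = 0 → a.1 = a'.1 + c.1 → b'.1 = c.1 + b.1 →
      a'.1 ⬝ᵥ b.1 = 1 → c.1 ⬝ᵥ b.1 = -1 → F a b = F a' b')
    (a b a' b' : rootsD4) (h : a.1 ⬝ᵥ b.1 = 0) (h' : a'.1 ⬝ᵥ b'.1 = 0)
    (hs : a.1 + b.1 = a'.1 + b'.1) : F a b = F a' b' := by
  have h3 : a.1 ⬝ᵥ a'.1 + a'.1 ⬝ᵥ b.1 = 2 := by
    have := congrArg (fun v => a'.1 ⬝ᵥ v) hs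
    simp only [dotProduct_add, root_norm, h'] at this
    rw [dotProduct_comm a.1]
    simpa using this
  have l1 := root_dot_le a a'
  have l2 := root_dot_le a' b
  have : a.1 ⬝ᵥ a'.1 = 0 ∨ a.1 ⬝ᵥ a'.1 = 1 ∨ a.1 ⬝ᵥ a'.1 = 2 := by omega
  rcases this with h4 | h4 | h4
  · have : a' = b := root_eq_of_dot (by omega)
    subst this
    have : a = b' := Subtype.ext (by rw [add_comm] at hs; exact add_left_cancel hs)
    subst this
    exact h₁ _ _ h
  · have e : b'.1 = a.1 + b.1 - a'.1 := by rw [hs]; abel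
    refine h₂ a b a' b' ⟨_, root_sub_mem h4⟩ h (by simp)
      (by rw [e]; exact add_sub_right_comm _ _ _) (by omega) ?_
    simp only [sub_dotProduct, h]
    omega
  · have : a = a' := root_eq_of_dot h4
    subst this
    have : b = b' := Subtype.ext (add_left_cancel hs)
    subst this
    rfl

end Orbits

/-! ### Signs of the structure constants. -/

section StructureConstants

theorem weight_dot (i j : Fin 4 × ℤˣ) : weight i ⬝ᵥ weight i = 1 ∧
    (weight i ⬝ᵥ weight j = 1 → i = j) ∧ (weight i ⬝ᵥ weight j = -1 → j = (i.1, -i.2)) := by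
  obtain ⟨i, s⟩ := i
  obtain ⟨j, t⟩ := j
  revert i j s t
  decide

theorem weight_injective : Function.Injective weight := fun i j h =>
  (weight_dot i j).2.1 (by rw [← h, (weight_dot i j).1])

theorem exists_weight_sub (a : rootsD4) :
    ∃ i j, weight i - weight j = a.1 ∧ weight i ⬝ᵥ weight j = 0 := by
  obtain ⟨i, j, hij, s, t, h⟩ := a.2
  refine ⟨(i, s), (j, -t), ?_, ?_⟩
  · rw [h]
    simp [weight, Pi.single_neg]
  · simp [weight, hij.ne]

theorem weight_dot_root (i : Fin 4 × ℤˣ) (a : rootsD4) :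
    -1 ≤ weight i ⬝ᵥ a.1 ∧ weight i ⬝ᵥ a.1 ≤ 1 ∧
      (weight i ⬝ᵥ a.1 = 1 → ∃ k, weight i - weight k = a.1) := by
  have key : ∀ (i : Fin 4) (s : ℤˣ), ∀ a ∈ rootList, -1 ≤ weight (i, s) ⬝ᵥ a ∧
      weight (i, s) ⬝ᵥ a ≤ 1 ∧ (weight (i, s) ⬝ᵥ a = 1 →
        ∃ (j : Fin 4) (t : ℤˣ), weight (i, s) - weight (j, t) = a) := by
    decide
  obtain ⟨h1, h2, h3⟩ := key i.1 i.2 _ (mem_rootList_iff.mpr a.2)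
  exact ⟨h1, h2, fun h => by obtain ⟨j, t, h4⟩ := h3 h; exact ⟨(j, t), h4⟩⟩

theorem weight_dot_of_sub {i k : Fin 4 × ℤˣ} {a : rootsD4} (h : weight i - weight k = a.1) :
    weight i ⬝ᵥ a.1 = 1 := by
  have h1 := root_norm a
  rw [← h] at h1 ⊢
  simp only [dotProduct_sub, sub_dotProduct, (weight_dot i i).1, (weight_dot k k).1,
    dotProduct_comm (weight k) (weight i)] at h1 ⊢
  omega

variable {X Y : Matrix (Fin 4 × ℤˣ) (Fin 4 × ℤˣ) ℤ}

/-- Only one summand of the matrix product survives, because i and the root a determine k. -/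
theorem IsRootVector.mul_apply_eq {a b : rootsD4} (hX : IsRootVector a.1 X)
    (hY : IsRootVector b.1 Y) {i j k : Fin 4 × ℤˣ} (hik : weight i - weight k = a.1)
    (hkj : weight k - weight j = b.1) : (X * Y) i j = 1 ∨ (X * Y) i j = -1 := by
  have : (X * Y) i j = X i k * Y k j := by
    rw [Matrix.mul_apply]
    refine Finset.sum_eq_single k (fun l _ hl => ?_) (by simp)
    rw [hX.eq_zero i l fun h => hl (weight_injective ?_), zero_mul]
    rw [← hik] at h
    exact sub_right_injective h
  rw [this]
  rcases hX.eq_unit i k hik with h | h <;> rcases hY.eq_unit k j hkj with h' | h' <;> simp [h, h']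

theorem IsRootVector.mul_apply_eq_zero {a : rootsD4} (hX : IsRootVector a.1 X)
    {i j : Fin 4 × ℤˣ} (h : weight i ⬝ᵥ a.1 ≠ 1) : (X * Y) i j = 0 := by
  rw [Matrix.mul_apply]
  refine Finset.sum_eq_zero fun k _ => ?_
  rw [hX.eq_zero i k fun hk => h (weight_dot_of_sub hk), zero_mul]

/-- The commutator of root vectors with orthogonal roots is zero. -/
theorem IsRootVector.commute {a b : rootsD4} (hX : IsRootVector a.1 X) (hY : IsRootVector b.1 Y)
    (hab : a.1 ⬝ᵥ b.1 = 0) : X * Y = Y * X := by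
  -- A nonzero entry at (i, j) makes a + b, of norm 4, a difference of two weights, so these weights
  -- are opposite.
  have key : ∀ {a b : rootsD4} {X Y : Matrix (Fin 4 × ℤˣ) (Fin 4 × ℤˣ) ℤ},
      IsRootVector a.1 X → IsRootVector b.1 Y → a.1 ⬝ᵥ b.1 = 0 → ∀ i j,
      (X * Y) i j ≠ 0 → j = (i.1, -i.2) := by
    intro a b X Y hX hY hab i j h
    rw [Matrix.mul_apply] at h
    obtain ⟨k, -, hk⟩ := Finset.exists_ne_zero_of_sum_ne_zero h
    have h1 : weight i - weight k = a.1 := by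
      by_contra h1
      exact hk (by rw [hX.eq_zero i k h1, zero_mul])
    have h2 : weight k - weight j = b.1 := by
      by_contra h2
      exact hk (by rw [hY.eq_zero k j h2, mul_zero])
    refine (weight_dot i j).2.2 ?_
    have h3 : (a.1 + b.1) ⬝ᵥ (a.1 + b.1) = 4 := by
      simp only [dotProduct_add, add_dotProduct, root_norm, dotProduct_comm b.1 a.1, hab]
      norm_num
    rw [← h1, ← h2, sub_add_sub_cancel] at h3
    simp only [dotProduct_sub, sub_dotProduct, (weight_dot i i).1, (weight_dot j j).1,
      dotProduct_comm (weight j) (weight i)] at h3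
    omega
  -- At the remaining entries the substitution k ↦ -k and the skew symmetry of both factors exchange
  -- the two products.
  have skew : ∀ i : Fin 4 × ℤˣ, (X * Y) i (i.1, -i.2) = (Y * X) i (i.1, -i.2) := by
    intro i
    rw [Matrix.mul_apply, Matrix.mul_apply]
    let e : Fin 4 × ℤˣ ≃ Fin 4 × ℤˣ := Equiv.prodCongr (Equiv.refl _) (Equiv.neg ℤˣ)
    refine Fintype.sum_equiv e _ _ fun k => ?_
    have h1 := hX.skew i k
    have h2 := hY.skew k (i.1, -i.2)
    simp only [neg_neg] at h2
    change X i k * Y k (i.1, -i.2) = Y i (k.1, -k.2) * X (k.1, -k.2) (i.1, -i.2)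
    rw [h1, show Y i (k.1, -k.2) = _ from h2]
    ring
  ext i j
  by_cases hj : j = (i.1, -i.2)
  · rw [hj, skew]
  · rw [show (X * Y) i j = 0 by by_contra h; exact hj (key hX hY hab i j h),
      show (Y * X) i j = 0 by
        by_contra h; exact hj (key hY hX (by rw [dotProduct_comm, hab]) i j h)]

variable {N : rootsD4 → rootsD4 → ℤ}

theorem IsRootVector.smul_injective {a : rootsD4} (hX : IsRootVector a.1 X) {m n : ℤ}
    (h : m • X = n • X) : m = n := by
  obtain ⟨i, j, hij, -⟩ := exists_weight_sub a
  have h1 := congrFun (congrFun h i) j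
  simp only [Matrix.smul_apply, smul_eq_mul] at h1
  rcases hX.eq_unit i j hij with h2 | h2 <;> rw [h2] at h1 <;> omega

/-- The properties of the structure constants that are used for Steinberg groups. -/
structure IsSignSystem (N : rootsD4 → rootsD4 → ℤ) : Prop where
  sq : ∀ {a b : rootsD4}, a.1 ⬝ᵥ b.1 = -1 → N a b * N a b = 1
  antisymm : ∀ {a b : rootsD4}, a.1 ⬝ᵥ b.1 = -1 → N b a = -N a b
  jacobi : ∀ {r s d g t : rootsD4}, r.1 ⬝ᵥ d.1 = 0 → g.1 = r.1 + s.1 → t.1 = s.1 + d.1 →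
    N r s * N g d = N s d * N r t

/-- The Jacobi-type relation computes the iterated bracket of X_r, X_s, X_d in two ways, using that
X_r and X_d commute for r ⟂ d. -/
theorem IsStructureConstants.isSignSystem (hN : IsStructureConstants N) : IsSignSystem N := by
  obtain ⟨X, hX, hc⟩ := hN
  refine ⟨fun {a b} hab => ?_, fun {a b} hab => ?_, fun {r s d g t} hrd hg ht => ?_⟩
  · let c : rootsD4 := ⟨_, root_add_mem hab⟩
    obtain ⟨i, j, hij, -⟩ := exists_weight_sub c
    have h1 := congrFun (congrFun (hc a b c rfl) i) j
    simp only [Matrix.smul_apply, smul_eq_mul, Matrix.sub_apply] at h1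
    have h2 := weight_dot_of_sub hij
    simp only [c, dotProduct_add] at h2
    -- The products of the weight of i with a and b lie in [-1, 1] and add up to 1, so one is 1 and
    -- the other is 0. Hence exactly one of the two matrix products contributes, with entry ±1.
    have unit : (X a * X b) i j - (X b * X a) i j = 1 ∨
        (X a * X b) i j - (X b * X a) i j = -1 := by
      obtain ⟨l1, l2, l3⟩ := weight_dot_root i a
      obtain ⟨m1, m2, m3⟩ := weight_dot_root i b
      have hsub : ∀ k, weight i - weight k = a.1 → weight k - weight j = b.1 := by
        intro k hk
        rw [← sub_sub_sub_cancel_left _ _ (weight i), hij, hk]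
        simp [c]
      rcases eq_or_ne (weight i ⬝ᵥ a.1) 1 with h3 | h3
      · obtain ⟨k, hk⟩ := l3 h3
        rw [(hX b).mul_apply_eq_zero (by omega), sub_zero]
        exact (hX a).mul_apply_eq (hX b) hk (hsub k hk)
      · rcases eq_or_ne (weight i ⬝ᵥ b.1) 1 with h4 | h4
        · obtain ⟨k, hk⟩ := m3 h4
          rw [(hX a).mul_apply_eq_zero h3, zero_sub]
          have := (hX b).mul_apply_eq (hX a) (j := j) hk (by
            rw [← sub_sub_sub_cancel_left _ _ (weight i), hij, hk]
            simp [c])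
          omega
        · omega
    rcases (hX c).eq_unit i j hij with h3 | h3 <;> rw [h3] at h1 <;>
      rcases unit with h4 | h4 <;> rw [h4] at h1
    · rw [show N a b = 1 by omega]; norm_num
    · rw [show N a b = -1 by omega]; norm_num
    · rw [show N a b = -1 by omega]; norm_num
    · rw [show N a b = 1 by omega]; norm_num
  · let c : rootsD4 := ⟨_, root_add_mem hab⟩
    refine (hX c).smul_injective ?_
    rw [neg_smul, ← hc a b c rfl, ← hc b a c (add_comm _ _), neg_sub]
  · have hgd : g.1 ⬝ᵥ d.1 = -1 := by
      rw [hg, add_dotProduct, hrd, zero_add]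
      exact root_dot_of_add ht
    let a : rootsD4 := ⟨_, root_add_mem hgd⟩
    refine (hX a).smul_injective ?_
    have h1 : a.1 = r.1 + t.1 := by
      simp only [a, hg, ht, add_assoc]
    have e1 := hc g d a rfl
    have e2 := hc r t a h1
    have e3 := hc r s g hg
    have e4 := hc s d t ht
    have e5 := (hX r).commute (hX d) hrd
    have f1 : (N r s * N g d) • X a = (N r s • X g) * X d - X d * (N r s • X g) := by
      rw [mul_smul, ← e1, smul_sub, Matrix.smul_mul, Matrix.mul_smul]
    have f2 : (N s d * N r t) • X a = X r * (N s d • X t) - (N s d • X t) * X r := by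
      rw [mul_smul, ← e2, smul_sub, Matrix.smul_mul, Matrix.mul_smul]
    rw [f1, f2, ← e3, ← e4]
    simp only [sub_mul, mul_sub, mul_assoc, e5]
    simp only [← mul_assoc, e5]
    abel

end StructureConstants

/-! ### Calculus of lifted commutators on generalized elements. -/

section LiftedSteinberg

/-- The elements `x a p` of a group `G` satisfy the Steinberg relations and `br` has the properties
of the commutator of preimages under a central extension `H` of `G`. -/
structure IsLiftedSteinberg {R G H : Type*} [NonUnitalCommRing R] [Group G] [Group H]
    (N : rootsD4 → rootsD4 → ℤ) (x : rootsD4 → R → G) (br : G → G → H) : Prop where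
  signs : IsSignSystem N
  map_add : ∀ a p q, x a (p + q) = x a p * x a q
  commutator_root : ∀ a b c : rootsD4, c.1 = a.1 + b.1 → ∀ p q,
    ⁅x a p, x b q⁆ = x c (N a b • (p * q))
  commutator_one : ∀ a b : rootsD4, 0 ≤ a.1 ⬝ᵥ b.1 → ∀ p q, ⁅x a p, x b q⁆ = 1
  br_mul_left : ∀ g g' h : G, br (g * g') h = br g ⁅g', h⁆ * br g' h * br g h
  br_swap : ∀ g h : G, br h g = (br g h)⁻¹
  br_hallWitt : ∀ r s d : G, ⁅r, d⁆ = 1 →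
    br r ⁅s, d⁆ * br s d = br ⁅r, s⁆ ⁅s, d⁆ * br s d * br ⁅r, s⁆ d
  br_comm : ∀ g h g' h' : G, ⁅br g h, br g' h'⁆ = br ⁅g, h⁆ ⁅g', h'⁆
  br_central : ∀ g h : G, ⁅g, h⁆ = 1 → ∀ z : H, Commute (br g h) z
  br_triv : ∀ g h z : G, ⁅g, z⁆ = 1 → ⁅h, z⁆ = 1 → br ⁅g, h⁆ z = 1
  nonorth : ∀ a b : rootsD4, 0 < a.1 ⬝ᵥ b.1 → ∀ p q, br (x a p) (x b q) = 1

namespace IsLiftedSteinberg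

variable {R G H : Type*} [NonUnitalCommRing R] [Group G] [Group H]
variable {N : rootsD4 → rootsD4 → ℤ} {x : rootsD4 → R → G} {br : G → G → H}

theorem br_one_left (h : IsLiftedSteinberg N x br) (z : G) : br 1 z = 1 := by
  have := h.br_triv 1 1 z (by simp) (by simp)
  simpa using this

theorem br_one_right (h : IsLiftedSteinberg N x br) (z : G) : br z 1 = 1 := by
  rw [h.br_swap, h.br_one_left, inv_one]

/-- By `br_comm` their commutator is the lifted commutator of elements that are trivial or have the
roots a + b and a' + b', and roots with positive scalar product give 1. -/
theorem commute_br (h : IsLiftedSteinberg N x br) {a b a' b' : rootsD4}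
    (hab : -1 ≤ a.1 ⬝ᵥ b.1) (hab' : -1 ≤ a'.1 ⬝ᵥ b'.1)
    (hs : 0 < (a.1 + b.1) ⬝ᵥ (a'.1 + b'.1)) (p q p' q' : R) :
    Commute (br (x a p) (x b q)) (br (x a' p') (x b' q')) := by
  rw [← commutatorElement_eq_one_iff_commute, h.br_comm]
  rcases hab.eq_or_lt with h1 | h1
  · rcases hab'.eq_or_lt with h2 | h2
    · rw [h.commutator_root a b ⟨_, root_add_mem h1.symm⟩ rfl,
        h.commutator_root a' b' ⟨_, root_add_mem h2.symm⟩ rfl]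
      exact h.nonorth _ _ hs _ _
    · rw [h.commutator_one a' b' (by omega), h.br_one_right]
  · rw [h.commutator_one a b (by omega), h.br_one_left]

/-- The correction term of the commutator identity is trivial, since a has positive scalar product
with a + b when a + b is a root. -/
theorem add_left (h : IsLiftedSteinberg N x br) {a b : rootsD4} (hab : -1 ≤ a.1 ⬝ᵥ b.1)
    (p p' q : R) : br (x a (p + p')) (x b q) = br (x a p) (x b q) * br (x a p') (x b q) := by
  have h0 : br (x a p) ⁅x a p', x b q⁆ = 1 := by
    rcases hab.eq_or_lt with h1 | h1
    · rw [h.commutator_root a b ⟨_, root_add_mem h1.symm⟩ rfl]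
      refine h.nonorth _ _ ?_ _ _
      simp only [dotProduct_add, root_norm]
      omega
    · rw [h.commutator_one a b (by omega), h.br_one_right]
  rw [h.map_add, h.br_mul_left, h0, one_mul]
  refine h.commute_br hab hab ?_ _ _ _ _
  simp only [dotProduct_add, add_dotProduct, root_norm, dotProduct_comm b.1 a.1]
  omega

/-- The lifted commutators as homomorphisms in the first argument. -/
def homLeft (h : IsLiftedSteinberg N x br) {a b : rootsD4} (hab : -1 ≤ a.1 ⬝ᵥ b.1) (q : R) :
    R →+ Additive H :=
  AddMonoidHom.mk' (fun p => Additive.ofMul (br (x a p) (x b q))) fun p p' => h.add_left hab p p' q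

theorem zsmul_left (h : IsLiftedSteinberg N x br) {a b : rootsD4} (hab : -1 ≤ a.1 ⬝ᵥ b.1)
    (n : ℤ) (p q : R) : br (x a (n • p)) (x b q) = br (x a p) (x b q) ^ n :=
  map_zsmul (h.homLeft hab q) n p

theorem zsmul_zsmul (h : IsLiftedSteinberg N x br) {a b : rootsD4} (hab : -1 ≤ a.1 ⬝ᵥ b.1)
    (n m : ℤ) (p q : R) : br (x a (n • p)) (x b (m • q)) = br (x a p) (x b q) ^ (n * m) := by
  rw [h.zsmul_left hab, h.br_swap, h.zsmul_left (by rwa [dotProduct_comm]), h.br_swap (x a p),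
    ← zpow_neg, ← zpow_mul, ← zpow_neg_one, ← zpow_mul]
  congr 1
  ring

theorem add_right (h : IsLiftedSteinberg N x br) {a b : rootsD4} (hab : -1 ≤ a.1 ⬝ᵥ b.1)
    (p q q' : R) : br (x a p) (x b (q + q')) = br (x a p) (x b q) * br (x a p) (x b q') := by
  rw [h.br_swap, h.add_left (by rwa [dotProduct_comm]), mul_inv_rev, ← h.br_swap, ← h.br_swap]
  refine h.commute_br hab hab ?_ _ _ _ _
  simp only [dotProduct_add, add_dotProduct, root_norm, dotProduct_comm b.1 a.1]
  omega

/-- Two lifted commutators of a subsystem of type `A3` differ by the lifted commutator of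
orthogonal roots. -/
theorem br_triple (h : IsLiftedSteinberg N x br) {r s d g t : rootsD4} (hrd : r.1 ⬝ᵥ d.1 = 0)
    (hg : g.1 = r.1 + s.1) (ht : t.1 = s.1 + d.1) (a b c : R) :
    br (x r a) (x t (N s d • (b * c))) =
      br (x g (N r s • (a * b))) (x t (N s d • (b * c))) *
        br (x g (N r s • (a * b))) (x d c) := by
  have h1 := h.br_hallWitt (x r a) (x s b) (x d c) (h.commutator_one r d hrd.ge _ _)
  rw [h.commutator_root s d t ht, h.commutator_root r s g hg] at h1
  have hrs := root_dot_of_add hg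
  have hsd := root_dot_of_add ht
  have h2 : Commute (br (x s b) (x d c)) (br (x g (N r s • (a * b))) (x d c)) := by
    refine h.commute_br hsd.ge ?_ ?_ _ _ _ _
    · rw [hg, add_dotProduct, hrd, hsd, zero_add]
    · rw [hg]
      simp only [dotProduct_add, add_dotProduct, root_norm, dotProduct_comm s.1 r.1,
        dotProduct_comm d.1 r.1, dotProduct_comm d.1 s.1, hrd, hsd, hrs]
      norm_num
  rw [mul_assoc, h2.eq, ← mul_assoc] at h1
  exact mul_right_cancel h1

theorem br_polarize (h : IsLiftedSteinberg N x br) {g t : rootsD4} (hgt : g.1 ⬝ᵥ t.1 = 0)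
    (a b b' c : R) :
    br (x g (a * b)) (x t (b' * c)) * br (x g (a * b')) (x t (b * c)) = 1 := by
  obtain ⟨s, hsg, hst⟩ := exists_root_dot_one_one hgt
  rw [dotProduct_comm] at hsg hst
  let r : rootsD4 := ⟨_, root_sub_mem hsg⟩
  let d : rootsD4 := ⟨_, root_sub_mem hst⟩
  have hg : g.1 = r.1 + s.1 := by simp [r]
  have ht : t.1 = s.1 + d.1 := by simp [d]
  have hrd : r.1 ⬝ᵥ d.1 = 0 := by
    simp only [r, d, dotProduct_sub, sub_dotProduct, hgt, hsg, dotProduct_comm s.1 t.1, hst,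
      root_norm]
    norm_num
  have hrt : r.1 ⬝ᵥ t.1 = -1 := by
    simp only [r, sub_dotProduct, hgt, dotProduct_comm s.1 t.1, hst]
    norm_num
  have hgd : g.1 ⬝ᵥ d.1 = -1 := by
    simp only [d, dotProduct_sub, hgt, hsg]
    norm_num
  have hrs := root_dot_of_add hg
  have hsd := root_dot_of_add ht
  have hgt' : -1 ≤ g.1 ⬝ᵥ t.1 := by omega
  have cen : ∀ p q z, Commute (br (x g p) (x t q)) z := fun p q z =>
    h.br_central _ _ (h.commutator_one g t hgt.ge _ _) z
  set S : R → R → H := fun b b' => br (x g (N r s • (a * b))) (x t (N s d • (b' * c))) with hS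
  set B : R → H := fun b => br (x g (N r s • (a * b))) (x d c) with hB
  have hB' : B (b + b') = B b * B b' := by
    simp only [hB]
    rw [mul_add, smul_add, h.add_left hgd.ge]
  have hS' : S (b + b') (b + b') = S b b * S b' b' * (S b b' * S b' b) := by
    have hl : ∀ b b' e, S (b + b') e = S b e * S b' e := fun b b' e => by
      simp only [hS]
      rw [mul_add, smul_add, h.add_left hgt']
    have hr : ∀ b b' e, S e (b + b') = S e b * S e b' := fun b b' e => by
      simp only [hS]
      rw [add_mul, smul_add, h.add_right hgt']
    rw [hl, hr, hr, mul_assoc, ← mul_assoc (S b b'),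
      ((cen _ _ _).mul_left (cen _ _ _) : Commute (S b b' * S b' b) _).eq, ← mul_assoc]
  have h1 : S (b + b') (b + b') * B (b + b') = S b b * B b * (S b' b' * B b') := by
    simp only [hS, hB]
    rw [← h.br_triple hrd hg ht, ← h.br_triple hrd hg ht, ← h.br_triple hrd hg ht, add_mul,
      smul_add, h.add_right hrt.ge]
  have h2 : S b b' * S b' b = 1 := by
    rw [hB', hS', mul_assoc (S b b) (B b), ← mul_assoc (B b), ← (cen _ _ (B b)).eq,
      mul_assoc (S b' b'), ← mul_assoc (S b b) (S b' b')] at h1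
    exact mul_eq_left.mp (mul_right_cancel h1)
  have h3 : S b b' * S b' b = (br (x g (a * b)) (x t (b' * c)) *
      br (x g (a * b')) (x t (b * c))) ^ (N r s * N s d) := by
    simp only [hS]
    rw [h.zsmul_zsmul hgt', h.zsmul_zsmul hgt', (cen _ _ _).mul_zpow]
  have h4 : N r s * N s d * (N r s * N s d) = 1 := by
    have e1 := h.signs.sq hrs
    have e2 := h.signs.sq hsd
    linear_combination N s d * N s d * e1 + e2
  rw [h2] at h3
  have h5 := congrArg (· ^ (N r s * N s d)) h3
  simp only [one_zpow, ← zpow_mul, h4, zpow_one] at h5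
  exact h5.symm

/-- The lifted commutator of orthogonal roots is invariant under a change of the roots which
preserves their sum. -/
theorem br_move (h : IsLiftedSteinberg N x br) {a b a' b' c : rootsD4}
    (hab : a.1 ⬝ᵥ b.1 = 0) (ha : a.1 = a'.1 + c.1) (hb : b'.1 = c.1 + b.1)
    (ha'b : a'.1 ⬝ᵥ b.1 = 1) (p q r : R) :
    br (x a (N a' c • (p * q))) (x b r) = br (x a' p) (x b' (N c b • (q * r))) := by
  -- The factor with the roots a and b' drops out of the Hall–Witt identity because a · b' = 1.
  have h1 := h.br_hallWitt (x a' p) (x c q) (x b r) (h.commutator_one a' b (by omega) _ _)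
  rw [h.commutator_root c b b' hb, h.commutator_root a' c a ha, h.nonorth a b' ?_, one_mul,
    ← (h.br_central _ _ (h.commutator_one a b hab.ge _ _) _).eq] at h1
  · exact (mul_right_cancel h1).symm
  · rw [hb, dotProduct_add, hab, ha, add_dotProduct, root_dot_of_add ha, root_norm]
    norm_num

/-- The lifted commutator normalized to lift the root element with parameter `p * q`. -/
def rootLift (N : rootsD4 → rootsD4 → ℤ) (x : rootsD4 → R → G) (br : G → G → H)
    (a b : rootsD4) (p q : R) : H :=
  br (x a (N a b • p)) (x b q)

theorem rootLift_swap (h : IsLiftedSteinberg N x br) {a b : rootsD4} (hab : a.1 ⬝ᵥ b.1 = -1)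
    (p q : R) : rootLift N x br b a q p = rootLift N x br a b p q := by
  have hba : b.1 ⬝ᵥ a.1 = -1 := by rw [dotProduct_comm, hab]
  rw [rootLift, rootLift, h.zsmul_left hba.ge, h.zsmul_left hab.ge, h.br_swap, h.signs.antisymm hab,
    inv_zpow, zpow_neg, inv_inv]

/-- This is `br_triple` freed of signs: the Jacobi relation for `N` matches the signs of the two
lifts, and the sign left on `P` does not matter by 2-torsion. -/
theorem rootLift_triple (h : IsLiftedSteinberg N x br) {r s d g t : rootsD4}
    (hrd : r.1 ⬝ᵥ d.1 = 0) (hg : g.1 = r.1 + s.1) (ht : t.1 = s.1 + d.1) {P : R → H}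
    (hP : ∀ p q, br (x g p) (x t q) = P (p * q)) (hP2 : ∀ p, P p * P p = 1) (a b c : R) :
    rootLift N x br r t a (b * c) = rootLift N x br g d (a * b) c * P (a * b * (b * c)) := by
  have hrs := root_dot_of_add hg
  have hsd := root_dot_of_add ht
  have hrt : r.1 ⬝ᵥ t.1 = -1 := by rw [ht, dotProduct_add, hrs, hrd, add_zero]
  have hgd : g.1 ⬝ᵥ d.1 = -1 := by rw [hg, add_dotProduct, hrd, hsd, zero_add]
  have hgt : g.1 ⬝ᵥ t.1 = 0 := by
    rw [hg, ht]
    simp only [dotProduct_add, add_dotProduct, hrd, hrs, hsd, root_norm]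
    norm_num
  have e1 := h.signs.sq hrs
  have e2 := h.signs.sq hsd
  have e3 := h.signs.sq hrt
  have e4 := h.signs.jacobi hrd hg ht
  have h1 := h.br_triple hrd hg ht ((N r t * N s d) • a) b c
  rw [smul_mul_assoc, smul_smul, h.zsmul_zsmul hrt.ge, h.zsmul_zsmul (by omega),
    h.zsmul_left hgd.ge, mul_assoc (N r t), e2, mul_one,
    show N r s * (N r t * N s d) = N g d by linear_combination N g d * e1 - N r s * e4] at h1
  rw [rootLift, rootLift, h.zsmul_left hrt.ge, h.zsmul_left hgd.ge, h1,
    (h.br_central _ _ (h.commutator_one g t hgt.ge _ _) _).zpow_left _ |>.eq, hP]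
  congr 1
  have e5 : (N g d * N s d) * (N g d * N s d) = 1 := by
    have := h.signs.sq hgd
    linear_combination N s d * N s d * this + e2
  have e6 : (P (a * b * (b * c)))⁻¹ = P (a * b * (b * c)) := inv_eq_of_mul_eq_one_left (hP2 _)
  rcases Int.isUnit_iff.mp (IsUnit.of_mul_eq_one _ e5) with e7 | e7 <;> rw [e7] <;> simp [e6]

theorem rootLift_add_left (h : IsLiftedSteinberg N x br) {a b : rootsD4} (hab : a.1 ⬝ᵥ b.1 = -1)
    (p p' q : R) :
    rootLift N x br a b (p + p') q = rootLift N x br a b p q * rootLift N x br a b p' q := by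
  rw [rootLift, smul_add, h.add_left hab.ge, rootLift, rootLift]

end IsLiftedSteinberg

end LiftedSteinberg

/-! ### Consequences of the defect relations between two lifts. -/

section Defect

variable {R H : Type*} [NonUnitalCommRing R] [Group H]

variable {A : Type*} [AddCommGroup A] {j : A → H} {f f' : R → R → H} {P Q : R →+ A}

/-- The way from f to f' and back moves x and y to the first argument, each at the cost of one
defect. -/
theorem defect_eq_add (hj : ∀ m n, j (m + n) = j m * j n)
    (hQ : ∀ a b c, f a (b * c) = f' (a * b) c * j (Q (a * b * (b * c))))
    (hP : ∀ a b c, f' a (b * c) = f (a * b) c * j (P (a * b * (b * c)))) (a x y c : R) :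
    f a (x * (y * c)) = f (a * x * y) c *
      j (P (a * x * y * (y * c)) + Q (a * x * (x * (y * c)))) := by
  rw [hQ, hP, hj, mul_assoc]

/-- Move d⁴ between the arguments of f in one round trip as d² · d², or in two round trips as d · d
each. The first costs (P + Q)(ad⁸), the second twice (P + Q)(ad⁷), which is zero. This is where
eighth powers are needed. -/
theorem defect_eq (hj : ∀ m n, j (m + n) = j m * j n) (hj' : Function.Injective j)
    (hP2 : ∀ p, P p + P p = 0) (hQ2 : ∀ p, Q p + Q p = 0)
    (hQ : ∀ a b c, f a (b * c) = f' (a * b) c * j (Q (a * b * (b * c))))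
    (hP : ∀ a b c, f' a (b * c) = f (a * b) c * j (P (a * b * (b * c)))) (a d : R) :
    P (a * (((d * d) * (d * d)) * ((d * d) * (d * d)))) =
      Q (a * (((d * d) * (d * d)) * ((d * d) * (d * d)))) := by
  have h1 := defect_eq_add hj hQ hP a (d * d) (d * d) (d * d)
  have h2 := defect_eq_add hj hQ hP a d d ((d * d) * (d * d))
  have h3 := defect_eq_add hj hQ hP (a * d * d) d d (d * d)
  have e1 : d * (d * (d * d * (d * d))) = d * d * (d * d * (d * d)) := by ac_rfl
  have e2 : a * d * d * d * d = a * (d * d) * (d * d) := by ac_rfl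
  have e3 : d * (d * (d * d)) = d * d * (d * d) := by ac_rfl
  rw [e3, e2] at h3
  rw [e1, h1, h3, mul_assoc (f _ _), ← hj] at h2
  have h4 := hj' (mul_left_cancel h2)
  have a1 : a * (d * d) * (d * d) * (d * d * (d * d)) =
    a * (((d * d) * (d * d)) * ((d * d) * (d * d))) := by ac_rfl
  have a2 : a * (d * d) * (d * d * (d * d * (d * d))) =
    a * (((d * d) * (d * d)) * ((d * d) * (d * d))) := by ac_rfl
  have a3 : a * (d * d) * (d * d) * (d * (d * d)) = a * d * d * (d * (d * d * (d * d))) := by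
    ac_rfl
  have a4 : a * d * d * d * (d * d * (d * d)) = a * d * (d * d * (d * d * (d * d))) := by
    ac_rfl
  rw [a1, a2, a3, a4, add_add_add_comm, hP2, hQ2, add_zero] at h4
  exact (eq_neg_of_add_eq_zero_left h4).trans (eq_neg_of_add_eq_zero_left (hQ2 _)).symm

theorem sub_eq_add_of_two_torsion {A : Type*} [AddCommGroup A] {b : A} (h : b + b = 0) (a : A) :
    a - b = a + b := by
  rw [sub_eq_add_neg, ← eq_neg_of_add_eq_zero_left h]

theorem map_mul_sub_self (hP2 : ∀ p, P p + P p = 0) (r p : R) :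
    P (r * (p * p - p)) = P (r * (p * p)) + P (r * p) := by
  rw [mul_sub, map_sub, sub_eq_add_of_two_torsion (hP2 _)]

/-- The relation between the parameters of the two defects. -/
theorem map_eps_relator (hj' : Function.Injective j) (hP2 : ∀ p, P p + P p = 0)
    (hP : ∀ a x y c, f a (x * (y * c)) = f (a * x * y) c *
      j (P (a * x * y * (y * c)) + P (a * x * (x * (y * c))))) (a d p q : R) :
    P (a * (((d * d) * (d * d)) * ((d * d) * (d * d))) * ((p * p - p) * (q * q - q))) = 0 := by
  -- The same product pqd² is moved as (pd)(qd) and as (pdq)d. With e = d⁸, comparison of the costs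
  -- gives P(aepq²) + P(aep²q) = P(aepq) + P(aep²q²).
  have h1 := hP a (p * d) (q * d) ((d * d) * ((d * d) * d))
  have h2 := hP a ((p * d) * q) d ((d * d) * ((d * d) * d))
  have e1 : p * d * q * (d * ((d * d) * ((d * d) * d))) =
    p * d * (q * d * ((d * d) * ((d * d) * d))) := by ac_rfl
  have e2 : a * (p * d * q) * d = a * (p * d) * (q * d) := by ac_rfl
  rw [e1, e2, h1] at h2
  have h3 := hj' (mul_left_cancel h2)
  set e := ((d * d) * (d * d)) * ((d * d) * (d * d)) with he
  have a1 : a * (p * d) * (q * d) * (q * d * (d * d * (d * d * d))) =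
    a * e * p * (q * q) := by rw [he]; ac_rfl
  have a2 : a * (p * d) * (p * d * (q * d * (d * d * (d * d * d)))) =
    a * e * (p * p) * q := by rw [he]; ac_rfl
  have a3 : a * (p * d) * (q * d) * (d * (d * d * (d * d * d))) =
    a * e * p * q := by rw [he]; ac_rfl
  have a4 : a * (p * d * q) * (p * d * (q * d * (d * d * (d * d * d)))) =
    a * e * (p * p) * (q * q) := by rw [he]; ac_rfl
  rw [a1, a2, a3, a4] at h3
  have h4 : P (a * e * (p * p) * (q * q)) - P (a * e * p * (q * q)) =
      P (a * e * (p * p) * q) - P (a * e * p * q) := by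
    rw [sub_eq_sub_iff_add_eq_add, add_comm, ← h3, add_comm]
  rw [← mul_assoc, map_mul_sub_self hP2, mul_sub, sub_mul, sub_mul, map_sub, map_sub, h4,
    sub_add_sub_comm, hP2, hP2, sub_zero]

/-- Both P and Q measure the same change of f when pd · d is moved, and this cost is the value at a
d⁸ (p² + p). -/
theorem map_ideal_eq (hj' : Function.Injective j) (hP2 : ∀ p, P p + P p = 0)
    (hQ2 : ∀ p, Q p + Q p = 0)
    (hP : ∀ a x y c, f a (x * (y * c)) = f (a * x * y) c *
      j (P (a * x * y * (y * c)) + P (a * x * (x * (y * c)))))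
    (hQ : ∀ a x y c, f a (x * (y * c)) = f (a * x * y) c *
      j (Q (a * x * y * (y * c)) + Q (a * x * (x * (y * c))))) (a d p : R) :
    P (a * (((d * d) * (d * d)) * ((d * d) * (d * d))) * (p * p - p)) =
      Q (a * (((d * d) * (d * d)) * ((d * d) * (d * d))) * (p * p - p)) := by
  have h1 := hP a (p * d) d ((d * d) * ((d * d) * d))
  rw [hQ] at h1
  have h3 := hj' (mul_left_cancel h1)
  set e := ((d * d) * (d * d)) * ((d * d) * (d * d)) with he
  have a1 : a * (p * d) * d * (d * (d * d * (d * d * d))) = a * e * p := by rw [he]; ac_rfl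
  have a2 : a * (p * d) * (p * d * (d * (d * d * (d * d * d)))) = a * e * (p * p) := by
    rw [he]; ac_rfl
  rw [a1, a2, add_comm, add_comm (P (a * e * p))] at h3
  rw [map_mul_sub_self hP2, map_mul_sub_self hQ2, ← h3]

/-- Going from fA to fB directly costs P₂(vd²), and through fC it costs P₀(vd) + P₁(vd), where v =
a²d⁴. As P₀ and P₁ agree on v(d² - d), the latter sum may be replaced by P₀(vd²) + P₁(vd²), and vd²
= (ad³)². -/
theorem map_triangle (hj : ∀ m n, j (m + n) = j m * j n) (hj' : Function.Injective j)
    {fA fB fC : R → R → H} {P₀ P₁ P₂ : R →+ A}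
    (h₀2 : ∀ p, P₀ p + P₀ p = 0) (h₁2 : ∀ p, P₁ p + P₁ p = 0)
    (h₂ : ∀ a b c, fA a (b * c) = fB (a * b) c * j (P₂ (a * b * (b * c))))
    (h₁ : ∀ a b c, fA a (b * c) = fC (a * b) c * j (P₁ (a * b * (b * c))))
    (h₀ : ∀ a b c, fC a (b * c) = fB c (a * b) * j (P₀ (a * b * (b * c))))
    (h₀₁ : ∀ r p, P₀ (r * (p * p - p)) = P₁ (r * (p * p - p))) (a d : R) :
    P₀ ((a * (d * (d * d))) * (a * (d * (d * d)))) +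
        P₁ ((a * (d * (d * d))) * (a * (d * (d * d)))) +
      P₂ ((a * (d * (d * d))) * (a * (d * (d * d)))) = 0 := by
  have k1 := h₂ a (d * d) (a * (d * d))
  have k2 := h₁ a d (d * (a * (d * d)))
  have k3 := h₀ (a * d) d (a * (d * d))
  have e1 : d * (d * (a * (d * d))) = d * d * (a * (d * d)) := by ac_rfl
  rw [mul_assoc a d d] at k3
  rw [e1, k1, k3, mul_assoc (fB _ _), ← hj] at k2
  have k4 := hj' (mul_left_cancel k2)
  set u := (a * (d * (d * d))) * (a * (d * (d * d))) with hu
  set v := a * a * ((d * d) * (d * d)) with hv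
  have a1 : a * (d * d) * (d * d * (a * (d * d))) = v * (d * d) := by rw [hv]; ac_rfl
  have a2 : a * (d * d) * (d * (a * (d * d))) = v * d := by rw [hv]; ac_rfl
  have a3 : a * d * (d * d * (a * (d * d))) = v * d := by rw [hv]; ac_rfl
  have a4 : u = v * (d * d) := by rw [hu, hv]; ac_rfl
  have k5 := h₀₁ v d
  rw [map_mul_sub_self h₀2, map_mul_sub_self h₁2] at k5
  rw [a1, a2, a3] at k4
  rw [a4, k4, add_add_add_comm, k5, add_add_add_comm, h₁2, h₁2, add_zero]

end Defect

/-! ### The commutator pairing of a central extension. -/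

section Pairing

variable {C : Type u} [Category.{v} C] [CartesianMonoidalCategory C]

theorem comp_commutator {S T G : C} [GrpObj G] (f : S ⟶ T) (g h : T ⟶ G) :
    f ≫ ⁅g, h⁆ = ⁅f ≫ g, f ≫ h⁆ := by
  simp only [commutatorElement_def, MonObj.comp_mul, GrpObj.comp_inv]

theorem mul_comp_hom {T G H : C} [GrpObj G] [GrpObj H] {f : G ⟶ H} (hf : IsMonHom f)
    (g h : T ⟶ G) : (g * h) ≫ f = (g ≫ f) * (h ≫ f) :=
  MonObj.mul_comp g h f

theorem commutator_comp_hom {T G H : C} [GrpObj G] [GrpObj H] {f : G ⟶ H} (hf : IsMonHom f)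
    (g h : T ⟶ G) : ⁅g, h⁆ ≫ f = ⁅g ≫ f, h ≫ f⁆ := by
  simp only [commutatorElement_def, MonObj.mul_comp, GrpObj.inv_comp]

variable {G H : C} [GrpObj G] [GrpObj H] {k : H ⟶ G}

theorem IsCentralExtension.commutator_eq (hk : IsCentralExtension k) {T : C} {g h g' h' : T ⟶ H}
    (hg : g ≫ k = g' ≫ k) (hh : h ≫ k = h' ≫ k) : ⁅g, h⁆ = ⁅g', h'⁆ := by
  have := hk.isMonHom
  obtain ⟨z, rfl⟩ : ∃ z, g = g' * z := ⟨g'⁻¹ * g, by simp⟩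
  obtain ⟨w, rfl⟩ : ∃ w, h = h' * w := ⟨h'⁻¹ * h, by simp⟩
  rw [MonObj.mul_comp, mul_eq_left] at hg hh
  have hz := fun y => hk.central z y hg
  have hw := fun y => hk.central w y hh
  simp only [commutatorElement_def, mul_inv_rev]
  calc g' * z * (h' * w) * (z⁻¹ * g'⁻¹) * (w⁻¹ * h'⁻¹)
      = g' * (z * (h' * w)) * z⁻¹ * g'⁻¹ * w⁻¹ * h'⁻¹ := by simp only [mul_assoc]
    _ = g' * h' * (w * g'⁻¹) * w⁻¹ * h'⁻¹ := by rw [hz]; simp only [mul_assoc, mul_inv_cancel_left]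
    _ = g' * h' * g'⁻¹ * h'⁻¹ := by rw [hw]; simp only [mul_assoc, mul_inv_cancel_left]

variable [Regular C]

theorem IsCentralExtension.exists_pairing (hk : IsCentralExtension k) :
    ∃ br : G ⊗ G ⟶ H, ∀ {T : C} (g h : T ⟶ H), lift (g ≫ k) (h ≫ k) ≫ br = ⁅g, h⁆ := by
  obtain ⟨br, hbr⟩ := exists_desc (isRegularEpi_tensor hk.isRegularEpi hk.isRegularEpi)
    ⁅fst H H, snd H H⁆ fun T u v huv => by
      rw [comp_commutator, comp_commutator]
      refine hk.commutator_eq ?_ ?_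
      · simpa using congrArg (· ≫ fst G G) huv
      · simpa using congrArg (· ≫ snd G G) huv
  refine ⟨br, fun g h => ?_⟩
  have := congrArg (lift g h ≫ ·) hbr
  simpa [comp_commutator] using this

/-- The commutator of arbitrary preimages under a central extension. -/
noncomputable def liftedComm (hk : IsCentralExtension k) {T : C} (g h : T ⟶ G) : T ⟶ H :=
  lift g h ≫ hk.exists_pairing.choose

theorem liftedComm_comp (hk : IsCentralExtension k) {T : C} (g h : T ⟶ H) :
    liftedComm hk (g ≫ k) (h ≫ k) = ⁅g, h⁆ :=
  hk.exists_pairing.choose_spec g h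

theorem liftedComm_eq (hk : IsCentralExtension k) {T : C} {g h : T ⟶ G} {g' h' : T ⟶ H}
    (hg : g' ≫ k = g) (hh : h' ≫ k = h) : liftedComm hk g h = ⁅g', h'⁆ := by
  rw [← liftedComm_comp hk, hg, hh]

theorem comp_liftedComm (hk : IsCentralExtension k) {S T : C} (f : S ⟶ T) (g h : T ⟶ G) :
    f ≫ liftedComm hk g h = liftedComm hk (f ≫ g) (f ≫ h) := by
  rw [liftedComm, liftedComm, ← Category.assoc, comp_lift]

theorem IsCentralExtension.exists_lift (hk : IsCentralExtension k) {T : C} (g : T ⟶ G) :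
    ∃ (T' : C) (e : T' ⟶ T) (g' : T' ⟶ H), IsRegularEpi e ∧ g' ≫ k = e ≫ g :=
  exists_local_lift hk.isRegularEpi g

theorem IsCentralExtension.exists_lift₂ (hk : IsCentralExtension k) {T : C} (g h : T ⟶ G) :
    ∃ (T' : C) (e : T' ⟶ T) (g' h' : T' ⟶ H), IsRegularEpi e ∧ g' ≫ k = e ≫ g ∧
      h' ≫ k = e ≫ h := by
  obtain ⟨T₁, e₁, g₁, he₁, h₁⟩ := hk.exists_lift g
  obtain ⟨T₂, e₂, g₂, he₂, h₂⟩ := hk.exists_lift (e₁ ≫ h)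
  exact ⟨T₂, e₂ ≫ e₁, e₂ ≫ g₁, g₂, isRegularEpi_comp he₂ he₁, by simp [h₁], by simp [h₂]⟩

theorem IsCentralExtension.exists_lift₃ (hk : IsCentralExtension k) {T : C} (g h l : T ⟶ G) :
    ∃ (T' : C) (e : T' ⟶ T) (g' h' l' : T' ⟶ H), IsRegularEpi e ∧ g' ≫ k = e ≫ g ∧
      h' ≫ k = e ≫ h ∧ l' ≫ k = e ≫ l := by
  obtain ⟨T₁, e₁, g₁, g₂, he₁, h₁, h₂⟩ := hk.exists_lift₂ g h
  obtain ⟨T₂, e₂, g₃, he₂, h₃⟩ := hk.exists_lift (e₁ ≫ l)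
  exact ⟨T₂, e₂ ≫ e₁, e₂ ≫ g₁, e₂ ≫ g₂, g₃, isRegularEpi_comp he₂ he₁, by simp [h₁],
    by simp [h₂], by simp [h₃]⟩

theorem liftedComm_comp_hom (hk : IsCentralExtension k) {T : C} (g h : T ⟶ G) :
    liftedComm hk g h ≫ k = ⁅g, h⁆ := by
  obtain ⟨T', e, g', h', he, hg, hh⟩ := hk.exists_lift₂ g h
  refine eq_of_cover he ?_
  rw [comp_commutator, ← Category.assoc, comp_liftedComm, liftedComm_eq hk hg hh,
    commutator_comp_hom hk.isMonHom, hg, hh]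

theorem liftedComm_mul_left (hk : IsCentralExtension k) {T : C} (g g' h : T ⟶ G) :
    liftedComm hk (g * g') h =
      liftedComm hk g ⁅g', h⁆ * liftedComm hk g' h * liftedComm hk g h := by
  have := hk.isMonHom
  obtain ⟨T', e, l, l', m, he, hl, hl', hm⟩ := hk.exists_lift₃ g g' h
  refine eq_of_cover he ?_
  simp only [MonObj.comp_mul, comp_liftedComm, comp_commutator, ← hl, ← hl', ← hm,
    ← mul_comp_hom hk.isMonHom, ← commutator_comp_hom hk.isMonHom, liftedComm_comp]
  simp only [commutatorElement_def]
  group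

theorem liftedComm_swap (hk : IsCentralExtension k) {T : C} (g h : T ⟶ G) :
    liftedComm hk h g = (liftedComm hk g h)⁻¹ := by
  obtain ⟨T', e, l, m, he, hl, hm⟩ := hk.exists_lift₂ g h
  refine eq_of_cover he ?_
  simp only [GrpObj.comp_inv, comp_liftedComm, ← hl, ← hm, liftedComm_comp,
    commutatorElement_inv]

theorem liftedComm_central (hk : IsCentralExtension k) {T : C} {g h : T ⟶ G} (hgh : ⁅g, h⁆ = 1)
    (z : T ⟶ H) : Commute (liftedComm hk g h) z :=
  hk.central _ _ (by rw [liftedComm_comp_hom, hgh])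

theorem commutator_liftedComm (hk : IsCentralExtension k) {T : C} (g h g' h' : T ⟶ G) :
    ⁅liftedComm hk g h, liftedComm hk g' h'⁆ = liftedComm hk ⁅g, h⁆ ⁅g', h'⁆ := by
  rw [← liftedComm_comp hk, liftedComm_comp_hom, liftedComm_comp_hom]

/-- Conjugation by a preimage of z changes the preimages of g and h by central elements only, so it
fixes their commutator. -/
theorem liftedComm_triv (hk : IsCentralExtension k) {T : C} {g h z : T ⟶ G} (hg : ⁅g, z⁆ = 1)
    (hh : ⁅h, z⁆ = 1) : liftedComm hk ⁅g, h⁆ z = 1 := by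
  have := hk.isMonHom
  obtain ⟨T', e, l, m, n, he, hl, hm, hn⟩ := hk.exists_lift₃ g h z
  refine eq_of_cover he ?_
  rw [comp_liftedComm, comp_commutator, ← hl, ← hm, ← hn, ← commutator_comp_hom hk.isMonHom,
    liftedComm_comp, MonObj.comp_one, commutatorElement_eq_one_iff_mul_comm]
  have h1 : ⁅n * l * n⁻¹, n * m * n⁻¹⁆ = ⁅l, m⁆ := by
    refine hk.commutator_eq ?_ ?_
    · rw [commutatorElement_eq_one_iff_mul_comm] at hg
      have := congrArg (e ≫ ·) hg
      simp only [MonObj.comp_mul, ← hl, ← hn] at this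
      rw [MonObj.mul_comp, MonObj.mul_comp, GrpObj.inv_comp, ← this, mul_inv_cancel_right]
    · rw [commutatorElement_eq_one_iff_mul_comm] at hh
      have := congrArg (e ≫ ·) hh
      simp only [MonObj.comp_mul, ← hm, ← hn] at this
      rw [MonObj.mul_comp, MonObj.mul_comp, GrpObj.inv_comp, ← this, mul_inv_cancel_right]
  rw [← conjugate_commutatorElement, mul_inv_eq_iff_eq_mul] at h1
  exact h1.symm

/-- Conjugate ⁅m, n⁆ by l, for preimages l, m, n of r, s, d. Since r and d commute, n may be left
unconjugated, and the conjugate of m is ⁅l, m⁆ m. -/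
theorem liftedComm_hallWitt (hk : IsCentralExtension k) {T : C} {r s d : T ⟶ G}
    (hrd : ⁅r, d⁆ = 1) :
    liftedComm hk r ⁅s, d⁆ * liftedComm hk s d =
      liftedComm hk ⁅r, s⁆ ⁅s, d⁆ * liftedComm hk s d * liftedComm hk ⁅r, s⁆ d := by
  have := hk.isMonHom
  obtain ⟨T', e, l, m, n, he, hl, hm, hn⟩ := hk.exists_lift₃ r s d
  refine eq_of_cover he ?_
  simp only [MonObj.comp_mul, comp_liftedComm, comp_commutator, ← hl, ← hm, ← hn,
    ← commutator_comp_hom hk.isMonHom, liftedComm_comp]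
  have h1 : ⁅l * m * l⁻¹, l * n * l⁻¹⁆ = ⁅l * m * l⁻¹, n⁆ := by
    refine hk.commutator_eq rfl ?_
    rw [commutatorElement_eq_one_iff_mul_comm] at hrd
    have := congrArg (e ≫ ·) hrd
    simp only [MonObj.comp_mul, ← hl, ← hn] at this
    rw [MonObj.mul_comp, MonObj.mul_comp, GrpObj.inv_comp, this, mul_inv_cancel_right]
  rw [← conjugate_commutatorElement] at h1
  calc ⁅l, ⁅m, n⁆⁆ * ⁅m, n⁆ = l * ⁅m, n⁆ * l⁻¹ := by
        rw [commutatorElement_def l]; group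
    _ = ⁅l * m * l⁻¹, n⁆ := h1
    _ = _ := by simp only [commutatorElement_def]; group

end Pairing

/-! ### From Steinberg relations to the calculus of lifted commutators. -/

section Steinberg

variable {C : Type u} [Category.{v} C] [CartesianMonoidalCategory C] [Regular C]
variable {K : C} [NonUnitalCommRingObj K] {G H : C} [GrpObj G] [GrpObj H] {k : H ⟶ G}
variable {N : rootsD4 → rootsD4 → ℤ} {x : rootsD4 → (K ⟶ G)}

theorem SteinbergRelations.isLiftedSteinberg (hx : SteinbergRelations N x)
    (hK : IsWeaklyUnital K) (hN : IsSignSystem N) (hk : IsCentralExtension k) (T : C) :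
    IsLiftedSteinberg N (fun a (p : T ⟶ K) => p ≫ x a) (liftedComm hk) where
  signs := hN
  map_add a := hx.map_add a
  commutator_root a b c h p q := hx.commutator_root a b c h p q
  commutator_one a b h := hx.commutator_one a b (root_add_not_mem h).1 (root_add_not_mem h).2
  br_mul_left := liftedComm_mul_left hk
  br_swap := liftedComm_swap hk
  br_hallWitt _ _ _ h := liftedComm_hallWitt hk h
  br_comm := commutator_liftedComm hk
  br_central _ _ h := liftedComm_central hk h
  br_triv _ _ _ := liftedComm_triv hk
  nonorth a b h p q := by
    obtain ⟨c, d, hcd, hc, hd⟩ := exists_root_decomposition h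
    obtain ⟨T', f, p₁, p₂, hf, hp⟩ := hK.exists_mul p
    refine eq_of_cover hf ?_
    have h1 := hx.commutator_root c d a hcd (N c d • p₁) p₂
    rw [smul_mul_assoc, smul_smul, hN.sq (root_dot_of_add hcd), one_smul, ← hp] at h1
    rw [comp_liftedComm, MonObj.comp_one, ← Category.assoc, ← h1, ← Category.assoc]
    exact liftedComm_triv hk
      (hx.commutator_one c b (root_add_not_mem hc).1 (root_add_not_mem hc).2 _ _)
      (hx.commutator_one d b (root_add_not_mem hd).1 (root_add_not_mem hd).2 _ _)

end Steinberg

section Homs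

variable {C : Type u} [Category.{v} C]

theorem hom_eq_of_forall {A B : C} {c c' : A ⟶ B}
    (h : ∀ {T : C} (p : T ⟶ A), ∃ (T' : C) (f : T' ⟶ T), IsRegularEpi f ∧
      (f ≫ p) ≫ c = (f ≫ p) ≫ c') : c = c' := by
  obtain ⟨T', f, hf, h⟩ := h (𝟙 A)
  rw [Category.comp_id] at h
  exact eq_of_cover hf h

theorem isAddMulHom_map_zsmul [CartesianMonoidalCategory C] {K H : C}
    [NonUnitalCommRingObj K] [GrpObj H] {c : K ⟶ H} (hc : IsAddMulHom c) {T : C} (n : ℤ)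
    (p : T ⟶ K) :
    (n • p) ≫ c = (p ≫ c) ^ n :=
  _root_.map_zsmul (AddMonoidHom.mk' (fun p : T ⟶ K => Additive.ofMul (p ≫ c)) hc) n p

end Homs

/-! ### Symbols of orthogonal roots and their invariance. -/

section Symbols

variable {C : Type u} [Category.{v} C] [CartesianMonoidalCategory C] [Regular C]
variable {K : C} [NonUnitalCommRingObj K] {G H : C} [GrpObj G] [GrpObj H] {k : H ⟶ G}
variable {N : rootsD4 → rootsD4 → ℤ} {x : rootsD4 → (K ⟶ G)}

/-- The morphism `c` expresses the lifted commutators of the root elements with the orthogonal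
roots `g` and `t`. -/
structure IsSymbol (hk : IsCentralExtension k) (x : rootsD4 → (K ⟶ G)) (g t : rootsD4)
    (c : K ⟶ H) : Prop where
  eq : ∀ {T : C} (p q : T ⟶ K), liftedComm hk (p ≫ x g) (q ≫ x t) = (p * q) ≫ c
  map_add : IsAddMulHom c
  two_torsion : ∀ {T : C} (p : T ⟶ K), (p ≫ c) * (p ≫ c) = 1
  central : ∀ {T : C} (p : T ⟶ K) (z : T ⟶ H), Commute (p ≫ c) z

/-- Polarization exchanges factors of the two arguments up to inversion; using it twice shows that
the pairing is balanced, hence a function of the product. -/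
theorem exists_isSymbol (hx : SteinbergRelations N x) (hK : IsWeaklyUnital K)
    (hN : IsSignSystem N) (hk : IsCentralExtension k) {g t : rootsD4} (hgt : g.1 ⬝ᵥ t.1 = 0) :
    ∃ c, IsSymbol hk x g t c := by
  have hL := hx.isLiftedSteinberg hK hN hk
  let y : K ⊗ K ⟶ H := liftedComm hk (fst K K ≫ x g) (snd K K ≫ x t)
  have hy : ∀ {T : C} (p q : T ⟶ K), lift p q ≫ y = liftedComm hk (p ≫ x g) (q ≫ x t) := by
    intro T p q
    rw [comp_liftedComm, lift_fst_assoc, lift_snd_assoc]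
  obtain ⟨c, hc⟩ := hK.exists_factor y fun {T} p e q => by
    obtain ⟨T₁, f₁, a, b, hf₁, h₁⟩ := hK.exists_mul p
    obtain ⟨T₂, f₂, b', c, hf₂, h₂⟩ := hK.exists_mul (f₁ ≫ q)
    refine eq_of_cover (isRegularEpi_comp hf₂ hf₁) ?_
    have hp : (f₂ ≫ f₁) ≫ p = (f₂ ≫ a) * (f₂ ≫ b) := by
      rw [Category.assoc, h₁, comp_mul_hom]
    have hq : (f₂ ≫ f₁) ≫ q = b' * c := by rw [Category.assoc, h₂]
    rw [hy, hy, comp_liftedComm, comp_liftedComm, ← Category.assoc _ _ (x g),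
      ← Category.assoc _ _ (x t), ← Category.assoc _ _ (x g), ← Category.assoc _ _ (x t),
      comp_mul_hom, comp_mul_hom, hp, hq]
    -- With p = ab and q = b'c, both ⟨p, eq⟩ and ⟨pe, q⟩ are inverse to ⟨aeb', bc⟩.
    have e1 := (hL T₂).br_polarize hgt (f₂ ≫ a) (f₂ ≫ b) ((f₂ ≫ f₁) ≫ e * b') c
    have e2 := (hL T₂).br_polarize hgt ((f₂ ≫ a) * ((f₂ ≫ f₁) ≫ e)) (f₂ ≫ b) b' c
    rw [mul_assoc (f₂ ≫ a) _ b', ← e1] at e2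
    have e3 := mul_right_cancel e2
    rwa [mul_right_comm, mul_assoc ((f₂ ≫ f₁) ≫ e)] at e3
  have hadd : IsAddMulHom c := fun p q => hK.isAddMulHom_of_factor hc (fun {T} a a' b => by
    rw [hy, hy, hy]
    exact (hL T).add_left (by omega) a a' b) p q
  have hcen : ∀ {T : C} (p : T ⟶ K) (z : T ⟶ H), Commute (p ≫ c) z := by
    intro T p z
    obtain ⟨T₁, f₁, a, b, hf₁, h₁⟩ := hK.exists_mul p
    refine eq_of_cover hf₁ ?_
    rw [MonObj.comp_mul, MonObj.comp_mul, ← Category.assoc, h₁, hc, hy]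
    exact ((hL T₁).br_central _ _ ((hL T₁).commutator_one g t hgt.ge _ _) _).eq
  refine ⟨c, fun p q => by rw [hc, hy], hadd, fun {T} p => ?_, hcen⟩
  obtain ⟨T₁, f₁, a, d, hf₁, h₁⟩ := hK.exists_pow_eight p
  refine eq_of_cover hf₁ ?_
  rw [MonObj.comp_mul, ← Category.assoc, MonObj.comp_one, h₁]
  -- For p = ad⁸ both factors of this polarization have the product of arguments ad⁸.
  have := (hL T₁).br_polarize hgt a ((d * d) * (d * d)) ((d * d) * d) d
  simp only [← hy, ← hc] at this
  have e1 : a * (d * d * (d * d)) * (d * d * d * d) =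
      a * (d * d * (d * d) * (d * d * (d * d))) := by ac_rfl
  have e2 : a * (d * d * d) * (d * d * (d * d) * d) =
      a * (d * d * (d * d) * (d * d * (d * d))) := by ac_rfl
  rwa [e1, e2] at this

theorem IsSymbol.map_zsmul {hk : IsCentralExtension k} {g t : rootsD4} {c : K ⟶ H}
    (hc : IsSymbol hk x g t c) {T : C} {n : ℤ} (hn : n * n = 1) (p : T ⟶ K) :
    (n • p) ≫ c = p ≫ c := by
  rw [isAddMulHom_map_zsmul hc.map_add]
  rcases Int.isUnit_iff.mp (IsUnit.of_mul_eq_one _ hn) with e | e <;> rw [e]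
  · rw [zpow_one]
  · rw [zpow_neg_one, inv_eq_of_mul_eq_one_left (hc.two_torsion p)]

theorem IsSymbol.symm {hk : IsCentralExtension k} {g t : rootsD4} {c : K ⟶ H}
    (hc : IsSymbol hk x g t c) : IsSymbol hk x t g c where
  eq p q := by
    rw [liftedComm_swap, hc.eq, inv_eq_of_mul_eq_one_left (hc.two_torsion _), mul_comm]
  map_add := hc.map_add
  two_torsion := hc.two_torsion
  central := hc.central

theorem IsSymbol.unique (hK : IsWeaklyUnital K) {hk : IsCentralExtension k} {g t : rootsD4}
    {c c' : K ⟶ H} (hc : IsSymbol hk x g t c) (hc' : IsSymbol hk x g t c') : c = c' :=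
  hom_eq_of_forall fun p => by
    obtain ⟨T', f, a, b, hf, h⟩ := hK.exists_mul p
    exact ⟨T', f, hf, by rw [h, ← hc.eq, ← hc'.eq]⟩

/-- The center of a group, written additively. -/
def CenterAdd (G : Type*) [Group G] : Type _ := Additive (Subgroup.center G)

instance (G : Type*) [Group G] : AddCommGroup (CenterAdd G) :=
  { (inferInstance : AddGroup (Additive (Subgroup.center G))) with
    add_comm := fun _ b => Additive.toMul.injective
      (Subtype.ext (Subgroup.mem_center_iff.mp (Additive.toMul b).2 _)) }

/-- An element of the center as an element of the group. -/
def ofCenter {G : Type*} [Group G] (m : CenterAdd G) : G :=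
  (Additive.toMul (m : Additive (Subgroup.center G)) : Subgroup.center G)

theorem ofCenter_add {G : Type*} [Group G] (m n : CenterAdd G) :
    ofCenter (m + n) = ofCenter m * ofCenter n := rfl

theorem ofCenter_injective {G : Type*} [Group G] : Function.Injective (ofCenter (G := G)) :=
  fun _ _ h => Additive.toMul.injective (Subtype.ext h)

/-- The homomorphism to the center on generalized elements. -/
def IsSymbol.toCenter {hk : IsCentralExtension k} {g t : rootsD4} {c : K ⟶ H}
    (hc : IsSymbol hk x g t c) (T : C) : (T ⟶ K) →+ CenterAdd (T ⟶ H) :=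
  AddMonoidHom.mk' (fun p => Additive.ofMul ⟨p ≫ c, Subgroup.mem_center_iff.mpr
    fun z => (hc.central p z).eq.symm⟩) fun p q => by
      exact ofCenter_injective (hc.map_add p q)

theorem IsSymbol.ofCenter_toCenter {hk : IsCentralExtension k} {g t : rootsD4} {c : K ⟶ H}
    (hc : IsSymbol hk x g t c) {T : C} (p : T ⟶ K) : ofCenter (hc.toCenter T p) = p ≫ c := rfl

theorem IsSymbol.toCenter_two {hk : IsCentralExtension k} {g t : rootsD4} {c : K ⟶ H}
    (hc : IsSymbol hk x g t c) (T : C) (p : T ⟶ K) : hc.toCenter T p + hc.toCenter T p = 0 :=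
  ofCenter_injective (hc.two_torsion p)

/-- The lifts of root elements on generalized elements. -/
noncomputable def homRootLift (hk : IsCentralExtension k) (N : rootsD4 → rootsD4 → ℤ)
    (x : rootsD4 → (K ⟶ G)) (T : C) (a b : rootsD4) : (T ⟶ K) → (T ⟶ K) → (T ⟶ H) :=
  IsLiftedSteinberg.rootLift N (fun a (p : T ⟶ K) => p ≫ x a) (liftedComm hk) a b

section

variable {hk : IsCentralExtension k}

theorem IsSymbol.rootLift_triple (hx : SteinbergRelations N x) (hK : IsWeaklyUnital K)
    (hN : IsSignSystem N) {r s d g t : rootsD4} {c : K ⟶ H}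
    (hrd : r.1 ⬝ᵥ d.1 = 0) (hg : g.1 = r.1 + s.1) (ht : t.1 = s.1 + d.1)
    (hc : IsSymbol hk x g t c) {T : C} (p q u : T ⟶ K) :
    homRootLift hk N x T r t p (q * u) =
      homRootLift hk N x T g d (p * q) u * ofCenter (hc.toCenter T (p * q * (q * u))) :=
  (hx.isLiftedSteinberg hK hN hk T).rootLift_triple hrd hg ht (P := fun p => p ≫ c)
    hc.eq hc.two_torsion p q u

theorem IsSymbol.eq_move (hx : SteinbergRelations N x) (hK : IsWeaklyUnital K)
    (hN : IsSignSystem N) {a b a' b' e : rootsD4} {c c' : K ⟶ H}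
    (hc : IsSymbol hk x a b c) (hc' : IsSymbol hk x a' b' c') (hab : a.1 ⬝ᵥ b.1 = 0)
    (ha : a.1 = a'.1 + e.1) (hb : b'.1 = e.1 + b.1) (ha'b : a'.1 ⬝ᵥ b.1 = 1) : c = c' :=
  hom_eq_of_forall fun {T} p => by
    obtain ⟨T', f, p₁, d, hf, h⟩ := hK.exists_pow_eight p
    refine ⟨T', f, hf, ?_⟩
    have := (hx.isLiftedSteinberg hK hN hk T').br_move hab ha hb ha'b p₁ ((d * d) * (d * d))
      ((d * d) * (d * d))
    rw [hc.eq, hc'.eq, smul_mul_assoc, mul_smul_comm, hc.map_zsmul (hN.sq (root_dot_of_add ha)),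
      hc'.map_zsmul (hN.sq (root_dot_of_add hb)), mul_assoc] at this
    rw [h, this]

/-- A reversal of a subsystem of type `A3`. -/
theorem IsSymbol.rootLift_triple_reverse (hx : SteinbergRelations N x) (hK : IsWeaklyUnital K)
    (hN : IsSignSystem N) {r s d g t : rootsD4} {c : K ⟶ H}
    (hrd : r.1 ⬝ᵥ d.1 = 0) (hg : g.1 = r.1 + s.1) (ht : t.1 = s.1 + d.1)
    (hc : IsSymbol hk x r d c) {T : C} (p q u : T ⟶ K) :
    homRootLift hk N x T g d p (q * u) =
      homRootLift hk N x T r t (p * q) u * ofCenter (hc.toCenter T (p * q * (q * u))) := by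
  -- Since r = g + (-s) and d = (-s) + t, replacing s by -s exchanges the pairs (g, t) and (r, d).
  refine hc.rootLift_triple hx hK hN (s := rootNeg s) ?_ ?_ ?_ p q u
  · have := root_dot_of_add hg
    have := root_dot_of_add ht
    simp only [hg, ht, dotProduct_add, add_dotProduct, root_norm]
    omega
  · simp [rootNeg, hg]
  · simp [rootNeg, ht]

/-- The two symbols are the defects of the two directions between the same pair of lifts, so
`defect_eq` applies. -/
theorem IsSymbol.eq_reverse (hx : SteinbergRelations N x) (hK : IsWeaklyUnital K)
    (hN : IsSignSystem N) {r s d g t : rootsD4} {c c' : K ⟶ H}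
    (hrd : r.1 ⬝ᵥ d.1 = 0) (hg : g.1 = r.1 + s.1) (ht : t.1 = s.1 + d.1)
    (hc : IsSymbol hk x g t c) (hc' : IsSymbol hk x r d c') : c = c' :=
  hom_eq_of_forall fun {T} p => by
    obtain ⟨T', f, a, e, hf, h⟩ := hK.exists_pow_eight p
    refine ⟨T', f, hf, ?_⟩
    have := defect_eq (f := homRootLift hk N x T' r t) (f' := homRootLift hk N x T' g d)
      (j := ofCenter) (P := hc'.toCenter T') (Q := hc.toCenter T')
      ofCenter_add ofCenter_injective (hc'.toCenter_two T') (hc.toCenter_two T')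
      (hc.rootLift_triple hx hK hN hrd hg ht) (hc'.rootLift_triple_reverse hx hK hN hrd hg ht) a e
    rw [h, ← hc.ofCenter_toCenter, ← hc'.ofCenter_toCenter, this]

theorem exists_orbit_symbols (hx : SteinbergRelations N x) (hK : IsWeaklyUnital K)
    (hN : IsSignSystem N) (hk : IsCentralExtension k) :
    ∃ c : Orbit → (K ⟶ H), ∀ o (g t : rootsD4), g.1 ⬝ᵥ t.1 = 0 → halfSum g.1 t.1 ∈ o.roots →
      IsSymbol hk x g t (c o) := by
  have : ∀ g t : rootsD4, ∃ c, g.1 ⬝ᵥ t.1 = 0 → IsSymbol hk x g t c := by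
    intro g t
    by_cases h : g.1 ⬝ᵥ t.1 = 0
    · obtain ⟨c, hc⟩ := exists_isSymbol hx hK hN hk h
      exact ⟨c, fun _ => hc⟩
    · exact ⟨1, fun h' => absurd h' h⟩
  choose F hF using this
  have h₁ : ∀ a b a' b' : rootsD4, a.1 ⬝ᵥ b.1 = 0 → a'.1 ⬝ᵥ b'.1 = 0 →
      a.1 + b.1 = a'.1 + b'.1 → F a b = F a' b' := by
    refine eq_of_sum_eq (fun a b h => ?_) fun a b a' b' e h ha hb ha'b he => ?_
    · exact (hF a b h).symm.unique hK (hF b a (by rw [dotProduct_comm, h]))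
    · refine (hF a b h).eq_move hx hK hN (hF a' b' ?_) h ha hb ha'b
      rw [hb, dotProduct_add, ha'b, root_dot_of_add ha]
      norm_num
  -- Choose an A3 subsystem with middle root s such that g + t = a + s and r + d = a - s; then the
  -- change of sign is a reversal.
  have h₂ : ∀ a b : rootsD4, a.1 ⬝ᵥ b.1 = 0 → F a b = F a (rootNeg b) := by
    intro a s has
    have has' : a.1 ⬝ᵥ (rootNeg s).1 = 0 := by simp [rootNeg, has]
    obtain ⟨r, hra, hrs⟩ := exists_root_dot_one_one has'
    simp only [rootNeg, dotProduct_neg] at hrs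
    have hg := root_add_mem (a := r) (b := s) (by omega)
    let t : rootsD4 := ⟨_, root_sub_mem (a := a) (b := r) (by rw [dotProduct_comm, hra])⟩
    have hts : t.1 ⬝ᵥ s.1 = 1 := by
      simp only [t, sub_dotProduct, has]
      omega
    let d : rootsD4 := ⟨_, root_sub_mem hts⟩
    have hrd : r.1 ⬝ᵥ d.1 = 0 := by
      simp only [d, t, dotProduct_sub, hra, root_norm]
      omega
    have hgt : (⟨_, hg⟩ : rootsD4).1 ⬝ᵥ t.1 = 0 := by
      simp only [t, dotProduct_sub, add_dotProduct, hra, root_norm, dotProduct_comm s.1 a.1, has,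
        dotProduct_comm s.1 r.1]
      omega
    rw [h₁ a s ⟨_, hg⟩ t has hgt (by simp only [t]; abel),
      h₁ a (rootNeg s) r d has' hrd (by simp only [t, d, rootNeg]; abel)]
    exact (hF _ _ hgt).eq_reverse hx hK hN (s := s) hrd rfl (by simp [d]) (hF _ _ hrd)
  have : ∀ o : Orbit, ∃ c, ∀ g t : rootsD4, g.1 ⬝ᵥ t.1 = 0 → halfSum g.1 t.1 ∈ o.roots →
      IsSymbol hk x g t c := by
    intro o
    by_cases h : ∃ g t : rootsD4, g.1 ⬝ᵥ t.1 = 0 ∧ halfSum g.1 t.1 ∈ o.roots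
    · obtain ⟨g, t, h, ho⟩ := h
      refine ⟨F g t, fun g' t' h' ho' => ?_⟩
      rw [orbit_eq h₁ h₂ h h' ho ho']
      exact hF _ _ h'
    · exact ⟨1, fun g t h' ho => absurd ⟨g, t, h', ho⟩ h⟩
  choose c hc using this
  exact ⟨c, hc⟩

end

end Symbols

/-! ### The three decompositions of e₁ + e₂ into orthogonal-orbit configurations. -/

section Configurations

/-- The root `e₁ + e₃`. -/
def rootA : rootsD4 := ⟨![1, 0, 1, 0], mem_rootList_iff.mp (by decide)⟩

/-- The root `e₂ - e₃`. -/
def rootA' : rootsD4 := ⟨![0, 1, -1, 0], mem_rootList_iff.mp (by decide)⟩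

/-- The root `e₁ + e₄`. -/
def rootB : rootsD4 := ⟨![1, 0, 0, 1], mem_rootList_iff.mp (by decide)⟩

/-- The root `e₂ - e₄`. -/
def rootB' : rootsD4 := ⟨![0, 1, 0, -1], mem_rootList_iff.mp (by decide)⟩

/-- The root `e₁ - e₄`. -/
def rootC : rootsD4 := ⟨![1, 0, 0, -1], mem_rootList_iff.mp (by decide)⟩

/-- The root `e₂ + e₄`. -/
def rootC' : rootsD4 := ⟨![0, 1, 0, 1], mem_rootList_iff.mp (by decide)⟩

theorem halfSum_mem_zero {a b : Fin 4 → ℤ} {i : Fin 4} (h : a + b = Pi.single i 2) :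
    halfSum a b ∈ Orbit.zero.roots := by
  refine ⟨i, 1, funext fun j => ?_⟩
  have := congrFun h j
  rw [Pi.add_apply] at this
  rw [halfSum, this]
  by_cases hj : j = i
  · subst hj; simp
  · simp [hj]

theorem halfSum_mem_plus {a b : Fin 4 → ℤ} (s : Fin 4 → ℤˣ) (hs : ∏ i, s i = 1)
    (h : a + b = fun i => (s i : ℤ)) : halfSum a b ∈ Orbit.plus.roots :=
  ⟨s, hs, funext fun i => by rw [halfSum, ← congrFun h i, Pi.add_apply]⟩

theorem halfSum_mem_minus {a b : Fin 4 → ℤ} (s : Fin 4 → ℤˣ) (hs : ∏ i, s i = -1)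
    (h : a + b = fun i => (s i : ℤ)) : halfSum a b ∈ Orbit.minus.roots :=
  ⟨s, hs, funext fun i => by rw [halfSum, ← congrFun h i, Pi.add_apply]⟩

/-- For every orbit the roots `rootA` and `rootA'` lie in a subsystem of type `A3` such that the
half sums of its orthogonal roots are in this orbit. -/
theorem exists_orbit_config (o : Orbit) : ∃ s g d : rootsD4, rootA.1 ⬝ᵥ d.1 = 0 ∧
    g.1 = rootA.1 + s.1 ∧ rootA'.1 = s.1 + d.1 ∧ halfSum g.1 rootA'.1 ∈ o.roots ∧
    halfSum rootA.1 d.1 ∈ o.roots := by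
  cases o with
  | zero =>
    exact ⟨⟨![-1, 1, 0, 0], mem_rootList_iff.mp (by decide)⟩,
      ⟨![0, 1, 1, 0], mem_rootList_iff.mp (by decide)⟩,
      ⟨![1, 0, -1, 0], mem_rootList_iff.mp (by decide)⟩, by decide, by decide, by decide,
      halfSum_mem_zero (i := 1) (by decide), halfSum_mem_zero (i := 0) (by decide)⟩
  | plus =>
    exact ⟨⟨![0, 0, -1, -1], mem_rootList_iff.mp (by decide)⟩, rootC, rootC',
      by decide, by decide, by decide,
      halfSum_mem_plus ![1, 1, -1, -1] (by decide) (by decide),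
      halfSum_mem_plus ![1, 1, 1, 1] (by decide) (by decide)⟩
  | minus =>
    exact ⟨⟨![0, 0, -1, 1], mem_rootList_iff.mp (by decide)⟩, rootB, rootB',
      by decide, by decide, by decide,
      halfSum_mem_minus ![1, 1, -1, 1] (by decide) (by decide),
      halfSum_mem_minus ![1, 1, 1, -1] (by decide) (by decide)⟩

end Configurations

/-! ### Relations between the three symbols. -/

section SymbolRelations

variable {C : Type u} [Category.{v} C] [CartesianMonoidalCategory C] [Regular C]
variable {K : C} [NonUnitalCommRingObj K] {G H : C} [GrpObj G] [GrpObj H] {k : H ⟶ G}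
variable {N : rootsD4 → rootsD4 → ℤ} {x : rootsD4 → (K ⟶ G)}

/-- The family `c` expresses the lifted commutators of root elements with orthogonal roots. -/
def IsSymbolFamily (hk : IsCentralExtension k) (x : rootsD4 → (K ⟶ G)) (c : Orbit → (K ⟶ H)) :
    Prop :=
  ∀ (o : Orbit) (g t : rootsD4), g.1 ⬝ᵥ t.1 = 0 → halfSum g.1 t.1 ∈ o.roots →
    IsSymbol hk x g t (c o)

theorem orthogonal_of_triple {r s d g t : rootsD4} (hrd : r.1 ⬝ᵥ d.1 = 0)
    (hg : g.1 = r.1 + s.1) (ht : t.1 = s.1 + d.1) : g.1 ⬝ᵥ t.1 = 0 := by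
  have := root_dot_of_add hg
  have := root_dot_of_add ht
  simp only [hg, ht, dotProduct_add, add_dotProduct, root_norm]
  omega

variable {hk : IsCentralExtension k} {c : Orbit → (K ⟶ H)}

theorem IsSymbolFamily.isSymbol (hc : IsSymbolFamily hk x c) (o : Orbit) :
    IsSymbol hk x (exists_orbit_config o).choose_spec.choose rootA' (c o) := by
  have h := (exists_orbit_config o).choose_spec.choose_spec.choose_spec
  exact hc o _ _ (orthogonal_of_triple h.1 h.2.1 h.2.2.1) h.2.2.2.1

/-- The symbol of an orbit as a homomorphism to the center on generalized elements. -/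
noncomputable def IsSymbolFamily.toCenter (hc : IsSymbolFamily hk x c) (o : Orbit) (T : C) :
    (T ⟶ K) →+ CenterAdd (T ⟶ H) := (hc.isSymbol o).toCenter T

theorem IsSymbolFamily.toCenter_two (hc : IsSymbolFamily hk x c) (o : Orbit) (T : C)
    (p : T ⟶ K) : hc.toCenter o T p + hc.toCenter o T p = 0 :=
  (hc.isSymbol o).toCenter_two T p

/-- The lift belongs to the fixed pair `rootA`, `rootA'` whatever the orbit is, which makes the
defects of different orbits comparable. -/
theorem IsSymbolFamily.rootLift_double (hc : IsSymbolFamily hk x c)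
    (hx : SteinbergRelations N x) (hK : IsWeaklyUnital K) (hN : IsSignSystem N) (o : Orbit) {T : C}
    (a p q u : T ⟶ K) :
    homRootLift hk N x T rootA rootA' a (p * (q * u)) =
      homRootLift hk N x T rootA rootA' (a * p * q) u *
        ofCenter (hc.toCenter o T (a * p * q * (q * u)) +
          hc.toCenter o T (a * p * (p * (q * u)))) := by
  obtain ⟨s, g, d, hrd, hg, ht, h₁, h₂⟩ := exists_orbit_config o
  have h₁' := hc o _ _ (orthogonal_of_triple hrd hg ht) h₁
  have h₂' := hc o _ _ hrd h₂
  exact defect_eq_add (P := h₂'.toCenter T) (Q := h₁'.toCenter T) ofCenter_add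
    (h₁'.rootLift_triple hx hK hN hrd hg ht) (h₂'.rootLift_triple_reverse hx hK hN hrd hg ht)
    a p q u

theorem IsSymbolFamily.map_eps (hc : IsSymbolFamily hk x c)
    (hx : SteinbergRelations N x) (hK : IsWeaklyUnital K) (hN : IsSignSystem N) (o : Orbit) {T : C}
    (r p q : T ⟶ K) : (r * ((p * p - p) * (q * q - q))) ≫ c o = 1 := by
  obtain ⟨T', f, a, d, hf, h⟩ := hK.exists_pow_eight r
  refine eq_of_cover hf ?_
  have := congrArg ofCenter (map_eps_relator ofCenter_injective (hc.toCenter_two o T')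
    (hc.rootLift_double hx hK hN o) a d (f ≫ p) (f ≫ q))
  rw [← h] at this
  rw [MonObj.comp_one, ← Category.assoc]
  simp only [comp_mul_hom, sub_eq_add_neg, AddMonObj.comp_add, AddGrpObj.comp_neg] at this ⊢
  exact this

theorem IsSymbolFamily.map_ideal (hc : IsSymbolFamily hk x c)
    (hx : SteinbergRelations N x) (hK : IsWeaklyUnital K) (hN : IsSignSystem N) (o o' : Orbit)
    {T : C} (r p : T ⟶ K) : (r * (p * p - p)) ≫ c o = (r * (p * p - p)) ≫ c o' := by
  obtain ⟨T', f, a, d, hf, h⟩ := hK.exists_pow_eight r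
  refine eq_of_cover hf ?_
  have := congrArg ofCenter (map_ideal_eq ofCenter_injective (hc.toCenter_two o T')
    (hc.toCenter_two o' T') (hc.rootLift_double hx hK hN o) (hc.rootLift_double hx hK hN o')
    a d (f ≫ p))
  rw [← h] at this
  rw [← Category.assoc, ← Category.assoc]
  simp only [comp_mul_hom, sub_eq_add_neg, AddMonObj.comp_add, AddGrpObj.comp_neg] at this ⊢
  exact this

theorem IsSymbolFamily.map_square (hc : IsSymbolFamily hk x c)
    (hx : SteinbergRelations N x) (hK : IsWeaklyUnital K) (hN : IsSignSystem N) {T : C}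
    (p : T ⟶ K) : ((p * p) ≫ c .zero) * ((p * p) ≫ c .plus) * ((p * p) ≫ c .minus) = 1 := by
  obtain ⟨T', f, a, d, hf, h⟩ := hK.exists_pow_eight p
  refine eq_of_cover hf ?_
  -- The pairs A, B, C all have sum e₁ + e₂. The A3 subsystems joining A to B, A to C and C to B
  -- have symbols in the orbits minus, plus and zero; the last one ends at (B', B), hence the swap
  -- below.
  have e₂ : IsSymbol hk x rootB rootA' (c .minus) :=
    hc _ _ _ (by decide) (halfSum_mem_minus ![1, 1, -1, 1] (by decide) (by decide))
  have e₁ : IsSymbol hk x rootC rootA' (c .plus) :=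
    hc _ _ _ (by decide) (halfSum_mem_plus ![1, 1, -1, -1] (by decide) (by decide))
  have e₀ : IsSymbol hk x rootB' rootC' (c .zero) :=
    hc _ _ _ (by decide) (halfSum_mem_zero (i := 1) (by decide))
  have := congrArg ofCenter (map_triangle (fA := homRootLift hk N x T' rootA rootA')
    (fB := homRootLift hk N x T' rootB rootB') (fC := homRootLift hk N x T' rootC rootC')
    (P₀ := hc.toCenter .zero T') (P₁ := hc.toCenter .plus T') (P₂ := hc.toCenter .minus T')
    ofCenter_add ofCenter_injective
    (hc.toCenter_two .zero T') (hc.toCenter_two .plus T')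
    (e₂.rootLift_triple hx hK hN (s := ⟨![0, 0, -1, 1], mem_rootList_iff.mp (by decide)⟩)
      (by decide) (by decide) (by decide))
    (e₁.rootLift_triple hx hK hN (s := ⟨![0, 0, -1, -1], mem_rootList_iff.mp (by decide)⟩)
      (by decide) (by decide) (by decide))
    (fun a b c => by
      rw [e₀.rootLift_triple hx hK hN (s := ⟨![-1, 1, 0, 0], mem_rootList_iff.mp (by decide)⟩)
        (d := rootB) (by decide) (by decide) (by decide)]
      congr 1
      exact (hx.isLiftedSteinberg hK hN hk T').rootLift_swap (by decide) _ _)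
    (fun r p => ofCenter_injective (hc.map_ideal hx hK hN _ _ r p))
    -- The triangle yields the square of (ad⁵) d³ = ad⁸.
    (a * (d * d * (d * d) * d)) d)
  have e : a * (d * d * (d * d) * d) * (d * (d * d)) =
    a * (d * d * (d * d) * (d * d * (d * d))) := by ac_rfl
  rw [e, ← h, ← comp_mul_hom] at this
  simp only [MonObj.comp_mul, MonObj.comp_one, ← Category.assoc]
  exact this

end SymbolRelations

/-! ### The ideal defining K₂ε, described by locally finite sums. -/

section EpsSum

variable {R : Type*} [NonUnitalCommRing R]

/-- The sums of `2 q` and `n` multiples of elements `(p ^ 2 - p) (q ^ 2 - q)`. -/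
def IsEpsSum : ℕ → R → Prop
  | 0, a => ∃ q, a = q + q
  | n + 1, a => ∃ b r p q, IsEpsSum n b ∧ a = b + r * ((p * p - p) * (q * q - q))

theorem IsEpsSum.add_double {n : ℕ} {a : R} (h : IsEpsSum n a) (q : R) :
    IsEpsSum n (a + (q + q)) := by
  induction n generalizing a with
  | zero =>
    obtain ⟨p, rfl⟩ := h
    exact ⟨p + q, add_add_add_comm p p q q⟩
  | succ n ih =>
    obtain ⟨b, r, p, s, hb, rfl⟩ := h
    exact ⟨_, r, p, s, ih hb, add_right_comm _ _ _⟩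

theorem IsEpsSum.add {n m : ℕ} {a b : R} (ha : IsEpsSum n a) (hb : IsEpsSum m b) :
    IsEpsSum (n + m) (a + b) := by
  induction m generalizing b with
  | zero =>
    obtain ⟨q, rfl⟩ := hb
    exact ha.add_double q
  | succ m ih =>
    obtain ⟨b, r, p, q, hb, rfl⟩ := hb
    exact ⟨_, r, p, q, ih hb, (add_assoc _ _ _).symm⟩

theorem IsEpsSum.mul {n : ℕ} {a : R} (h : IsEpsSum n a) (s : R) : IsEpsSum n (s * a) := by
  induction n generalizing a with
  | zero =>
    obtain ⟨q, rfl⟩ := h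
    exact ⟨s * q, mul_add _ _ _⟩
  | succ n ih =>
    obtain ⟨b, r, p, q, hb, rfl⟩ := h
    exact ⟨_, s * r, p, q, ih hb, by rw [mul_add, mul_assoc]⟩

theorem IsEpsSum.neg {n : ℕ} {a : R} (h : IsEpsSum n a) : IsEpsSum n (-a) := by
  induction n generalizing a with
  | zero =>
    obtain ⟨q, rfl⟩ := h
    exact ⟨-q, neg_add _ _⟩
  | succ n ih =>
    obtain ⟨b, r, p, q, hb, rfl⟩ := h
    exact ⟨_, -r, p, q, ih hb, by rw [neg_add, neg_mul]⟩

/-- Without a unit a relator need not be a multiple of relators. For a product pd, however, p²d² -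
pd = p(d² - d) + d²(p² - p). -/
theorem isEpsSum_relator (p d q : R) :
    IsEpsSum 2 ((p * d * (p * d) - p * d) * (q * q - q)) :=
  ⟨_, d * d, p, q, ⟨_, p, d, q, ⟨0, rfl⟩, rfl⟩, by
    simp only [mul_sub, sub_mul, add_zero, zero_add]
    have e1 : p * (d * d * (q * q)) = d * d * (p * (q * q)) := by ac_rfl
    have e2 : p * (d * d * q) = d * d * (p * q) := by ac_rfl
    have e3 : p * d * (p * d) * (q * q) = d * d * (p * p * (q * q)) := by ac_rfl
    have e4 : p * d * (p * d) * q = d * d * (p * p * q) := by ac_rfl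
    rw [e1, e2, e3, e4, mul_assoc p d, mul_assoc p d]
    abel⟩

end EpsSum

section Coproduct

variable {C : Type u} [Category.{v} C]

theorem factors_of_cover {T' T X : C} {e : T' ⟶ T} (he : IsRegularEpi e) {J : Subobject X}
    {a : T ⟶ X} (h : J.Factors (e ≫ a)) : J.Factors a := by
  obtain ⟨t, ht⟩ := exists_factor_of_cover he J.arrow a (J.factorThru _ h) (by simp)
  rw [← ht]
  exact Subobject.factors_comp_arrow t

variable [Regular C]

theorem exists_lift_of_imageSubobject_factors {D X T : C} {f : D ⟶ X} {a : T ⟶ X}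
    (h : (imageSubobject f).Factors a) :
    ∃ (T' : C) (e : T' ⟶ T) (y : T' ⟶ D), IsRegularEpi e ∧ y ≫ f = e ≫ a := by
  have hf : IsRegularEpi (factorThruImageSubobject f) := by
    rw [factorThruImageSubobject]
    have : StrongEpi (factorThruImage f ≫ (imageSubobjectIso f).inv) := strongEpi_comp _ _
    infer_instance
  obtain ⟨T', e, y, he, hy⟩ := exists_local_lift hf (Subobject.factorThru _ a h)
  refine ⟨T', e, y, he, ?_⟩
  have := congrArg (· ≫ (imageSubobject f).arrow) hy
  simpa using this

end Coproduct

section Union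

variable {C : Type u} [Category.{v} C] [InfinitaryPretopos C]

/-- A property of subobjects can be checked locally on a coproduct. -/
theorem factors_of_forall_sigma {D : ℕ → C} {X Y T : C} (φ : ∀ n, D n ⟶ X)
    [HasCoproduct fun n : ULift.{v} ℕ => D n.down]
    {a : T ⟶ X} (ha : (imageSubobject (Sigma.desc fun n : ULift.{v} ℕ => φ n.down)).Factors a)
    {J : Subobject Y} {b : T ⟶ Y}
    (h : ∀ {T' : C} (f : T' ⟶ T) (n : ℕ) (y : T' ⟶ D n), y ≫ φ n = f ≫ a → J.Factors (f ≫ b)) :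
    J.Factors b := by
  obtain ⟨T', e, y, he, hy⟩ := exists_lift_of_imageSubobject_factors ha
  refine factors_of_cover he ?_
  -- By universality of coproducts, T' is the coproduct of its parts where y lands in a single D n.
  let F : ULift.{v} ℕ → C := fun n => D n.down
  let c' : Cofan fun n : ULift.{v} ℕ => pullback y (Sigma.ι F n) :=
    Cofan.mk T' fun n => pullback.fst y (Sigma.ι F n)
  have hc : Nonempty (IsColimit c') :=
    (InfinitaryPretopos.isVanKampen_coproduct F (Cofan.mk _ (Sigma.ι F))
      ⟨coproductIsCoproduct F⟩).isUniversal c'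
      (Discrete.natTrans fun n => pullback.snd y (Sigma.ι F n.as)) y
      (by
        ext ⟨n⟩
        exact pullback.condition.symm)
      (NatTrans.Equifibered.of_discrete _)
      fun n => (IsPullback.of_hasPullback y (Sigma.ι F n.as))
  have hn : ∀ n : ULift.{v} ℕ, J.Factors (pullback.fst y (Sigma.ι F n) ≫ e ≫ b) := fun n => by
    rw [← Category.assoc]
    refine h _ n.down (pullback.snd y (Sigma.ι F n)) ?_
    rw [Category.assoc, ← hy, pullback.condition_assoc, Sigma.ι_desc]
  have : e ≫ b = hc.some.desc (Cofan.mk _ fun n => J.factorThru _ (hn n)) ≫ J.arrow := by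
    refine hc.some.hom_ext fun ⟨n⟩ => ?_
    rw [hc.some.fac_assoc]
    simp [c']
  rw [this]
  exact Subobject.factors_comp_arrow _

end Union

section EpsIdeal

variable {C : Type u} [Category.{v} C] [CartesianMonoidalCategory C]
variable {K : C} [NonUnitalCommRingObj K]

/-- A sum with n terms is the value of a polynomial morphism on a power of K, so the union over all
n is the image of a coproduct. -/
theorem exists_representing_isEpsSum (K : C) [NonUnitalCommRingObj K] (n : ℕ) :
    ∃ (D : C) (φ : D ⟶ K), ∀ {T : C} (a : T ⟶ K), IsEpsSum n a ↔ ∃ y : T ⟶ D, y ≫ φ = a := by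
  induction n with
  | zero =>
    refine ⟨K, 𝟙 K + 𝟙 K, fun a => ⟨?_, ?_⟩⟩
    · rintro ⟨q, rfl⟩
      exact ⟨q, by simp [AddMonObj.comp_add]⟩
    · rintro ⟨q, rfl⟩
      exact ⟨q, by simp [AddMonObj.comp_add]⟩
  | succ n ih =>
    obtain ⟨D, φ, h⟩ := ih
    let r : (D ⊗ K) ⊗ (K ⊗ K) ⟶ K := fst _ _ ≫ snd _ _
    let p : (D ⊗ K) ⊗ (K ⊗ K) ⟶ K := snd _ _ ≫ fst _ _
    let q : (D ⊗ K) ⊗ (K ⊗ K) ⟶ K := snd _ _ ≫ snd _ _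
    refine ⟨(D ⊗ K) ⊗ (K ⊗ K), fst _ _ ≫ fst _ _ ≫ φ + r * ((p * p - p) * (q * q - q)),
      fun {T} a => ⟨?_, ?_⟩⟩
    · rintro ⟨b, s, p', q', hb, rfl⟩
      obtain ⟨y, rfl⟩ := (h b).mp hb
      refine ⟨lift (lift y s) (lift p' q'), ?_⟩
      simp [AddMonObj.comp_add, AddGrpObj.comp_neg, comp_mul_hom, sub_eq_add_neg, r, p, q]
    · rintro ⟨y, rfl⟩
      refine ⟨y ≫ fst _ _ ≫ fst _ _ ≫ φ, y ≫ r, y ≫ p, y ≫ q, (h _).mpr ⟨y ≫ fst _ _ ≫ fst _ _, by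
        simp only [Category.assoc]⟩, ?_⟩
      simp [AddMonObj.comp_add, AddGrpObj.comp_neg, comp_mul_hom, sub_eq_add_neg]

theorem comp_isEpsSum {S T : C} (f : S ⟶ T) {n : ℕ} {a : T ⟶ K} (h : IsEpsSum n a) :
    IsEpsSum n (f ≫ a) := by
  obtain ⟨D, φ, hD⟩ := exists_representing_isEpsSum K n
  obtain ⟨y, rfl⟩ := (hD a).mp h
  exact (hD _).mpr ⟨f ≫ y, Category.assoc _ _ _⟩

variable [InfinitaryPretopos C]

/-- The ideal of locally finite sums of multiples of the relators. -/
theorem exists_epsIdeal (K : C) [NonUnitalCommRingObj K] : ∃ J : Subobject K,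
    (∀ {T : C} (n : ℕ) (a : T ⟶ K), IsEpsSum n a → J.Factors a) ∧
    ∀ {T Y : C} (a : T ⟶ K) (X : Subobject Y) (b : T ⟶ Y), J.Factors a →
      (∀ {T' : C} (f : T' ⟶ T) (n : ℕ), IsEpsSum n (f ≫ a) → X.Factors (f ≫ b)) →
      X.Factors b := by
  choose D φ hD using exists_representing_isEpsSum K
  have := InfinitaryPretopos.hasCoproducts (C := C) (ULift.{v} ℕ)
  refine ⟨imageSubobject (Sigma.desc fun n : ULift.{v} ℕ => φ n.down), fun {T} n a h => ?_,
    fun {T Y} a X b ha h => factors_of_forall_sigma φ ha fun f n y hy =>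
      h f n ((hD n _).mpr ⟨y, hy⟩)⟩
  obtain ⟨y, rfl⟩ := (hD n a).mp h
  have := imageSubobject_factors_comp_self (Sigma.desc fun n : ULift.{v} ℕ => φ n.down)
    (y ≫ Sigma.ι (fun n : ULift.{v} ℕ => D n.down) ⟨n⟩)
  rwa [Category.assoc, Sigma.ι_desc] at this

/-- The kernel of the quotient by the relators is contained in every subobject that contains
the finite sums of multiples of the relators. -/
theorem IsQuotientBySpan.factors_of_comp_eq_zero (hK : IsWeaklyUnital K) {K2e : C}
    [NonUnitalCommRingObj K2e] {π : K ⟶ K2e} (hπ : IsQuotientBySpan TwoEpsRelator π)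
    {X : Subobject K} (hX : ∀ {T : C} (n : ℕ) (a : T ⟶ K), IsEpsSum n a → X.Factors a)
    {T : C} (a : T ⟶ K) (ha : a ≫ π = 0) : X.Factors a := by
  obtain ⟨J, hJ, hJX⟩ := exists_epsIdeal K
  refine hJX a X a (hπ.ker_le J ⟨?_, ?_, ?_, ?_⟩ ?_ a ha) fun f n => hX n _
  · exact fun {T} => hJ 0 _ ⟨0, (add_zero 0).symm⟩
  · intro T a b ha hb
    refine hJX a J _ ha fun {T₁} f n h₁ => ?_
    refine hJX (f ≫ b) J _ (Subobject.factors_of_factors_right f hb) fun {T₂} g m h₂ => ?_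
    rw [AddMonObj.comp_add, AddMonObj.comp_add]
    exact hJ _ _ ((comp_isEpsSum g h₁).add h₂)
  · intro T a ha
    refine hJX a J _ ha fun f n h => ?_
    rw [AddGrpObj.comp_neg]
    exact hJ _ _ h.neg
  · intro T r a ha
    refine hJX a J _ ha fun f n h => ?_
    rw [comp_mul_hom]
    exact hJ _ _ (h.mul _)
  · rintro T a (⟨p, rfl⟩ | ⟨p, q, rfl⟩)
    · exact hJ 0 _ ⟨p, rfl⟩
    · obtain ⟨T', f, p', d, hf, h⟩ := hK.exists_mul p
      refine factors_of_cover hf (hJ 2 _ ?_)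
      have := isEpsSum_relator p' d (f ≫ q)
      rw [← h] at this
      simpa only [comp_mul_hom, sub_eq_add_neg, AddMonObj.comp_add, AddGrpObj.comp_neg] using this

end EpsIdeal

section Homs

variable {C : Type u} [Category.{v} C] [CartesianMonoidalCategory C]

theorem comp_eq_comp_of_sub {A G : C} [NonUnitalCommRingObj A] [GrpObj G] {f : A ⟶ G}
    (hf : IsAddMulHom f) {T : C} {p q : T ⟶ A} (h : (p - q) ≫ f = 1) : p ≫ f = q ≫ f := by
  rw [← sub_add_cancel p q, hf, h, one_mul]

theorem IsRingObjHom.map_sub_eq_zero {R S : C} [NonUnitalCommRingObj R] [NonUnitalCommRingObj S]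
    {f : R ⟶ S} (hf : IsRingObjHom f) {T : C} {p q : T ⟶ R} (h : p ≫ f = q ≫ f) :
    (p - q) ≫ f = 0 := by
  have := hf.map_add (p - q) q
  rw [sub_add_cancel, h] at this
  exact right_eq_add.mp this

theorem IsRingObjHom.map_mul_sub {R S : C} [NonUnitalCommRingObj R] [NonUnitalCommRingObj S]
    {f : R ⟶ S} (hf : IsRingObjHom f) {T : C} (p : T ⟶ R) :
    (p * p - p) ≫ f = (p ≫ f) * (p ≫ f) - p ≫ f := by
  rw [← hf.map_mul, eq_sub_iff_add_eq, ← hf.map_add, sub_add_cancel]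

theorem IsQuotientBySpan.mul_self_comp {K2e K2 : C} [NonUnitalCommRingObj K2e]
    [NonUnitalCommRingObj K2] {ρ : K2e ⟶ K2} (hρ : IsQuotientBySpan BooleanRelator ρ) {T : C}
    (p : T ⟶ K2e) : (p * p) ≫ ρ = p ≫ ρ := by
  have h := hρ.relation (p * p - p) (.inr ⟨p, rfl⟩)
  have h' := hρ.isHom.map_add (p * p - p) p
  rwa [sub_add_cancel, h, zero_add] at h'

variable {M G H : C} [GrpObj G] {i : M ⟶ H} {k : H ⟶ G}

theorem mono_of_isPullback_one (hi : IsPullback i (toUnit M) k η[G]) : Mono i :=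
  ⟨fun _ _ h => hi.hom_ext h (toUnit_unique _ _)⟩

theorem exists_lift_of_isPullback_one (hi : IsPullback i (toUnit M) k η[G]) {T : C} (h : T ⟶ H)
    (hh : h ≫ k = 1) : ∃ m : T ⟶ M, m ≫ i = h :=
  ⟨hi.lift h (toUnit T) (by rw [hh]; rfl), hi.lift_fst _ _ _⟩

end Homs

/-! ### Descent of the symbols to K₂ε and to the Schur multiplier. -/

section Descent

variable {C : Type u} [Category.{v} C] [CartesianMonoidalCategory C] [InfinitaryPretopos C]
variable {K : C} [NonUnitalCommRingObj K] {G H : C} [GrpObj G] [GrpObj H] {k : H ⟶ G}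
variable {N : rootsD4 → rootsD4 → ℤ} {x : rootsD4 → (K ⟶ G)}
variable {hk : IsCentralExtension k} {c : Orbit → (K ⟶ H)}

theorem exists_isSymbolFamily (hx : SteinbergRelations N x) (hK : IsWeaklyUnital K)
    (hN : IsSignSystem N) (hk : IsCentralExtension k) :
    ∃ c, IsSymbolFamily hk x c :=
  exists_orbit_symbols hx hK hN hk

theorem IsSymbolFamily.map_add (hc : IsSymbolFamily hk x c) (o : Orbit) : IsAddMulHom (c o) :=
  (hc.isSymbol o).map_add

theorem IsSymbolFamily.map_isEpsSum (hc : IsSymbolFamily hk x c)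
    (hx : SteinbergRelations N x) (hK : IsWeaklyUnital K) (hN : IsSignSystem N) (o : Orbit) {T : C}
    {n : ℕ} {a : T ⟶ K} (ha : IsEpsSum n a) : a ≫ c o = 1 := by
  induction n generalizing a with
  | zero =>
    obtain ⟨q, rfl⟩ := ha
    rw [hc.map_add, (hc.isSymbol o).two_torsion]
  | succ n ih =>
    obtain ⟨b, r, p, q, hb, rfl⟩ := ha
    rw [hc.map_add, ih hb, hc.map_eps hx hK hN, one_mul]

variable {K2e : C} [NonUnitalCommRingObj K2e] {π : K ⟶ K2e}

/-- The subobject where c is trivial contains all finite sums of multiples of relators, hence the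
kernel of π. -/
theorem IsSymbolFamily.exists_desc (hc : IsSymbolFamily hk x c)
    (hx : SteinbergRelations N x) (hK : IsWeaklyUnital K) (hN : IsSignSystem N)
    (hπ : IsQuotientBySpan TwoEpsRelator π) (o : Orbit) : ∃ c' : K2e ⟶ H, π ≫ c' = c o := by
  refine SteinbergD4.exists_desc hπ.isRegularEpi (c o) fun T p q hpq => ?_
  refine comp_eq_comp_of_sub (hc.map_add o) ?_
  have := hπ.factors_of_comp_eq_zero hK (X := equalizerSubobject (c o) 1)
    (fun n a ha => equalizerSubobject_factors _ _ _
      (by rw [hc.map_isEpsSum hx hK hN o ha, MonObj.comp_one]))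
    (p - q) (hπ.isHom.map_sub_eq_zero hpq)
  rw [equalizerSubobject_factors_iff, MonObj.comp_one] at this
  exact this

theorem IsSymbolFamily.comp_eq_one (hc : IsSymbolFamily hk x c)
    (hx : SteinbergRelations N x) (hK : IsWeaklyUnital K) (o : Orbit) : c o ≫ k = 1 := by
  refine eq_of_cover hK.isRegularEpi_mul ?_
  have h := (exists_orbit_config o).choose_spec.choose_spec.choose_spec
  have h' := orthogonal_of_triple h.1 h.2.1 h.2.2.1
  rw [← Category.assoc, ← (hc.isSymbol o).eq, liftedComm_comp_hom, MonObj.comp_one]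
  exact hx.commutator_one _ _ (root_add_not_mem h'.ge).1 (root_add_not_mem h'.ge).2 _ _

variable {M : C} [GrpObj M] {i : M ⟶ H}

theorem IsSymbolFamily.exists_orbitHom (hc : IsSymbolFamily hk x c)
    (hx : SteinbergRelations N x) (hK : IsWeaklyUnital K) (hN : IsSignSystem N)
    (hπ : IsQuotientBySpan TwoEpsRelator π) (hM : IsMonHom i)
    (hi : IsPullback i (toUnit M) k η[G]) (o : Orbit) :
    ∃ c' : K2e ⟶ M, π ≫ c' ≫ i = c o ∧ IsOrbitHom x k i π o c' := by
  have := mono_of_isPullback_one hi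
  have hπ' := hπ.isRegularEpi
  obtain ⟨d, hd⟩ := hc.exists_desc hx hK hN hπ o
  obtain ⟨c', rfl⟩ := exists_lift_of_isPullback_one hi d (by
    rw [← cancel_epi π, ← Category.assoc, hd, hc.comp_eq_one hx hK o, MonObj.comp_one])
  refine ⟨c', hd, fun {T} p q => ?_, fun a b hab ho T p q g h hg hh => ?_⟩
  · obtain ⟨T₁, e₁, p', he₁, hp⟩ := exists_local_lift hπ.isRegularEpi p
    obtain ⟨T₂, e₂, q', he₂, hq⟩ := exists_local_lift hπ.isRegularEpi (e₁ ≫ q)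
    refine eq_of_cover (isRegularEpi_comp he₂ he₁) ?_
    rw [← cancel_mono i]
    have h₁ : (e₂ ≫ e₁) ≫ p = (e₂ ≫ p') ≫ π := by rw [Category.assoc, Category.assoc, hp]
    have h₂ : (e₂ ≫ e₁) ≫ q = q' ≫ π := by rw [Category.assoc, hq]
    rw [← Category.assoc, AddMonObj.comp_add, MonObj.comp_mul, mul_comp_hom hM, ← Category.assoc,
      ← Category.assoc _ q, h₁, h₂, ← hπ.isHom.map_add]
    simp only [Category.assoc, hd]
    rw [hc.map_add, Category.assoc]
  · rw [hd, ← (hc o a b hab ho).eq, liftedComm_eq hk hg hh]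

/-- Every element of K is locally a product, so the commutators for one orthogonal pair in the orbit
already determine c. -/
theorem IsOrbitHom.unique (hK : IsWeaklyUnital K) (hk : IsCentralExtension k)
    (hπ : IsQuotientBySpan TwoEpsRelator π)
    (hi : IsPullback i (toUnit M) k η[G]) {o : Orbit} {c₁ c₂ : K2e ⟶ M}
    (h₁ : IsOrbitHom x k i π o c₁) (h₂ : IsOrbitHom x k i π o c₂) : c₁ = c₂ := by
  have := mono_of_isPullback_one hi
  have hπ' := hπ.isRegularEpi
  rw [← cancel_mono i, ← cancel_epi π]
  refine eq_of_cover hK.isRegularEpi_mul ?_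
  obtain ⟨s, g, d, hrd, hg, ht, h, -⟩ := exists_orbit_config o
  have hgt := orthogonal_of_triple hrd hg ht
  obtain ⟨T', e, l, m, he, hl, hm⟩ := hk.exists_lift₂ (fst K K ≫ x g) (snd K K ≫ x rootA')
  refine eq_of_cover he ?_
  have e₁ := h₁.commutator_eq g rootA' hgt h (e ≫ fst K K) (e ≫ snd K K) l m (by simp [hl])
    (by simp [hm])
  have e₂ := h₂.commutator_eq g rootA' hgt h (e ≫ fst K K) (e ≫ snd K K) l m (by simp [hl])
    (by simp [hm])
  rw [e₁, ← comp_mul_hom, Category.assoc, Category.assoc] at e₂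
  exact e₂

end Descent

/-! ### The ideal I and the section by squares. -/

section Ideal

variable {C : Type u} [Category.{v} C] [CartesianMonoidalCategory C] [InfinitaryPretopos C]
variable {K : C} [NonUnitalCommRingObj K]
variable {K2e : C} [NonUnitalCommRingObj K2e] {π : K ⟶ K2e}

theorem IsQuotientBySpan.two_torsion (hπ : IsQuotientBySpan TwoEpsRelator π) {T : C}
    (p : T ⟶ K2e) : p + p = 0 := by
  obtain ⟨T', e, p', he, hp⟩ := exists_local_lift hπ.isRegularEpi p
  refine eq_of_cover he ?_
  rw [AddMonObj.comp_add, ← hp, ← hπ.isHom.map_add, hπ.relation _ (.inl ⟨p', rfl⟩),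
    AddMonObj.comp_zero]

theorem IsQuotientBySpan.eps_relation (hπ : IsQuotientBySpan TwoEpsRelator π) {T : C}
    (p q : T ⟶ K2e) : (p * p - p) * (q * q - q) = 0 := by
  obtain ⟨T₁, e₁, p', he₁, hp⟩ := exists_local_lift hπ.isRegularEpi p
  obtain ⟨T₂, e₂, q', he₂, hq⟩ := exists_local_lift hπ.isRegularEpi (e₁ ≫ q)
  refine eq_of_cover (isRegularEpi_comp he₂ he₁) ?_
  have h₁ : (e₂ ≫ e₁) ≫ p = (e₂ ≫ p') ≫ π := by rw [Category.assoc, Category.assoc, hp]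
  have h₂ : (e₂ ≫ e₁) ≫ q = q' ≫ π := by rw [Category.assoc, hq]
  have := hπ.relation _ (.inr ⟨e₂ ≫ p', q', rfl⟩)
  rw [hπ.isHom.map_mul, hπ.isHom.map_mul_sub, hπ.isHom.map_mul_sub, ← h₁, ← h₂] at this
  rw [AddMonObj.comp_zero, ← this]
  simp only [comp_mul_hom, sub_eq_add_neg, AddMonObj.comp_add, AddGrpObj.comp_neg]

variable {K2 : C} [NonUnitalCommRingObj K2] {ρ : K2e ⟶ K2}

/-- The elements of the ideal `I` have zero squares. -/
theorem IsQuotientBySpan.mul_self_eq_zero (hπ : IsQuotientBySpan TwoEpsRelator π)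
    (hρ : IsQuotientBySpan BooleanRelator ρ) {T : C} (p : T ⟶ K2e) (hp : p ≫ ρ = 0) :
    p * p = 0 := by
  -- As 2 = 0, the elements with square zero form an ideal; it contains p² - p by the relation with
  -- q = p.
  have hJ : ∀ {T : C} (a : T ⟶ K2e),
      (equalizerSubobject (𝟙 K2e * 𝟙 K2e) 0).Factors a ↔ a * a = 0 := fun {T} a => by
    rw [equalizerSubobject_factors_iff, comp_mul_hom, Category.comp_id, AddMonObj.comp_zero]
  refine (hJ p).mp (hρ.ker_le _ ⟨?_, ?_, ?_, ?_⟩ ?_ p hp)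
  · intro T
    rw [hJ, mul_zero]
  · intro T a b ha hb
    rw [hJ] at ha hb ⊢
    rw [mul_add, add_mul, add_mul, ha, hb, mul_comm b a, zero_add, add_zero]
    exact hπ.two_torsion _
  · intro T a ha
    rw [hJ] at ha ⊢
    rw [neg_mul_neg, ha]
  · intro T r a ha
    rw [hJ] at ha ⊢
    rw [mul_mul_mul_comm, ha, mul_zero]
  · rintro T a (⟨q, rfl⟩ | ⟨q, rfl⟩)
    · rw [hJ, hπ.two_torsion, mul_zero]
    · rw [hJ, hπ.eps_relation]

/-- Squaring is a ring homomorphism since 2 = 0, and it is constant on the cosets of I because p² -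
q² = (p - q)² + 2(pq - q²). Modulo I it is the identity. -/
theorem IsQuotientBySpan.exists_section (hπ : IsQuotientBySpan TwoEpsRelator π)
    (hρ : IsQuotientBySpan BooleanRelator ρ) :
    ∃ s : K2 ⟶ K2e, IsRingObjHom s ∧ s ≫ ρ = 𝟙 K2 ∧ ρ ≫ s = 𝟙 K2e * 𝟙 K2e := by
  have hρ' := hρ.isRegularEpi
  obtain ⟨s, hs⟩ := SteinbergD4.exists_desc hρ.isRegularEpi (𝟙 K2e * 𝟙 K2e) fun T p q hpq => by
    rw [comp_mul_hom, comp_mul_hom, Category.comp_id, Category.comp_id, ← sub_eq_zero]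
    have h := hπ.mul_self_eq_zero hρ _ (hρ.isHom.map_sub_eq_zero hpq)
    have h2 := hπ.two_torsion (p * q - q * q)
    rw [sub_mul, mul_sub, mul_sub, mul_comm q p] at h
    rw [← add_zero (0 : T ⟶ K2e)]
    nth_rw 1 [← h]
    rw [← h2]
    abel
  have hs' : ∀ {T : C} (p : T ⟶ K2e), (p ≫ ρ) ≫ s = p * p := fun {T} p => by
    rw [Category.assoc, hs, comp_mul_hom, Category.comp_id]
  refine ⟨s, ⟨fun {T} a b => ?_, fun {T} a b => ?_⟩, ?_, hs⟩
  · obtain ⟨T₁, e₁, a', he₁, ha⟩ := exists_local_lift hρ.isRegularEpi a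
    obtain ⟨T₂, e₂, b', he₂, hb⟩ := exists_local_lift hρ.isRegularEpi (e₁ ≫ b)
    refine eq_of_cover (isRegularEpi_comp he₂ he₁) ?_
    have h₁ : (e₂ ≫ e₁) ≫ a = (e₂ ≫ a') ≫ ρ := by rw [Category.assoc, Category.assoc, ha]
    have h₂ : (e₂ ≫ e₁) ≫ b = b' ≫ ρ := by rw [Category.assoc, hb]
    rw [AddMonObj.comp_add, ← Category.assoc, ← Category.assoc, ← Category.assoc,
      AddMonObj.comp_add, h₁, h₂, ← hρ.isHom.map_add, hs', hs', hs', mul_add, add_mul, add_mul,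
      mul_comm b', add_add_add_comm, add_assoc ((e₂ ≫ a') * (e₂ ≫ a')), ← add_assoc _ _ (b' * b'),
      add_assoc, ← add_assoc _ _ (b' * b'), hπ.two_torsion, zero_add]
  · obtain ⟨T₁, e₁, a', he₁, ha⟩ := exists_local_lift hρ.isRegularEpi a
    obtain ⟨T₂, e₂, b', he₂, hb⟩ := exists_local_lift hρ.isRegularEpi (e₁ ≫ b)
    refine eq_of_cover (isRegularEpi_comp he₂ he₁) ?_
    have h₁ : (e₂ ≫ e₁) ≫ a = (e₂ ≫ a') ≫ ρ := by rw [Category.assoc, Category.assoc, ha]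
    have h₂ : (e₂ ≫ e₁) ≫ b = b' ≫ ρ := by rw [Category.assoc, hb]
    rw [comp_mul_hom, ← Category.assoc, ← Category.assoc, ← Category.assoc,
      comp_mul_hom, h₁, h₂, ← hρ.isHom.map_mul, hs', hs', hs', mul_mul_mul_comm]
  · rw [← cancel_epi ρ, ← Category.assoc, hs, hρ.mul_self_comp, Category.comp_id, Category.id_comp]

variable {M H : C} [GrpObj M] [GrpObj H] {i : M ⟶ H}

/-- Two homomorphisms that agree on the multiples of `p ^ 2 - p` agree on the ideal `I`. -/
theorem IsQuotientBySpan.comp_eq_of_ideal (hπ : IsQuotientBySpan TwoEpsRelator π)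
    (hρ : IsQuotientBySpan BooleanRelator ρ) (hK : IsWeaklyUnital K) {c c' : K2e ⟶ M}
    (hc : IsAddMulHom c) (hc' : IsAddMulHom c')
    (h : ∀ {T : C} (r p : T ⟶ K), (r * (p * p - p)) ≫ π ≫ c = (r * (p * p - p)) ≫ π ≫ c')
    {T : C} (p : T ⟶ K2e) (hp : p ≫ ρ = 0) : p ≫ c = p ≫ c' := by
  obtain ⟨T₁, e₁, p₁, he₁, h₁⟩ := exists_local_lift hπ.isRegularEpi p
  obtain ⟨T₂, e₂, q, d, he₂, h₂⟩ := hK.exists_mul p₁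
  refine eq_of_cover (isRegularEpi_comp he₂ he₁) ?_
  -- An element of I that is locally a product qd has zero square, so it equals (qd)² - qd up to a
  -- sign, which is irrelevant as 2 = 0.
  have e : (e₂ ≫ e₁) ≫ p = (d * d * (q * q - q)) ≫ π + (q * (d * d - d)) ≫ π := by
    have h₃ : (e₂ ≫ e₁) ≫ p = (q * d) ≫ π := by rw [← h₂, Category.assoc, Category.assoc, h₁]
    have h₄ : ((q * d) * (q * d)) ≫ π = 0 := by
      rw [hπ.isHom.map_mul, ← h₃, ← comp_mul_hom, hπ.mul_self_eq_zero hρ p hp,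
        AddMonObj.comp_zero]
    rw [← hπ.isHom.map_add]
    have h₅ : d * d * (q * q - q) + q * (d * d - d) = (q * d) * (q * d) - q * d := by
      rw [mul_sub, mul_sub, mul_mul_mul_comm, mul_comm (d * d) q, mul_comm d q]
      abel
    have h₆ := hπ.isHom.map_add ((q * d) * (q * d) - q * d) (q * d)
    rw [sub_add_cancel, h₄, ← h₃] at h₆
    rw [h₅, eq_comm]
    exact (eq_neg_of_add_eq_zero_left h₆.symm).trans
      (eq_neg_of_add_eq_zero_left (hπ.two_torsion _)).symm
  rw [← Category.assoc, ← Category.assoc, e, hc, hc']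
  simp only [Category.assoc]
  rw [h, h]

end Ideal

/-! ### Steinberg sections of central extensions with trivial symbols. -/

section Triples

set_option maxRecDepth 10000 in
theorem exists_root_dot_zero_one {a b : rootsD4} (h : a.1 ⬝ᵥ b.1 = -1) :
    ∃ c : rootsD4, a.1 ⬝ᵥ c.1 = 0 ∧ b.1 ⬝ᵥ c.1 = 1 := by
  have key : ∀ a ∈ rootList, ∀ b ∈ rootList, a ⬝ᵥ b = -1 →
      ∃ c ∈ rootList, a ⬝ᵥ c = 0 ∧ b ⬝ᵥ c = 1 := by
    decide
  obtain ⟨c, hc, h1⟩ := key _ (mem_rootList_iff.mpr a.2) _ (mem_rootList_iff.mpr b.2) h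
  exact ⟨⟨c, mem_rootList_iff.mp hc⟩, h1⟩

theorem exists_triple {r t : rootsD4} (h : r.1 ⬝ᵥ t.1 = -1) :
    ∃ s e g : rootsD4, r.1 ⬝ᵥ e.1 = 0 ∧ g.1 = r.1 + s.1 ∧ t.1 = s.1 + e.1 := by
  obtain ⟨e, hre, hte⟩ := exists_root_dot_zero_one h
  let s : rootsD4 := ⟨_, root_sub_mem hte⟩
  have hrs : r.1 ⬝ᵥ s.1 = -1 := by simp only [s, dotProduct_sub, h, hre, sub_zero]
  exact ⟨s, e, ⟨_, root_add_mem hrs⟩, hre, rfl, by simp [s]⟩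

/-- Two decompositions of a root into a sum are equivalent. -/
theorem eq_of_decomposition {X : Type*} {F : rootsD4 → rootsD4 → X}
    (h₁ : ∀ a b : rootsD4, a.1 ⬝ᵥ b.1 = -1 → F a b = F b a)
    (h₂ : ∀ r s e g t : rootsD4, r.1 ⬝ᵥ e.1 = 0 → g.1 = r.1 + s.1 → t.1 = s.1 + e.1 →
      F r t = F g e) {a b a' b' c : rootsD4} (h : c.1 = a.1 + b.1) (h' : c.1 = a'.1 + b'.1) :
    F a b = F a' b' := by
  -- Here a, a' - a, b' span an A3 subsystem with a ⟂ b', a' = a + (a' - a) and b = (a' - a) + b'.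
  have key : ∀ a b : rootsD4, c.1 = a.1 + b.1 → a.1 ⬝ᵥ a'.1 = 1 → F a b = F a' b' := by
    intro a b h ha
    have hca' := root_dot_of_add h'
    refine h₂ a ⟨_, root_sub_mem (a := a') (b := a) (by rw [dotProduct_comm, ha])⟩ b' a' b ?_
      (by simp) ?_
    · have h3 : b'.1 = a.1 + b.1 - a'.1 := by rw [← h, h']; simp
      rw [h3, dotProduct_sub, dotProduct_add, ha, root_norm, root_dot_of_add h]
      norm_num
    · have h3 : b.1 = a'.1 + b'.1 - a.1 := by rw [← h', h]; simp
      simp only [h3]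
      abel
  have hs : a.1 ⬝ᵥ a'.1 + b.1 ⬝ᵥ a'.1 = 1 := by
    rw [← add_dotProduct, ← h, h', add_dotProduct, root_norm, dotProduct_comm,
      root_dot_of_add h']
    norm_num
  have ha := root_dot_le a a'
  have hb := root_dot_le b a'
  have hab := root_dot_of_add h
  have : a.1 ⬝ᵥ a'.1 = 2 ∨ a.1 ⬝ᵥ a'.1 = 1 ∨ b.1 ⬝ᵥ a'.1 = 1 ∨ b.1 ⬝ᵥ a'.1 = 2 := by omega
  rcases this with h3 | h3 | h3 | h3
  · obtain rfl := root_eq_of_dot h3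
    rw [Subtype.ext (add_left_cancel (h.symm.trans h'))]
  · exact key a b h h3
  · rw [h₁ a b hab]
    exact key b a (by rw [h, add_comm]) h3
  · obtain rfl := root_eq_of_dot h3
    rw [h₁ a b hab, Subtype.ext (add_left_cancel ((add_comm b.1 a.1).trans (h.symm.trans h')))]

end Triples

section Section

variable {C : Type u} [Category.{v} C] [CartesianMonoidalCategory C] [Regular C]
variable {K : C} [NonUnitalCommRingObj K] {G B : C} [GrpObj G] [GrpObj B] {d : B ⟶ G}
variable {N : rootsD4 → rootsD4 → ℤ} {x : rootsD4 → (K ⟶ G)}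

/-- The lifted commutators of root elements with orthogonal roots are trivial. -/
def HasTrivialSymbols (hd : IsCentralExtension d) (x : rootsD4 → (K ⟶ G)) : Prop :=
  ∀ g t : rootsD4, g.1 ⬝ᵥ t.1 = 0 → ∀ {T : C} (p q : T ⟶ K),
    liftedComm hd (p ≫ x g) (q ≫ x t) = 1

variable {hd : IsCentralExtension d}

theorem comp_homRootLift {S T : C} (f : S ⟶ T) (a b : rootsD4) (p q : T ⟶ K) :
    f ≫ homRootLift hd N x T a b p q = homRootLift hd N x S a b (f ≫ p) (f ≫ q) := by
  have : f ≫ (N a b • p) = N a b • (f ≫ p) :=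
    _root_.map_zsmul (AddMonoidHom.mk' (fun p : T ⟶ K => f ≫ p) (AddMonObj.comp_add f)) _ _
  rw [homRootLift, homRootLift, IsLiftedSteinberg.rootLift, IsLiftedSteinberg.rootLift,
    comp_liftedComm, ← Category.assoc, ← Category.assoc, this]

theorem HasTrivialSymbols.rootLift_triple (h : HasTrivialSymbols hd x)
    (hx : SteinbergRelations N x) (hK : IsWeaklyUnital K) (hN : IsSignSystem N)
    {r s e g t : rootsD4} (hre : r.1 ⬝ᵥ e.1 = 0) (hg : g.1 = r.1 + s.1) (ht : t.1 = s.1 + e.1)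
    {T : C} (p q u : T ⟶ K) :
    homRootLift hd N x T r t p (q * u) = homRootLift hd N x T g e (p * q) u := by
  have := (hx.isLiftedSteinberg hK hN hd T).rootLift_triple hre hg ht (P := fun _ => 1)
    (h g t (orthogonal_of_triple hre hg ht)) (fun _ => one_mul 1) p q u
  rwa [mul_one] at this

/-- A round trip through an A3 subsystem, now without defect, moves a product of two factors to the
first argument, and locally b is such a product. -/
theorem HasTrivialSymbols.rootLift_balanced (h : HasTrivialSymbols hd x)
    (hx : SteinbergRelations N x) (hK : IsWeaklyUnital K) (hN : IsSignSystem N)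
    {r t : rootsD4} (hrt : r.1 ⬝ᵥ t.1 = -1) {T : C} (a b c : T ⟶ K) :
    homRootLift hd N x T r t (a * b) c = homRootLift hd N x T r t a (b * c) := by
  obtain ⟨s, e, g, hre, hg, ht⟩ := exists_triple hrt
  have hge : g.1 ⬝ᵥ e.1 = -1 := by
    rw [hg, add_dotProduct, hre, root_dot_of_add ht, zero_add]
  have hgt : g.1 ⬝ᵥ t.1 = 0 := orthogonal_of_triple hre hg ht
  have key : ∀ {T : C} (p q u w : T ⟶ K), homRootLift hd N x T r t p (q * (u * w)) =
      homRootLift hd N x T r t (p * q * u) w := by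
    intro T p q u w
    rw [h.rootLift_triple hx hK hN hre hg ht]
    exact h.rootLift_triple hx hK hN (s := rootNeg s) hgt (by simp [rootNeg, hg])
      (by simp [rootNeg, ht]) _ _ _
  obtain ⟨T', f, b₁, b₂, hf, hb⟩ := hK.exists_mul b
  refine eq_of_cover hf ?_
  have := key (f ≫ a) b₁ b₂ (f ≫ c)
  rw [← mul_assoc, mul_assoc (f ≫ a), ← hb] at this
  rw [comp_homRootLift, comp_homRootLift, comp_mul_hom, comp_mul_hom, this]

/-- The lifts of root elements form a family of morphisms. -/
theorem HasTrivialSymbols.exists_lift (h : HasTrivialSymbols hd x)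
    (hx : SteinbergRelations N x) (hK : IsWeaklyUnital K) (hN : IsSignSystem N) :
    ∃ z : rootsD4 → (K ⟶ B), ∀ a b c : rootsD4, c.1 = a.1 + b.1 → ∀ {T : C} (p q : T ⟶ K),
      (p * q) ≫ z c = homRootLift hd N x T a b p q := by
  have : ∀ a b : rootsD4, ∃ z : K ⟶ B, a.1 ⬝ᵥ b.1 = -1 → ∀ {T : C} (p q : T ⟶ K),
      (p * q) ≫ z = homRootLift hd N x T a b p q := by
    intro a b
    by_cases hab : a.1 ⬝ᵥ b.1 = -1
    · have hy : ∀ {T : C} (p q : T ⟶ K),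
          lift p q ≫ homRootLift hd N x (K ⊗ K) a b (fst K K) (snd K K) =
            homRootLift hd N x T a b p q := by
        intro T p q
        rw [comp_homRootLift, lift_fst, lift_snd]
      obtain ⟨z, hz⟩ := hK.exists_factor
        (homRootLift hd N x (K ⊗ K) a b (fst K K) (snd K K)) fun {T} p q u => by
          rw [hy, hy, h.rootLift_balanced hx hK hN hab]
      exact ⟨z, fun _ {T} p q => by rw [hz, hy]⟩
    · exact ⟨1, fun hab' => absurd hab' hab⟩
  choose F hF using this
  have hF' : ∀ {a b a' b' c : rootsD4}, c.1 = a.1 + b.1 → c.1 = a'.1 + b'.1 →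
      F a b = F a' b' := by
    intro a b a' b' c
    refine eq_of_decomposition (fun a b hab => ?_) fun r s e g t hre hg ht => ?_
    · refine hom_eq_of_forall fun {T} p => ?_
      obtain ⟨T', f, q, u, hf, hp⟩ := hK.exists_mul p
      refine ⟨T', f, hf, ?_⟩
      rw [hp, hF a b hab, mul_comm, hF b a (by rw [dotProduct_comm, hab])]
      exact ((hx.isLiftedSteinberg hK hN hd T').rootLift_swap hab _ _).symm
    · have hge : g.1 ⬝ᵥ e.1 = -1 := by
        rw [hg, add_dotProduct, hre, root_dot_of_add ht, zero_add]
      have hrt : r.1 ⬝ᵥ t.1 = -1 := by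
        rw [ht, dotProduct_add, hre, root_dot_of_add hg, add_zero]
      refine hom_eq_of_forall fun {T} p => ?_
      obtain ⟨T₁, f₁, q, u, hf₁, hp⟩ := hK.exists_mul p
      obtain ⟨T₂, f₂, u₁, u₂, hf₂, hu⟩ := hK.exists_mul u
      refine ⟨T₂, f₂ ≫ f₁, isRegularEpi_comp hf₂ hf₁, ?_⟩
      rw [Category.assoc f₂ f₁ p, hp, comp_mul_hom, hu, hF r t hrt, ← mul_assoc, hF g e hge,
        h.rootLift_triple hx hK hN hre hg ht]
  have hdec : ∀ c : rootsD4, ∃ a b : rootsD4, c.1 = a.1 + b.1 := fun c => by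
    obtain ⟨a, b, hab, -⟩ := exists_root_decomposition (a := c) (b := c) (by
      rw [root_norm]; norm_num)
    exact ⟨a, b, hab⟩
  choose α β hαβ using hdec
  refine ⟨fun c => F (α c) (β c), fun a b c hc {T} p q => ?_⟩
  dsimp only
  rw [hF' (hαβ c) hc, hF a b (root_dot_of_add hc)]

/-- A central extension with trivial symbols has a Steinberg section. -/
theorem HasTrivialSymbols.exists_section (h : HasTrivialSymbols hd x)
    (hx : SteinbergRelations N x) (hK : IsWeaklyUnital K) (hN : IsSignSystem N) :
    ∃ z : rootsD4 → (K ⟶ B), SteinbergRelations N z ∧ ∀ a, z a ≫ d = x a := by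
  obtain ⟨z, hz⟩ := h.exists_lift hx hK hN
  have hdec : ∀ c : rootsD4, ∃ a b : rootsD4, c.1 = a.1 + b.1 := fun c => by
    obtain ⟨a, b, hab, -⟩ := exists_root_decomposition (a := c) (b := c) (by
      rw [root_norm]; norm_num)
    exact ⟨a, b, hab⟩
  have hzd : ∀ c, z c ≫ d = x c := by
    intro c
    obtain ⟨a, b, hc⟩ := hdec c
    refine eq_of_cover hK.isRegularEpi_mul ?_
    rw [← Category.assoc, hz a b c hc]
    refine (liftedComm_comp_hom hd _ _).trans ?_
    rw [hx.commutator_root a b c hc, smul_mul_assoc, smul_smul, hN.sq (root_dot_of_add hc),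
      one_smul]
  have hcomm : ∀ a b : rootsD4, ∀ {T : C} (p q : T ⟶ K),
      ⁅p ≫ z a, q ≫ z b⁆ = liftedComm hd (p ≫ x a) (q ≫ x b) := fun a b {T} p q =>
    (liftedComm_eq hd (by rw [Category.assoc, hzd]) (by rw [Category.assoc, hzd])).symm
  refine ⟨z, ⟨fun c {T} p q => ?_, fun a b c hc {T} p q => ?_, fun a b hab hab' {T} p q => ?_⟩, hzd⟩
  · obtain ⟨a, b, hc⟩ := hdec c
    have hy : ∀ {T : C} (p q : T ⟶ K),
        lift p q ≫ homRootLift hd N x (K ⊗ K) a b (fst K K) (snd K K) =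
          homRootLift hd N x T a b p q := by
      intro T p q
      rw [comp_homRootLift, lift_fst, lift_snd]
    refine hK.isAddMulHom_of_factor (fun {T} p q => (hz a b c hc p q).trans (hy p q).symm)
      (fun {T} p p' q => ?_) p q
    rw [hy, hy, hy]
    exact (hx.isLiftedSteinberg hK hN hd T).rootLift_add_left (root_dot_of_add hc) p p' q
  · rw [hcomm, ← smul_mul_assoc, hz a b c hc, homRootLift, IsLiftedSteinberg.rootLift, smul_smul,
      hN.sq (root_dot_of_add hc), one_smul]
  · rw [hcomm]
    have h3 : 0 ≤ a.1 ⬝ᵥ b.1 := by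
      have h4 := neg_two_le_root_dot a b
      by_contra h5
      have : a.1 ⬝ᵥ b.1 = -1 ∨ a.1 ⬝ᵥ b.1 = -2 := by omega
      rcases this with h6 | h6
      · exact hab (root_add_mem h6)
      · exact hab' (root_add_eq_zero h6)
    rcases h3.eq_or_lt with h4 | h4
    · exact h a b h4.symm p q
    · exact (hx.isLiftedSteinberg hK hN hd T).nonorth a b h4 p q

end Section

/-! ### Quotients by central subgroups. -/

section Quotient

variable {C : Type u} [Category.{v} C] [CartesianMonoidalCategory C]

theorem isMonHom_of_map_mul {G H : C} [GrpObj G] [GrpObj H] {f : G ⟶ H}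
    (h : ∀ {T : C} (a b : T ⟶ G), (a * b) ≫ f = (a ≫ f) * (b ≫ f)) : IsMonHom f where
  one_hom := by
    have h1 := h (1 : 𝟙_ C ⟶ G) 1
    rw [one_mul, left_eq_mul] at h1
    simpa [Hom.one_def] using h1
  mul_hom := by
    have h1 := h (fst G G) (snd G G)
    simpa [Hom.mul_def] using h1

/-- A group object from the group axioms for generalized elements. -/
abbrev grpObjOfElements {B : C} (m : B ⊗ B ⟶ B) (e : 𝟙_ C ⟶ B) (n : B ⟶ B)
    (assoc : ∀ {T : C} (a b c : T ⟶ B),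
      lift (lift a b ≫ m) c ≫ m = lift a (lift b c ≫ m) ≫ m)
    (one_mul : ∀ {T : C} (b : T ⟶ B), lift (toUnit T ≫ e) b ≫ m = b)
    (mul_one : ∀ {T : C} (b : T ⟶ B), lift b (toUnit T ≫ e) ≫ m = b)
    (inv_mul : ∀ {T : C} (b : T ⟶ B), lift (b ≫ n) b ≫ m = toUnit T ≫ e)
    (mul_inv : ∀ {T : C} (b : T ⟶ B), lift b (b ≫ n) ≫ m = toUnit T ≫ e) : GrpObj B where
  one := e
  mul := m
  inv := n
  one_mul := by
    have h : e ▷ B = lift (toUnit _ ≫ e) (snd _ _) := by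
      apply CartesianMonoidalCategory.hom_ext
      · simp only [whiskerRight_fst, lift_fst]
        rw [toUnit_unique (toUnit (𝟙_ C ⊗ B)) (fst _ _)]
      · simp
    rw [h, one_mul, leftUnitor_hom]
  mul_one := by
    have h : B ◁ e = lift (fst _ _) (toUnit _ ≫ e) := by
      apply CartesianMonoidalCategory.hom_ext
      · simp
      · simp only [whiskerLeft_snd, lift_snd]
        rw [toUnit_unique (toUnit (B ⊗ 𝟙_ C)) (snd _ _)]
    rw [h, mul_one, rightUnitor_hom]
  mul_assoc := by
    have h : m ▷ B = lift (lift (fst _ _ ≫ fst _ _) (fst _ _ ≫ snd _ _) ≫ m) (snd _ _) := by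
      apply CartesianMonoidalCategory.hom_ext <;> simp [← comp_lift]
    have h' : (α_ B B B).hom ≫ B ◁ m =
        lift (fst _ _ ≫ fst _ _) (lift (fst _ _ ≫ snd _ _) (snd _ _) ≫ m) := by
      apply CartesianMonoidalCategory.hom_ext
      · simp
      · simp only [Category.assoc, whiskerLeft_snd, lift_snd]
        rw [← Category.assoc]
        congr 1
        apply CartesianMonoidalCategory.hom_ext <;> simp
    rw [h, assoc, ← h', Category.assoc]
  left_inv := by simpa using inv_mul (𝟙 B)
  right_inv := by simpa using mul_inv (𝟙 B)

/-- A group structure on the target of a regular epimorphism that is compatible with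
the multiplication. -/
theorem exists_grpObj_of_isRegularEpi [Regular C] {H B : C} [GrpObj H] {q : H ⟶ B}
    (hq : IsRegularEpi q)
    (hmul : ∀ {T : C} (a b a' b' : T ⟶ H), a ≫ q = a' ≫ q → b ≫ q = b' ≫ q →
      (a * b) ≫ q = (a' * b') ≫ q) : ∃ _ : GrpObj B, IsMonHom q := by
  obtain ⟨m, hm⟩ := exists_desc (isRegularEpi_tensor hq hq) ((fst H H * snd H H) ≫ q)
    fun T a b hab => by
      rw [← Category.assoc, ← Category.assoc, MonObj.comp_mul, MonObj.comp_mul]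
      refine hmul _ _ _ _ ?_ ?_
      · simpa using congrArg (· ≫ fst B B) hab
      · simpa using congrArg (· ≫ snd B B) hab
  have hm' : ∀ {T : C} (a b : T ⟶ H), lift (a ≫ q) (b ≫ q) ≫ m = (a * b) ≫ q := by
    intro T a b
    have := congrArg (lift a b ≫ ·) hm
    rwa [← Category.assoc, ← Category.assoc, lift_map, MonObj.comp_mul, lift_fst, lift_snd] at this
  obtain ⟨n, hn⟩ := exists_desc hq ((𝟙 H)⁻¹ ≫ q) fun T a b hab => by
    rw [← Category.assoc, ← Category.assoc, GrpObj.comp_inv, GrpObj.comp_inv, Category.comp_id,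
      Category.comp_id]
    have h2 := hmul a⁻¹ (b * b⁻¹) a⁻¹ (a * b⁻¹) rfl (hmul b b⁻¹ a b⁻¹ hab.symm rfl)
    simpa only [mul_inv_cancel, mul_one, inv_mul_cancel_left] using h2
  have hn' : ∀ {T : C} (a : T ⟶ H), (a ≫ q) ≫ n = a⁻¹ ≫ q := by
    intro T a
    rw [Category.assoc, hn, ← Category.assoc, GrpObj.comp_inv, Category.comp_id]
  have he : ∀ T : C, toUnit T ≫ η[H] ≫ q = (1 : T ⟶ H) ≫ q := fun T => by
    rw [Hom.one_def, Category.assoc]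
  suffices ∃ g : GrpObj B, g.mul = m by
    obtain ⟨g, rfl⟩ := this
    exact ⟨g, isMonHom_of_map_mul fun a b => (hm' a b).symm⟩
  refine ⟨grpObjOfElements m (η[H] ≫ q) n (fun {T} a b c => ?_) (fun {T} b => ?_) (fun {T} b => ?_)
    (fun {T} b => ?_) fun {T} b => ?_, rfl⟩
  · obtain ⟨T₁, f₁, a', hf₁, ha⟩ := exists_local_lift hq a
    obtain ⟨T₂, f₂, b', hf₂, hb⟩ := exists_local_lift hq (f₁ ≫ b)
    obtain ⟨T₃, f₃, c', hf₃, hc⟩ := exists_local_lift hq (f₂ ≫ f₁ ≫ c)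
    refine eq_of_cover (isRegularEpi_comp hf₃ (isRegularEpi_comp hf₂ hf₁)) ?_
    have h₁ : (f₃ ≫ f₂ ≫ f₁) ≫ a = (f₃ ≫ f₂ ≫ a') ≫ q := by
      simp only [Category.assoc, ha]
    have h₂ : (f₃ ≫ f₂ ≫ f₁) ≫ b = (f₃ ≫ b') ≫ q := by
      simp only [Category.assoc, hb]
    have h₃ : (f₃ ≫ f₂ ≫ f₁) ≫ c = c' ≫ q := by
      simp only [Category.assoc, hc]
    rw [comp_lift_assoc, comp_lift_assoc, comp_lift_assoc, comp_lift_assoc, h₁, h₂, h₃]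
    simp only [hm', mul_assoc]
  all_goals
    obtain ⟨T', f, b', hf, hb⟩ := exists_local_lift hq b
    refine eq_of_cover hf ?_
    rw [comp_lift_assoc]
    simp only [he, ← Category.assoc, MonObj.comp_one, ← hb, hn', hm', one_mul, mul_one,
      inv_mul_cancel, mul_inv_cancel]

/-- The quotient of a group object by a central subgroup. -/
theorem exists_quotient [InfinitaryPretopos C] {H W : C} [GrpObj H] (m : W ⟶ H) [Mono m]
    (hone : ∃ e : 𝟙_ C ⟶ W, e ≫ m = η[H])
    (hmul : ∀ {T : C} (v w : T ⟶ W), ∃ u : T ⟶ W, u ≫ m = (v ≫ m) * (w ≫ m))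
    (hinv : ∀ {T : C} (v : T ⟶ W), ∃ u : T ⟶ W, u ≫ m = (v ≫ m)⁻¹)
    (hcen : ∀ {T : C} (v : T ⟶ W) (h : T ⟶ H), Commute (v ≫ m) h) :
    ∃ (B : C) (_ : GrpObj B) (q : H ⟶ B), IsMonHom q ∧ IsRegularEpi q ∧
      ∀ {T : C} (a b : T ⟶ H), a ≫ q = b ≫ q ↔ ∃ w : T ⟶ W, b = a * (w ≫ m) := by
  -- The relation h ∼ hw is parametrized by pairs (h, w); it is effective in a pretopos, and
  -- centrality of W makes it compatible with multiplication.
  let p₁ : H ⊗ W ⟶ H := fst H W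
  let p₂ : H ⊗ W ⟶ H := fst H W * (snd H W ≫ m)
  have h₂ : ∀ {T : C} (r : T ⟶ H ⊗ W), r ≫ p₂ = (r ≫ fst H W) * (r ≫ snd H W ≫ m) :=
    fun r => MonObj.comp_mul _ _ _
  have hR : IsEquivalenceRelation p₁ p₂ := by
    obtain ⟨e, he⟩ := hone
    obtain ⟨n, hn⟩ := hinv (snd H W)
    obtain ⟨u, hu⟩ := hmul (pullback.fst p₂ p₁ ≫ snd H W) (pullback.snd p₂ p₁ ≫ snd H W)
    have ht : lift (pullback.fst p₂ p₁ ≫ p₁) u ≫ p₂ = pullback.snd p₂ p₁ ≫ p₂ := by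
      have h3 : pullback.snd p₂ p₁ ≫ fst H W = pullback.fst p₂ p₁ ≫ p₂ :=
        (pullback.condition (f := p₂) (g := p₁)).symm
      rw [h₂, h₂, lift_fst, lift_snd_assoc, hu, h3, h₂, mul_assoc, Category.assoc, Category.assoc]
    refine EquivalenceRelation.isEquivalenceRelation
      { right_cancellation := fun Y f g hfg hfg' => ?_
        r := lift (𝟙 H) (toUnit H ≫ e)
        reflexivity₁ := lift_fst _ _
        reflexivity₂ := ?_
        s := lift p₂ n
        symmetry₁ := lift_fst _ _
        symmetry₂ := ?_
        c := pullback.cone p₂ p₁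
        isLimit := pullback.isLimit p₂ p₁
        t := lift (pullback.fst p₂ p₁ ≫ p₁) u
        transitivity₁ := lift_fst _ _
        transitivity₂ := ht }
    · apply CartesianMonoidalCategory.hom_ext
      · exact hfg
      · rw [h₂, h₂] at hfg'
        have h3 : f ≫ fst H W = g ≫ fst H W := hfg
        rw [h3] at hfg'
        rw [← cancel_mono m, Category.assoc, Category.assoc]
        exact mul_left_cancel hfg'
    · rw [h₂, lift_fst, lift_snd_assoc, Category.assoc, he, ← Hom.one_def, mul_one]
    · rw [h₂, lift_fst, lift_snd_assoc, hn, mul_inv_cancel_right]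
  obtain ⟨⟨E⟩⟩ := InfinitaryPretopos.isEffective p₁ p₂ hR
  have hq : IsRegularEpi E.π := inferInstance
  have hker : ∀ {T : C} (a b : T ⟶ H), a ≫ E.π = b ≫ E.π ↔ ∃ w : T ⟶ W, b = a * (w ≫ m) := by
    intro T a b
    constructor
    · intro hab
      obtain ⟨r, hr, hr'⟩ := E.isKernelPair.exists_lift a b hab
      refine ⟨r ≫ snd H W, ?_⟩
      rw [← hr', h₂, Category.assoc]
      exact congrArg (· * _) hr
    · rintro ⟨w, rfl⟩
      have := congrArg (lift a w ≫ ·) E.isKernelPair.w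
      simp only [← Category.assoc] at this
      rwa [h₂, lift_fst, lift_snd_assoc] at this
  obtain ⟨g, hg⟩ := exists_grpObj_of_isRegularEpi hq fun {T} a b a' b' ha hb => by
    rw [hker] at ha hb ⊢
    obtain ⟨v, rfl⟩ := ha
    obtain ⟨w, rfl⟩ := hb
    obtain ⟨u, hu⟩ := hmul v w
    refine ⟨u, ?_⟩
    rw [hu, mul_assoc, ← mul_assoc _ b, (hcen v b).eq, mul_assoc, mul_assoc]
  exact ⟨E.B, g, E.π, hg, hq, hker⟩

/-- A central subgroup that lies in the kernel of a central extension induces a central extension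
of the quotient. -/
theorem IsCentralExtension.exists_desc [Regular C] {G H B W : C} [GrpObj G] [GrpObj H] [GrpObj B]
    {k : H ⟶ G} (hk : IsCentralExtension k) {m : W ⟶ H} {q : H ⟶ B} (hq : IsMonHom q)
    (hq' : IsRegularEpi q)
    (hker : ∀ {T : C} (a b : T ⟶ H), a ≫ q = b ≫ q → ∃ w : T ⟶ W, b = a * (w ≫ m))
    (hm : m ≫ k = 1) : ∃ d : B ⟶ G, IsCentralExtension d ∧ q ≫ d = k := by
  have hk' := hk.isMonHom
  have hk'' := hk.isRegularEpi
  obtain ⟨d, rfl⟩ := SteinbergD4.exists_desc hq' k fun T a b hab => by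
    obtain ⟨w, rfl⟩ := hker a b hab
    rw [MonObj.mul_comp, Category.assoc, hm, MonObj.comp_one, mul_one]
  refine ⟨d, ⟨isMonHom_of_map_mul fun {T} a b => ?_, isRegularEpi_of_comp q d hk'',
    fun {T} z h hz => ?_⟩, rfl⟩
  · obtain ⟨T₁, f₁, a', hf₁, ha⟩ := exists_local_lift hq' a
    obtain ⟨T₂, f₂, b', hf₂, hb⟩ := exists_local_lift hq' (f₁ ≫ b)
    refine eq_of_cover (isRegularEpi_comp hf₂ hf₁) ?_
    have h₁ : (f₂ ≫ f₁) ≫ a = (f₂ ≫ a') ≫ q := by simp only [Category.assoc, ha]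
    have h₂ : (f₂ ≫ f₁) ≫ b = b' ≫ q := by simp only [Category.assoc, hb]
    rw [MonObj.comp_mul, ← Category.assoc, ← Category.assoc, ← Category.assoc, MonObj.comp_mul,
      h₁, h₂, ← MonObj.mul_comp, Category.assoc, Category.assoc, Category.assoc, Category.assoc,
      ← Category.assoc f₂, mul_comp_hom hk']
  · obtain ⟨T₁, f₁, z', hf₁, hz'⟩ := exists_local_lift hq' z
    obtain ⟨T₂, f₂, h', hf₂, hh'⟩ := exists_local_lift hq' (f₁ ≫ h)
    refine eq_of_cover (isRegularEpi_comp hf₂ hf₁) ?_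
    have h₁ : (f₂ ≫ f₁) ≫ z = (f₂ ≫ z') ≫ q := by simp only [Category.assoc, hz']
    have h₂ : (f₂ ≫ f₁) ≫ h = h' ≫ q := by simp only [Category.assoc, hh']
    rw [MonObj.comp_mul, MonObj.comp_mul, h₁, h₂, ← MonObj.mul_comp, ← MonObj.mul_comp,
      hk.central (f₂ ≫ z') h']
    rw [← Category.assoc, ← h₁, Category.assoc, hz, MonObj.comp_one]

end Quotient

section CentralImage

variable {C : Type u} [Category.{v} C] [CartesianMonoidalCategory C]

theorem IsAddMulHom.map_zero {A G : C} [AddGrpObj A] [GrpObj G] {f : A ⟶ G} (hf : IsAddMulHom f)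
    {T : C} : (0 : T ⟶ A) ≫ f = 1 := by
  have := hf (0 : T ⟶ A) 0
  rwa [add_zero, left_eq_mul] at this

theorem IsAddMulHom.map_neg {A G : C} [AddGrpObj A] [GrpObj G] {f : A ⟶ G} (hf : IsAddMulHom f)
    {T : C} (a : T ⟶ A) : (-a) ≫ f = (a ≫ f)⁻¹ := by
  rw [eq_inv_iff_mul_eq_one, ← hf, neg_add_cancel, hf.map_zero]

/-- The product of three morphisms to a group object. -/
def prodHom {A G : C} [GrpObj G] (f g h : A ⟶ G) : A ⊗ (A ⊗ A) ⟶ G :=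
  ((fst A (A ⊗ A) ≫ f) * (snd A (A ⊗ A) ≫ fst A A ≫ g)) * (snd A (A ⊗ A) ≫ snd A A ≫ h)

theorem lift_prodHom {A G T : C} [GrpObj G] (f g h : A ⟶ G) (a b c : T ⟶ A) :
    lift a (lift b c) ≫ prodHom f g h = ((a ≫ f) * (b ≫ g)) * (c ≫ h) := by
  simp only [prodHom, MonObj.comp_mul, lift_fst_assoc, lift_snd_assoc]

theorem comp_prodHom {A G T : C} [GrpObj G] (f g h : A ⟶ G) (v : T ⟶ A ⊗ (A ⊗ A)) :
    v ≫ prodHom f g h = (((v ≫ fst _ _) ≫ f) * ((v ≫ snd _ _ ≫ fst _ _) ≫ g)) *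
      ((v ≫ snd _ _ ≫ snd _ _) ≫ h) := by
  simp only [prodHom, MonObj.comp_mul, Category.assoc]

variable [Regular C]

/-- The image of a product of three homomorphisms to the center is a central subgroup. -/
theorem exists_central_image {A H : C} [NonUnitalCommRingObj A] [GrpObj H] {f g h : A ⟶ H}
    (hf : IsAddMulHom f) (hg : IsAddMulHom g) (hh : IsAddMulHom h)
    (hf' : ∀ {T : C} (a : T ⟶ A) (z : T ⟶ H), Commute (a ≫ f) z)
    (hg' : ∀ {T : C} (a : T ⟶ A) (z : T ⟶ H), Commute (a ≫ g) z)
    (hh' : ∀ {T : C} (a : T ⟶ A) (z : T ⟶ H), Commute (a ≫ h) z) :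
    ∃ (W : C) (e : A ⊗ (A ⊗ A) ⟶ W) (m : W ⟶ H), Mono m ∧ IsRegularEpi e ∧
      e ≫ m = prodHom f g h ∧ (∃ n : 𝟙_ C ⟶ W, n ≫ m = η[H]) ∧
      (∀ {T : C} (v w : T ⟶ W), ∃ u : T ⟶ W, u ≫ m = (v ≫ m) * (w ≫ m)) ∧
      (∀ {T : C} (v : T ⟶ W), ∃ u : T ⟶ W, u ≫ m = (v ≫ m)⁻¹) ∧
      ∀ {T : C} (v : T ⟶ W) (z : T ⟶ H), Commute (v ≫ m) z := by
  obtain ⟨W, e, m, hm, he, hem⟩ : ∃ (W : C) (e : A ⊗ (A ⊗ A) ⟶ W) (m : W ⟶ H), Mono m ∧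
      IsRegularEpi e ∧ e ≫ m = prodHom f g h :=
    ⟨_, factorThruImage _, image.ι _, inferInstance, inferInstance, image.fac _⟩
  have hcen : ∀ {T : C} (v : T ⟶ A ⊗ (A ⊗ A)) (z : T ⟶ H), Commute (v ≫ prodHom f g h) z := by
    intro T v z
    rw [comp_prodHom]
    exact ((hf' _ z).mul_left (hg' _ z)).mul_left (hh' _ z)
  have hloc : ∀ {T : C} (w : T ⟶ W), ∃ (T' : C) (t : T' ⟶ T) (v : T' ⟶ A ⊗ (A ⊗ A)),
      IsRegularEpi t ∧ t ≫ w ≫ m = v ≫ prodHom f g h := by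
    intro T w
    obtain ⟨T', t, v, ht, hv⟩ := exists_local_lift he w
    exact ⟨T', t, v, ht, by rw [← Category.assoc, ← hv, Category.assoc, hem]⟩
  refine ⟨W, e, m, hm, he, hem, ⟨lift 0 (lift 0 0) ≫ e, ?_⟩, fun {T} v w => ?_, fun {T} v => ?_,
    fun {T} v z => ?_⟩
  · rw [Category.assoc, hem, lift_prodHom, hf.map_zero, hg.map_zero, hh.map_zero, one_mul, one_mul,
      Hom.one_def, toUnit_unit, Category.id_comp]
  · obtain ⟨T₁, t₁, v', ht₁, hv⟩ := hloc v
    obtain ⟨T₂, t₂, w', ht₂, hw⟩ := hloc (t₁ ≫ w)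
    refine exists_factor_of_cover (isRegularEpi_comp ht₂ ht₁) m _ (lift
      ((t₂ ≫ v') ≫ fst _ _ + w' ≫ fst _ _)
      (lift ((t₂ ≫ v') ≫ snd _ _ ≫ fst _ _ + w' ≫ snd _ _ ≫ fst _ _)
        ((t₂ ≫ v') ≫ snd _ _ ≫ snd _ _ + w' ≫ snd _ _ ≫ snd _ _)) ≫ e) ?_
    have h₁ : (t₂ ≫ t₁) ≫ v ≫ m = (t₂ ≫ v') ≫ prodHom f g h := by
      simp only [Category.assoc, hv]
    have h₂ : (t₂ ≫ t₁) ≫ w ≫ m = w' ≫ prodHom f g h := by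
      rw [← hw]
      simp only [Category.assoc]
    rw [MonObj.comp_mul, h₁, h₂, Category.assoc, hem, lift_prodHom, hf, hg, hh,
      comp_prodHom f g h (t₂ ≫ v'), comp_prodHom f g h w', (hg' _ _).symm.mul_mul_mul_comm,
      (hh' _ _).symm.mul_mul_mul_comm]
  · obtain ⟨T', t, v', ht, hv⟩ := hloc v
    refine exists_factor_of_cover ht m _ (lift (-(v' ≫ fst _ _)) (lift (-(v' ≫ snd _ _ ≫ fst _ _))
      (-(v' ≫ snd _ _ ≫ snd _ _))) ≫ e) ?_
    rw [GrpObj.comp_inv, hv, Category.assoc, hem, lift_prodHom, hf.map_neg, hg.map_neg, hh.map_neg,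
      comp_prodHom, (hh' _ _).symm.mul_inv, (hg' _ _).symm.mul_inv]
  · obtain ⟨T', t, v', ht, hv⟩ := hloc v
    refine eq_of_cover ht ?_
    rw [MonObj.comp_mul, MonObj.comp_mul, hv, (hcen v' (t ≫ z)).eq]

end CentralImage

/-! ### The symbols exhaust the Schur multiplier. -/

section Main

variable {C : Type u} [Category.{v} C] [CartesianMonoidalCategory C] [InfinitaryPretopos C]
variable {K : C} [NonUnitalCommRingObj K] {St H M K2e : C} [GrpObj St] [GrpObj H] [GrpObj M]
variable [NonUnitalCommRingObj K2e] {N : rootsD4 → rootsD4 → ℤ} {x : rootsD4 → (K ⟶ St)}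
variable {k : H ⟶ St} {i : M ⟶ H} {π : K ⟶ K2e}

/-- The Schur multiplier is the product of the images of the orbit homomorphisms. -/
theorem IsSchurMultiplier.isRegularEpi_prodHom (hK : IsWeaklyUnital K) (hN : IsSignSystem N)
    (hSt : IsSteinbergGroup N x) (hM : IsSchurMultiplier i k) {c : Orbit → (K2e ⟶ M)}
    (hc : ∀ o, IsOrbitHom x k i π o (c o)) :
    IsRegularEpi (prodHom (c .zero) (c .plus) (c .minus)) := by
  have hk := hM.isUniversalCentralExtension.isCentralExtension
  have hi := mono_of_isPullback_one hM.isPullback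
  have hi' := hM.isMonHom
  have hk' := hk.isMonHom
  have hik : i ≫ k = 1 := hM.isPullback.w
  have hadd : ∀ o, IsAddMulHom (c o ≫ i) := fun o {T} p q => by
    rw [← Category.assoc, (hc o).map_add, MonObj.mul_comp, Category.assoc, Category.assoc]
  have hzero : ∀ o {T : C}, (0 : T ⟶ K2e) ≫ c o ≫ i = 1 := fun o {T} =>
    IsAddMulHom.map_zero (hadd o)
  have hcen : ∀ o {T : C} (a : T ⟶ K2e) (z : T ⟶ H), Commute (a ≫ c o ≫ i) z := fun o {T} a z =>
    hk.central _ _ (by rw [Category.assoc, Category.assoc, hik, MonObj.comp_one, MonObj.comp_one])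
  obtain ⟨W, e, m, hm, he, hem, h₁, h₂, h₃, h₄⟩ := exists_central_image (hadd .zero) (hadd .plus)
    (hadd .minus) (hcen .zero) (hcen .plus) (hcen .minus)
  -- The subgroup W is the product of the three images, and dividing by it trivializes all symbols.
  obtain ⟨B, hB, q, hq, hq', hker⟩ := exists_quotient m h₁ h₂ h₃ h₄
  have hP : prodHom (c .zero ≫ i) (c .plus ≫ i) (c .minus ≫ i) =
      prodHom (c .zero) (c .plus) (c .minus) ≫ i := by
    simp only [prodHom, MonObj.mul_comp, Category.assoc]
  obtain ⟨d, hd, rfl⟩ := hk.exists_desc hq hq' (fun a b => (hker a b).mp) (by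
    have := he
    rw [← cancel_epi e, ← Category.assoc, hem, hP, Category.assoc, hik, MonObj.comp_one,
      MonObj.comp_one])
  have hsym : HasTrivialSymbols hd x := by
    intro g t hgt T p p'
    obtain ⟨o, ho⟩ := exists_orbit hgt
    obtain ⟨T', f, l, l', hf, hl, hl'⟩ := hk.exists_lift₂ (p ≫ x g) (p' ≫ x t)
    refine eq_of_cover hf ?_
    rw [comp_liftedComm, ← hl, ← hl', ← Category.assoc, ← Category.assoc, liftedComm_comp,
      ← commutator_comp_hom hq, (hc o).commutator_eq g t hgt ho (f ≫ p) (f ≫ p') l l' (by simp [hl])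
      (by simp [hl']), MonObj.comp_one]
    have : ∃ w : T' ⟶ W, w ≫ m = (f ≫ p * f ≫ p') ≫ π ≫ c o ≫ i := by
      cases o with
      | zero =>
        refine ⟨lift ((f ≫ p * f ≫ p') ≫ π) (lift 0 0) ≫ e, ?_⟩
        rw [Category.assoc, hem, lift_prodHom, hzero .plus, hzero .minus, mul_one,
          mul_one, Category.assoc]
      | plus =>
        refine ⟨lift 0 (lift ((f ≫ p * f ≫ p') ≫ π) 0) ≫ e, ?_⟩
        rw [Category.assoc, hem, lift_prodHom, hzero .zero, hzero .minus, mul_one,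
          one_mul, Category.assoc]
      | minus =>
        refine ⟨lift 0 (lift 0 ((f ≫ p * f ≫ p') ≫ π)) ≫ e, ?_⟩
        rw [Category.assoc, hem, lift_prodHom, hzero .zero, hzero .plus, one_mul,
          one_mul, Category.assoc]
    obtain ⟨w, hw⟩ := this
    have h := (hker 1 (w ≫ m)).mpr ⟨w, (one_mul _).symm⟩
    rw [← hw, ← h, MonObj.one_comp]
  obtain ⟨z, hz, hzd⟩ := hsym.exists_section hSt.relations hK hN
  have hdm := hd.isMonHom
  obtain ⟨f, ⟨hf, hfz⟩, -⟩ := hSt.existsUnique_hom z hz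
  have hfd : f ≫ d = 𝟙 St :=
    (hSt.existsUnique_hom x hSt.relations).unique
      ⟨inferInstance, fun a => by rw [← Category.assoc, hfz, hzd]⟩
      ⟨inferInstance, fun a => Category.comp_id _⟩
  -- Both are homomorphisms from the universal central extension to d over St, so they coincide; in
  -- particular q kills M, which therefore lies in W.
  have hqf : q = (q ≫ d) ≫ f :=
    (hM.isUniversalCentralExtension.existsUnique_hom d hd).unique ⟨hq, rfl⟩
      ⟨inferInstance, by rw [Category.assoc, hfd, Category.comp_id]⟩
  have hiq : i ≫ q = 1 := by
    rw [hqf, ← Category.assoc, hik, MonObj.one_comp]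
  obtain ⟨w, hw⟩ := (hker 1 i).mp (by rw [MonObj.one_comp, hiq])
  rw [one_mul] at hw
  obtain ⟨T, t, v, ht, hv⟩ := exists_local_lift he w
  refine isRegularEpi_of_comp v _ ?_
  have : v ≫ prodHom (c .zero) (c .plus) (c .minus) = t := by
    rw [← cancel_mono i, Category.assoc, ← hP, ← hem, ← Category.assoc, hv, Category.assoc, ← hw]
  rwa [this]

end Main

end SteinbergD4

theorem mainTheorem6 {C : Type u} [Category.{v} C] [CartesianMonoidalCategory C]
    [InfinitaryPretopos C]
    {K : C} [NonUnitalCommRingObj K] (hK : IsWeaklyUnital K)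
    {N : rootsD4 → rootsD4 → ℤ} (hN : IsStructureConstants N)
    {St : C} [GrpObj St] {x : rootsD4 → (K ⟶ St)} (hSt : IsSteinbergGroup N x)
    {H : C} [GrpObj H] {k : H ⟶ St} {M : C} [GrpObj M] {i : M ⟶ H}
    (hM : IsSchurMultiplier i k)
    {K2e : C} [NonUnitalCommRingObj K2e] {π : K ⟶ K2e}
    (hπ : IsQuotientBySpan TwoEpsRelator π)
    {K2 : C} [NonUnitalCommRingObj K2] {ρ : K2e ⟶ K2}
    (hρ : IsQuotientBySpan BooleanRelator ρ) :
    ∃ c : Orbit → (K2e ⟶ M),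
      -- the homomorphisms are the ones given by commutators, and these are unique
      (∀ o, IsOrbitHom x k i π o (c o)) ∧
      (∀ o (c' : K2e ⟶ M), IsOrbitHom x k i π o c' → c' = c o) ∧
      -- the Schur multiplier is the product of the three images
      IsRegularEpi (((fst K2e (K2e ⊗ K2e) ≫ c .zero) *
        (snd K2e (K2e ⊗ K2e) ≫ fst K2e K2e ≫ c .plus)) *
          (snd K2e (K2e ⊗ K2e) ≫ snd K2e K2e ≫ c .minus)) ∧
      -- they agree on the ideal `I`, the kernel of `K2e ⟶ K2`
      (∀ {T : C} (p : T ⟶ K2e), p ≫ ρ = 0 →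
        p ≫ c .zero = p ≫ c .plus ∧ p ≫ c .plus = p ≫ c .minus) ∧
      -- `K2` is embedded in `K2e` by squares, and their product is trivial on `K2`
      ∃ s : K2 ⟶ K2e, IsRingObjHom s ∧ s ≫ ρ = 𝟙 K2 ∧ ρ ≫ s = 𝟙 K2e * 𝟙 K2e ∧
        ∀ {T : C} (q : T ⟶ K2),
          (q ≫ s ≫ c .zero) * (q ≫ s ≫ c .plus) * (q ≫ s ≫ c .minus) = 1 := by
  have hk := hM.isUniversalCentralExtension.isCentralExtension
  have hN' := hN.isSignSystem
  have hx := hSt.relations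
  have hi := mono_of_isPullback_one hM.isPullback
  have hi' := hM.isMonHom
  obtain ⟨F, hF⟩ := exists_isSymbolFamily hx hK hN' hk
  choose c hcF hc using hF.exists_orbitHom hx hK hN' hπ hi' hM.isPullback
  have hideal : ∀ o o' {T : C} (p : T ⟶ K2e), p ≫ ρ = 0 → p ≫ c o = p ≫ c o' := fun o o' {T} p hp =>
    hπ.comp_eq_of_ideal hρ hK (hc o).map_add (hc o').map_add (fun {T} r p => by
      rw [← cancel_mono i]
      simp only [Category.assoc, hcF]
      exact hF.map_ideal hx hK hN' o o' r p) p hp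
  obtain ⟨s, hs, hsρ, hρs⟩ := hπ.exists_section hρ
  refine ⟨c, hc, fun o c' h => h.unique hK hk hπ hM.isPullback (hc o),
    hM.isRegularEpi_prodHom hK hN' hSt hc, fun p hp => ⟨hideal _ _ p hp, hideal _ _ p hp⟩,
    s, hs, hsρ, hρs, fun {T} q => ?_⟩
  -- Locally q is the class of some p in K, and s sends it to the class of p², where `map_square`
  -- applies.
  obtain ⟨T₁, e₁, q', he₁, hq'⟩ := exists_local_lift hρ.isRegularEpi q
  obtain ⟨T₂, e₂, p, he₂, hp⟩ := exists_local_lift hπ.isRegularEpi q'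
  refine eq_of_cover (isRegularEpi_comp he₂ he₁) ?_
  have hq : (e₂ ≫ e₁) ≫ q ≫ s = (p * p) ≫ π := by
    rw [hπ.isHom.map_mul, hp, ← comp_mul_hom, Category.assoc, ← reassoc_of% hq', hρs,
      comp_mul_hom, Category.comp_id]
  have hq₂ : ∀ o, (e₂ ≫ e₁) ≫ q ≫ s ≫ c o = (p * p) ≫ π ≫ c o := fun o => by
    rw [← Category.assoc (p * p), ← hq]
    simp only [Category.assoc]
  rw [← cancel_mono i]
  simp only [MonObj.comp_mul, MonObj.mul_comp, hq₂, Category.assoc, hcF, MonObj.comp_one,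
    MonObj.one_comp]
  exact hF.map_square hx hK hN' p
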